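/- Let $d\ge 2$ and $f_c(z)=z^d+c$ for $c\in\mathbb{C}$. Let $K(f_c)$ be the set of points with bounded forward orbit, $J(f_c)=\partial K(f_c)$, and $\mathcal{M}_d=\{c: J(f_c)\text{ is connected}\}$. Let $\varphi_c$ be the Böttcher coordinate: the conformal map near $\infty$ with $\varphi_c(z)/z\to1$ and $\varphi_c\circ f_c=\varphi_c^d$. The dynamical ray $\mathcal{R}^c_t$ at angle $t\in\mathbb{R}/\mathbb{Z}$ is the curve $r\mapsto\varphi_c^{-1}(re^{2\pi i t})$, continued analytically from $r=\infty$ down to $r=1$ or until it meets an iterated preimage of the critical point $0$. It lands at $z$ if it is defined for all $r>1$ and $\overline{\mathcal{R}^c_t}\cap K(f_c)=\{z\}$. For $c\notin\mathcal{M}_d$, the external angle $t(c)$ is the angle of the dynamical ray of $f_c$ that passes through the critical value $c$, i.e. $\varphi_c(c)=|\varphi_c(c)|e^{2\pi i t(c)}$. The orbit portrait of a periodic orbit $z_1\mapsto z_2\mapsto\dots\mapsto z_p\mapsto z_1$ of exact period $p$ is $\{\mathcal{A}_1,\dots,\mathcal{A}_p\}$, where $\mathcal{A}_j$ is the set of the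 angles of all dynamical rays landing at $z_j$. A formal orbit portrait in degree $d$ is a collection $\mathcal{P}=\{\mathcal{A}_1,\dots,\mathcal{A}_p\}$, $p\ge1$, of subsets of $\mathbb{R}/\mathbb{Z}$ (indices modulo $p$) such that: 1. each $\mathcal{A}_j$ is a nonempty finite subset of $\mathbb{Q}/\mathbb{Z}$; 2. $\theta\mapsto d\theta$ maps $\mathcal{A}_j$ bijectively onto $\mathcal{A}_{j+1}$ and preserves the cyclic order; 3. each $\mathcal{A}_j$ is contained in an arc of length less than $1/d$; 4. all angles in $\bigcup_j\mathcal{A}_j$ are periodic under $\theta\mapsto d\theta$ with a common period $rp$, $r\ge1$; 5. for each $i$, the translates $\mathcal{A}_i+k/d$, $0\le k<d$, are pairwise unlinked, and each of them is unlinked from every $\mathcal{A}_m$ with $m\ne i$. Here two sets are unlinked if they are contained in disjoint connected subsets of $\mathbb{R}/\mathbb{Z}$. The portrait $\mathcal{P}$ is nontrivial if some $\mathcal{A}_j$ has at least two elements or $\mathcal{P}=\{\{0\}\}$. For a nontrivial $\mathcal{P}$, the characteristic arc is the shortest arc among all connected components of the sets $(\mathbb{R}/\mathbb{Z})\setminus\mathcal{A}_j$.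 **Theorem (Realizing Orbit Portraits).** Let $\mathcal{P}$ be a formal orbit portrait in degree $d\ge2$. Then there is $c\in\mathbb{C}\setminus\mathcal{M}_d$ such that $f_c$ has a repelling periodic orbit whose orbit portrait is exactly $\mathcal{P}$. If moreover $\mathcal{P}$ is nontrivial, then there are parameters $c\in\mathbb{C}\setminus\mathcal{M}_d$ whose external angle $t(c)$ lies in the characteristic arc of $\mathcal{P}$, and for every such $c$ the polynomial $f_c$ has a repelling periodic orbit whose orbit portrait is exactly $\mathcal{P}$. -/

import Mathlib

open Set Filter Topology

namespace Unicritical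

noncomputable section

/-! ### Dynamics of the unicritical polynomials `z ^ d + c` -/

/-- The unicritical polynomial `f_c(z) = z ^ d + c`. -/
def poly (d : ℕ) (c : ℂ) (z : ℂ) : ℂ := z ^ d + c

/-- The filled-in Julia set `K(f_c)`: the points with bounded forward orbit. -/
def filledJulia (d : ℕ) (c : ℂ) : Set ℂ :=
  {z | Bornology.IsBounded (range fun n : ℕ => (poly d c)^[n] z)}

/-- The Julia set `J(f_c)`: the boundary of the filled-in Julia set. -/
def julia (d : ℕ) (c : ℂ) : Set ℂ := frontier (filledJulia d c)

/-- The multibrot set `M_d`: the parameters with connected Julia set. -/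
def multibrot (d : ℕ) : Set ℂ := {c | IsConnected (julia d c)}

/-- A neighbourhood of infinity, mapped into itself by `f_c` for `d ≥ 2`, on which
`‖c / z ^ d‖ < 1 / 2`. -/
def nearInfinity (c : ℂ) : Set ℂ := {z | 2 < ‖z‖ ∧ ‖c‖ < ‖z‖}

/-- The Böttcher coordinate `φ_c` near infinity,
`φ_c(z) = z * ∏ n, (1 + c / f_c^n(z) ^ d) ^ (1 / d ^ (n + 1))` with principal roots.
On `nearInfinity c` it is the holomorphic solution of
`φ_c (f_c z) = (φ_c z) ^ d`, `φ_c(z) / z → 1` as `z → ∞`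
(it is only ever evaluated at points of `nearInfinity c`). -/
def bottcher (d : ℕ) (c : ℂ) (z : ℂ) : ℂ :=
  z * Complex.exp
    (∑' n : ℕ, Complex.log (1 + c / ((poly d c)^[n] z) ^ d) / (d : ℂ) ^ (n + 1))

/-- The point `r * e ^ (2 π i t)` of the radial line at angle `t ∈ ℝ / ℤ`. -/
def radial (r : ℝ) (t : UnitAddCircle) : ℂ := (r : ℂ) * (AddCircle.toCircle t : ℂ)

/-- `γ`, restricted to `(ρ, ∞)`, is `r ↦ φ_c⁻¹(r e ^ (2 π i t))`, where `φ_c⁻¹` is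
continued analytically from infinity down the radial line at angle `t`.
Close to infinity this is the inverse of the Böttcher coordinate. Further down, the
functional equation `φ_c (f_c^n z) = (φ_c z) ^ (d ^ n)` determines the continuation by continuity,
for as long as the curve meets no iterated preimage of the critical point `0`; at such a
preimage the continuation ends. -/
structure IsRayOn (d : ℕ) (c : ℂ) (t : UnitAddCircle) (ρ : ℝ) (γ : ℝ → ℂ) : Prop where
  continuousOn : ContinuousOn γ (Ioi ρ)
  near_infinity : ∀ᶠ r : ℝ in atTop, γ r ∈ nearInfinity c ∧ bottcher d c (γ r) = radial r t
  equation : ∀ r : ℝ, ρ < r → ∀ᶠ n : ℕ in atTop,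
    (poly d c)^[n] (γ r) ∈ nearInfinity c ∧
      bottcher d c ((poly d c)^[n] (γ r)) = radial r t ^ (d ^ n)
  not_precritical : ∀ r : ℝ, ρ < r → ∀ n : ℕ, (poly d c)^[n] (γ r) ≠ 0

/-- The dynamical ray of `f_c` at angle `t` is defined on all of `(1, ∞)` and lands at `z`:
the closure of the ray meets the filled-in Julia set exactly in `z`. -/
def RayLandsAt (d : ℕ) (c : ℂ) (t : UnitAddCircle) (z : ℂ) : Prop :=
  ∃ γ : ℝ → ℂ, IsRayOn d c t 1 γ ∧ closure (γ '' Ioi 1) ∩ filledJulia d c = {z}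

/-- `t = t(c)` is the external angle of the parameter `c`: the critical value `c` lies on the
dynamical ray of `f_c` at angle `t` (equivalently `φ_c(c) = ‖φ_c(c)‖ e ^ (2 π i t)`, where
`c ↦ φ_c(c)` is the conformal isomorphism from the complement of `M_d` onto the complement of the
closed unit disk). The ray need only be defined far enough to reach `c`. -/
def HasExternalAngle (d : ℕ) (c : ℂ) (t : UnitAddCircle) : Prop :=
  ∃ (ρ : ℝ) (γ : ℝ → ℂ), 1 ≤ ρ ∧ IsRayOn d c t ρ γ ∧ c ∈ γ '' Ioi ρ

/-- `f_c` has a repelling periodic orbit `z_0, …, z_{p-1}` of exact period `p` whose orbit portrait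
is `A_0, …, A_{p-1}`, that is, `A_j` is the set of the angles of all dynamical rays
landing at `z_j`. Indices are taken modulo `p`. -/
def HasRepellingOrbitWithPortrait (d : ℕ) (c : ℂ) {p : ℕ} (A : ZMod p → Set UnitAddCircle) :
    Prop :=
  ∃ z : ZMod p → ℂ, Function.Injective z ∧ (∀ j, poly d c (z j) = z (j + 1)) ∧
    (∀ j, 1 < ‖deriv ((poly d c)^[p]) (z j)‖) ∧
    ∀ j, A j = {t | RayLandsAt d c t (z j)}

/-! ### Formal orbit portraits -/

/-- Two sets of angles are unlinked if they lie in disjoint connected subsets of `ℝ / ℤ`. -/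
def Unlinked (B C : Set UnitAddCircle) : Prop :=
  ∃ I J : Set UnitAddCircle, IsConnected I ∧ IsConnected J ∧ Disjoint I J ∧ B ⊆ I ∧ C ⊆ J

/-- The translate `B + k / d`. -/
def rotate (d k : ℕ) (B : Set UnitAddCircle) : Set UnitAddCircle :=
  (fun θ => θ + (((k : ℝ) / (d : ℝ) : ℝ) : UnitAddCircle)) '' B

/-- Formal orbit portraits `A_0, …, A_{p-1}` in degree `d`, with indices modulo `p`. -/
structure IsFormalOrbitPortrait (d : ℕ) {p : ℕ} (A : ZMod p → Set UnitAddCircle) : Prop where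
  nonempty : ∀ j, (A j).Nonempty
  finite : ∀ j, (A j).Finite
  rational : ∀ j, ∀ θ ∈ A j, ∃ q : ℚ, θ = ((q : ℝ) : UnitAddCircle)
  bijOn : ∀ j, BijOn (fun θ => d • θ) (A j) (A (j + 1))
  cyclic_order : ∀ j, ∀ θ₁ ∈ A j, ∀ θ₂ ∈ A j, ∀ θ₃ ∈ A j,
    sbtw θ₁ θ₂ θ₃ → sbtw (d • θ₁) (d • θ₂) (d • θ₃)
  short_arc : ∀ j, ∃ (a : UnitAddCircle) (l : ℝ), l < 1 / (d : ℝ) ∧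
    A j ⊆ (fun x : ℝ => a + (x : UnitAddCircle)) '' Icc 0 l
  common_period : ∃ r : ℕ, 1 ≤ r ∧ ∀ j, ∀ θ ∈ A j,
    Function.minimalPeriod (fun x : UnitAddCircle => d • x) θ = r * p
  unlinked_translates : ∀ i, ∀ k < d, ∀ l < d, k ≠ l →
    Unlinked (rotate d k (A i)) (rotate d l (A i))
  unlinked_others : ∀ i m, i ≠ m → ∀ k < d, Unlinked (rotate d k (A i)) (A m)

/-- A portrait is nontrivial if some `A_j` has at least two elements; the portrait
`{{0}}` also counts as nontrivial. -/
def IsNontrivial {p : ℕ} (A : ZMod p → Set UnitAddCircle) : Prop :=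
  (∃ j, (A j).Nontrivial) ∨ (p = 1 ∧ A 0 = {0})

/-- The length in `(0, 1]` of the anticlockwise path from `a` to `b`
(a full turn if `a = b`). -/
def arcLength (a b : UnitAddCircle) : ℝ := (AddCircle.equivIoc 1 0 (b - a) : ℝ)

/-- The open arc `(a, b)` traversed anticlockwise from `a` to `b`
(all angles but `a` if `a = b`). -/
def openArc (a b : UnitAddCircle) : Set UnitAddCircle := {θ | arcLength a θ < arcLength a b}

/-- `(a, b)` is a complementary arc of `B`: a connected component of `(ℝ / ℤ) \ B`,
for nonempty finite `B`. -/
def IsComplementaryArc (B : Set UnitAddCircle) (a b : UnitAddCircle) : Prop :=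
  a ∈ B ∧ b ∈ B ∧ Disjoint (openArc a b) B

/-- `(a, b)` is a characteristic arc: a complementary arc of some `A_j` which is shortest among
all complementary arcs of all the `A_i`. -/
def IsCharacteristicArc {p : ℕ} (A : ZMod p → Set UnitAddCircle) (a b : UnitAddCircle) : Prop :=
  (∃ j, IsComplementaryArc (A j) a b) ∧
    ∀ i a' b', IsComplementaryArc (A i) a' b' → arcLength a b ≤ arcLength a' b'

end

end Unicritical

open Set Filter Topology

namespace Unicritical

noncomputable section

section

/-! ### The Green function -/

/-! If `c` has an external angle `t`, the critical point escapes, and `t` decides which periodic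
rays land together. The inverse Böttcher coordinate, continued as a function `Ψ` on a half-plane,
describes the basin above the potential of the critical point. After cutting the plane along the ray
from `c` to infinity, all inverse branches of `f_c` are `ξ * g` with one continuous `g` and `ξ ^ d =
1` (`exists_branch`). They map the region below the potential of `c` into a compact part of itself,
so long words in them contract geometrically, uniformly in the word (`SlitData.exists_contraction`).

Hence periodic rays that are not precritical land, and their landing points are repelling
(`SlitData.exists_lands`, `SlitData.one_lt_norm_deriv`). The preimages of `t` under multiplication
by `d` cut the circle into `d` sectors, and the itinerary of an angle records the sectors it visits.
Two periodic rays with equal itineraries are joined by an equipotential arc that shrinks to a point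
under pull-back (`SlitData.lands_unique`). Conversely, a landing point remembers the itinerary of
each ray landing there (`SlitData.symbol_eq_of_mem_closure`). What remains is to show that every
part of the portrait is a full itinerary class (`hasRepellingOrbitWithPortrait_of_itinerary`).

Let `t` lie in the characteristic arc `(a, b)` of a portrait whose parts have at least two angles.
Removing the preimages of `(a, b)` leaves `d` translates of a short arc `[b', a']`. Unlinkedness
puts each part into a single translate, and each translate lies in one sector
(`notMem_openArc_and_sameSector`). So a part has only one itinerary.

Conversely, multiplication by `d` permutes the gaps of the itinerary classes, and the image of a gap
is `d` times as long or contains `t`. The shortest gap of an orbit of gaps therefore contains `t`.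
Comparing gaps around `t` shows that the class with the shortest gap of all lies in one orbit as
soon as it has three elements (`IsPeriodicSystem.exists_eq_pow_nsmul`). Its gaps are then permuted
transitively, and unlinkedness makes neighbouring angles belong to the same part, so the class is
one part (`exists_class_subset`). Iteration carries this to the other parts.

For `{{0}}` it suffices that itineraries separate fixed angles. For the other portraits with
singleton parts one takes `t = 0`, where itineraries are base `d` expansions. Parameters with any
given external angle are found on a large circle by the intermediate value theorem, and `2 < ‖c‖`
makes the Julia set disconnected. -/

theorem continuous_poly (d : ℕ) (c : ℂ) : Continuous (poly d c) := by
  unfold poly; fun_prop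

theorem continuous_poly_iterate (d : ℕ) (c : ℂ) (n : ℕ) : Continuous (poly d c)^[n] :=
  (continuous_poly d c).iterate n

/-- The `n`-th term of the telescoping series of the Green function. -/
def greenTerm (d : ℕ) (c z : ℂ) (n : ℕ) : ℝ :=
  Real.posLog ‖(poly d c)^[n + 1] z‖ / (d : ℝ) ^ (n + 1)
      - Real.posLog ‖(poly d c)^[n] z‖ / (d : ℝ) ^ n

/-- The Green function of the filled-in Julia set of `poly d c`, as a telescoping series. -/
def green (d : ℕ) (c z : ℂ) : ℝ := Real.posLog ‖z‖ + ∑' n : ℕ, greenTerm d c z n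

/-- A bound for the distance of the Green function to `log⁺`. -/
def greenBound (c : ℂ) : ℝ := Real.posLog ‖c‖ + Real.log 2

/-- The inequality `log⁺ ‖u + v‖ ≤ log⁺ ‖u‖ + log⁺ ‖v‖ + log 2` is applied twice, to `z ^ d + c` and
to `z ^ d = (z ^ d + c) + (-c)`. -/
theorem abs_posLog_poly_sub_le (d : ℕ) (c z : ℂ) :
    |Real.posLog ‖poly d c z‖ - d * Real.posLog ‖z‖| ≤ greenBound c := by
  have h1 := Real.posLog_norm_add_le (z ^ d) c
  have h2 := Real.posLog_norm_add_le (z ^ d + c) (-c)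
  rw [add_neg_cancel_right, norm_neg] at h2
  rw [norm_pow, Real.posLog_pow] at h1 h2
  unfold greenBound poly
  rw [abs_le]
  constructor <;> linarith

variable {d : ℕ} {c : ℂ}

theorem norm_greenTerm_le (hd : 2 ≤ d) (c z : ℂ) (n : ℕ) :
    ‖greenTerm d c z n‖ ≤ greenBound c / 2 / 2 ^ n := by
  have hd' : (2 : ℝ) ≤ d := by exact_mod_cast hd
  have h := abs_posLog_poly_sub_le d c ((poly d c)^[n] z)
  have h0 : 0 ≤ greenBound c := (abs_nonneg _).trans h
  have e : greenTerm d c z n = (Real.posLog ‖poly d c ((poly d c)^[n] z)‖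
      - d * Real.posLog ‖(poly d c)^[n] z‖) / (d : ℝ) ^ (n + 1) := by
    unfold greenTerm
    rw [Function.iterate_succ_apply']
    field_simp
    ring
  rw [e, Real.norm_eq_abs, abs_div, abs_of_pos (by positivity : (0 : ℝ) < (d : ℝ) ^ (n + 1)),
    div_div, ← pow_succ']
  gcongr

theorem greenBound_nonneg (c : ℂ) : 0 ≤ greenBound c :=
  (abs_nonneg _).trans (abs_posLog_poly_sub_le 2 c 0)

theorem summable_greenTerm (hd : 2 ≤ d) (c z : ℂ) : Summable (greenTerm d c z) :=
  .of_norm_bounded (hasSum_geometric_two' (greenBound c)).summable (norm_greenTerm_le hd c z)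

theorem abs_green_sub_le (hd : 2 ≤ d) (c z : ℂ) :
    |green d c z - Real.posLog ‖z‖| ≤ greenBound c := by
  have := tsum_of_norm_bounded (hasSum_geometric_two' (greenBound c)) (norm_greenTerm_le hd c z)
  simpa [green] using this

theorem continuous_green (hd : 2 ≤ d) (c : ℂ) : Continuous (green d c) := by
  unfold green
  refine (Real.continuous_posLog.comp continuous_norm).add ?_
  refine continuous_tsum (fun n => ?_) (hasSum_geometric_two' (greenBound c)).summable
    (fun n z => norm_greenTerm_le hd c z n)
  unfold greenTerm
  have h1 := continuous_poly_iterate d c (n + 1)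
  have h2 := continuous_poly_iterate d c n
  fun_prop

theorem tendsto_green (hd : 2 ≤ d) (c z : ℂ) :
    Tendsto (fun n : ℕ => Real.posLog ‖(poly d c)^[n] z‖ / (d : ℝ) ^ n) atTop
      (𝓝 (green d c z)) := by
  have h := (summable_greenTerm hd c z).hasSum.tendsto_sum_nat
  have h2 := h.const_add (Real.posLog ‖z‖)
  refine h2.congr (fun n => ?_)
  unfold greenTerm
  rw [Finset.sum_range_sub (fun n => Real.posLog ‖(poly d c)^[n] z‖ / (d : ℝ) ^ n)]
  simp

theorem green_poly (hd : 2 ≤ d) (c z : ℂ) : green d c (poly d c z) = d * green d c z := by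
  have h1 := tendsto_green hd c (poly d c z)
  have h2 := ((tendsto_green hd c z).comp (tendsto_add_atTop_nat 1)).const_mul (d : ℝ)
  refine tendsto_nhds_unique h1 (h2.congr (fun n => ?_))
  have hd' : (d : ℝ) ≠ 0 := by positivity
  simp only [Function.comp_apply, Function.iterate_succ_apply]
  field_simp
  ring

theorem green_poly_iterate (hd : 2 ≤ d) (c z : ℂ) (n : ℕ) :
    green d c ((poly d c)^[n] z) = (d : ℝ) ^ n * green d c z := by
  induction n with
  | zero => simp
  | succ n ih => rw [Function.iterate_succ_apply', green_poly hd, ih]; ring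

theorem green_nonneg (hd : 2 ≤ d) (c z : ℂ) : 0 ≤ green d c z :=
  ge_of_tendsto' (tendsto_green hd c z) fun n => div_nonneg Real.posLog_nonneg (by positivity)

theorem norm_le_exp_posLog (z : ℂ) : ‖z‖ ≤ Real.exp (Real.posLog ‖z‖) := by
  by_cases h : ‖z‖ = 0
  · rw [h]; positivity
  · calc ‖z‖ = Real.exp (Real.log ‖z‖) := (Real.exp_log (by positivity)).symm
      _ ≤ _ := Real.exp_le_exp.2 (le_max_right _ _)

theorem norm_le_of_green_le (hd : 2 ≤ d) {c z : ℂ} {a : ℝ} (h : green d c z ≤ a) :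
    ‖z‖ ≤ Real.exp (a + greenBound c) := by
  refine (norm_le_exp_posLog z).trans (Real.exp_le_exp.2 ?_)
  have := abs_le.1 (abs_green_sub_le hd c z)
  linarith

theorem isCompact_green_le (hd : 2 ≤ d) (c : ℂ) (a : ℝ) : IsCompact {z | green d c z ≤ a} := by
  refine Metric.isCompact_of_isClosed_isBounded
    (isClosed_le (continuous_green hd c) continuous_const) ?_
  refine (Metric.isBounded_closedBall (x := (0 : ℂ)) (r := Real.exp (a + greenBound c))).subset ?_
  intro z hz
  simpa using norm_le_of_green_le hd hz

/-- Along a bounded orbit `log⁺` is bounded and disappears after division by `d ^ n`. Conversely,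
potential `0` persists along the orbit and confines it to one disc. -/
theorem mem_filledJulia_iff (hd : 2 ≤ d) {c z : ℂ} : z ∈ filledJulia d c ↔ green d c z = 0 := by
  have hd' : (2 : ℝ) ≤ d := by exact_mod_cast hd
  constructor
  · intro h
    obtain ⟨C, hC⟩ := Bornology.IsBounded.exists_norm_le (mem_ofPred_eq ▸ h)
    have hb : ∀ n : ℕ, Real.posLog ‖(poly d c)^[n] z‖ / (d : ℝ) ^ n ≤ Real.posLog C / 2 ^ n := by
      intro n
      have := Real.posLog_le_posLog (norm_nonneg _) (hC _ (mem_range_self n))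
      have h0 : 0 ≤ Real.posLog C := Real.posLog_nonneg
      gcongr
    have ht : Tendsto (fun n : ℕ => Real.posLog C / 2 ^ n) atTop (𝓝 0) :=
      tendsto_const_nhds.div_atTop (tendsto_pow_atTop_atTop_of_one_lt one_lt_two)
    exact le_antisymm (le_of_tendsto_of_tendsto' (tendsto_green hd c z) ht hb)
      (green_nonneg hd c z)
  · intro h
    refine (Metric.isBounded_closedBall (x := (0 : ℂ)) (r := Real.exp (0 + greenBound c))).subset ?_
    rintro _ ⟨n, rfl⟩
    have : green d c ((poly d c)^[n] z) ≤ 0 := by rw [green_poly_iterate hd, h, mul_zero]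
    simpa using norm_le_of_green_le hd this

/-- A bounded error is killed by division by `d ^ n`, so any quantity that scales exactly by `d`
along the orbit and stays close to `log⁺` computes the Green function. -/
theorem green_eq_of_tendsto {z : ℂ} {a : ℝ} {u : ℕ → ℝ} (hd : 2 ≤ d)
    (hu : ∀ᶠ n in atTop, |Real.posLog ‖(poly d c)^[n] z‖ - u n| ≤ 1)
    (ha : ∀ n, u n = (d : ℝ) ^ n * a) : green d c z = a := by
  have hd' : (2 : ℝ) ≤ d := by exact_mod_cast hd
  have h1 : Tendsto (fun n : ℕ => 1 / (d : ℝ) ^ n) atTop (𝓝 0) :=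
    tendsto_const_nhds.div_atTop (tendsto_pow_atTop_atTop_of_one_lt (by linarith))
  have h2 : Tendsto (fun n : ℕ => Real.posLog ‖(poly d c)^[n] z‖ / (d : ℝ) ^ n - a) atTop
      (𝓝 0) := by
    refine squeeze_zero_norm' (hu.mono fun n hn => ?_) h1
    have hpos : (0 : ℝ) < (d : ℝ) ^ n := by positivity
    rw [ha] at hn
    have : Real.posLog ‖(poly d c)^[n] z‖ / (d : ℝ) ^ n - a
      = (Real.posLog ‖(poly d c)^[n] z‖ - (d : ℝ) ^ n * a) / (d : ℝ) ^ n := by field_simp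
    rw [this, Real.norm_eq_abs, abs_div, abs_of_pos hpos]
    gcongr
  have h3 := (tendsto_green hd c z).sub_const a
  have := tendsto_nhds_unique h3 h2
  linarith

end

section

/-! ### The Böttcher coordinate far from the filled-in Julia set -/

/-- The exponent in the product formula of the Böttcher coordinate. -/
def bottcherExponent (d : ℕ) (c z : ℂ) : ℂ :=
  ∑' n : ℕ, Complex.log (1 + c / ((poly d c)^[n] z) ^ d) / (d : ℂ) ^ (n + 1)

theorem bottcher_eq (d : ℕ) (c z : ℂ) :
    bottcher d c z = z * Complex.exp (bottcherExponent d c z) := rfl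

/-- A neighbourhood of infinity on which the iterates of `poly d c` grow geometrically and the
exponent of the Böttcher coordinate is small. -/
def IsFar (c z : ℂ) : Prop := 4 ≤ ‖z‖ ∧ 8 * ‖c‖ ≤ ‖z‖ ^ 2

variable {d : ℕ} {c z : ℂ}

theorem IsFar.of_norm_le {w : ℂ} (hz : IsFar c z) (h : ‖z‖ ≤ ‖w‖) : IsFar c w :=
  ⟨hz.1.trans h, hz.2.trans (by gcongr)⟩

theorem IsFar.ne_zero (hz : IsFar c z) : z ≠ 0 := by
  rintro rfl
  have := hz.1
  simp at this
  linarith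

theorem IsFar.sq_le_norm_pow (hd : 2 ≤ d) (hz : IsFar c z) : ‖z‖ ^ 2 ≤ ‖z‖ ^ d :=
  pow_le_pow_right₀ (by linarith [hz.1]) hd

theorem IsFar.two_mul_norm_le (hd : 2 ≤ d) (hz : IsFar c z) : 2 * ‖z‖ ≤ ‖poly d c z‖ := by
  have h1 := hz.sq_le_norm_pow hd
  have h2 : ‖z ^ d‖ - ‖c‖ ≤ ‖z ^ d + c‖ := by
    have := norm_sub_le (z ^ d + c) c
    rw [add_sub_cancel_right] at this
    linarith
  rw [norm_pow] at h2
  have := hz.1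
  have := hz.2
  unfold poly
  nlinarith

theorem IsFar.norm_le_norm_poly (hd : 2 ≤ d) (hz : IsFar c z) : ‖z‖ ≤ ‖poly d c z‖ := by
  linarith [hz.two_mul_norm_le hd, norm_nonneg z]

theorem IsFar.poly (hd : 2 ≤ d) (hz : IsFar c z) : IsFar c (poly d c z) :=
  hz.of_norm_le (hz.norm_le_norm_poly hd)

theorem IsFar.poly_iterate (hd : 2 ≤ d) (hz : IsFar c z) (n : ℕ) :
    IsFar c ((Unicritical.poly d c)^[n] z) := by
  induction n with
  | zero => exact hz
  | succ n ih => rw [Function.iterate_succ_apply']; exact ih.poly hd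

theorem IsFar.norm_div_pow_le (hd : 2 ≤ d) (hz : IsFar c z) : ‖c / z ^ d‖ ≤ 1 / 8 := by
  have h1 := hz.sq_le_norm_pow hd
  have h2 := hz.2
  have h3 := hz.1
  rw [norm_div, norm_pow, div_le_iff₀ (by positivity)]
  linarith

theorem IsFar.one_add_mem_slitPlane (hd : 2 ≤ d) (hz : IsFar c z) :
    1 + c / z ^ d ∈ Complex.slitPlane :=
  Complex.mem_slitPlane_of_norm_lt_one ((hz.norm_div_pow_le hd).trans_lt (by norm_num))

theorem IsFar.norm_log_le (hd : 2 ≤ d) (hz : IsFar c z) :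
    ‖Complex.log (1 + c / z ^ d)‖ ≤ 3 / 16 := by
  have := hz.norm_div_pow_le hd
  have := Complex.norm_log_one_add_half_le_self (z := c / z ^ d) (by linarith)
  linarith

theorem IsFar.norm_term_le (hd : 2 ≤ d) (hz : IsFar c z) (n : ℕ) :
    ‖Complex.log (1 + c / ((Unicritical.poly d c)^[n] z) ^ d) / (d : ℂ) ^ (n + 1)‖
      ≤ 3 / 16 / 2 / 2 ^ n := by
  have hd' : (2 : ℝ) ≤ d := by exact_mod_cast hd
  rw [norm_div, norm_pow, Complex.norm_natCast, div_div, ← pow_succ']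
  have := (hz.poly_iterate hd n).norm_log_le hd
  gcongr

theorem IsFar.summable (hd : 2 ≤ d) (hz : IsFar c z) : Summable fun n : ℕ =>
    Complex.log (1 + c / ((Unicritical.poly d c)^[n] z) ^ d) / (d : ℂ) ^ (n + 1) :=
  .of_norm_bounded (hasSum_geometric_two' (3 / 16)).summable (hz.norm_term_le hd)

theorem IsFar.norm_bottcherExponent_le (hd : 2 ≤ d) (hz : IsFar c z) :
    ‖bottcherExponent d c z‖ ≤ 3 / 16 :=
  tsum_of_norm_bounded (hasSum_geometric_two' (3 / 16)) (hz.norm_term_le hd)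

/-- Splitting off the first term of the series turns `d` times the exponent at `z` into `log (1 + c
/ z ^ d)` plus the exponent at `f_c(z)`, and `z ^ d * (1 + c / z ^ d) = f_c(z)`. -/
theorem IsFar.bottcher_poly (hd : 2 ≤ d) (hz : IsFar c z) :
    bottcher d c (Unicritical.poly d c z) = bottcher d c z ^ d := by
  have hd' : (d : ℂ) ≠ 0 := by exact_mod_cast (by omega : d ≠ 0)
  have hz0 := hz.ne_zero
  have h1 : d * bottcherExponent d c z
      = Complex.log (1 + c / z ^ d) + bottcherExponent d c (Unicritical.poly d c z) := by
    unfold bottcherExponent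
    rw [(hz.summable hd).tsum_eq_zero_add, mul_add, ← tsum_mul_left]
    congr 1
    · simp; field_simp
    · refine tsum_congr fun n => ?_
      rw [Function.iterate_succ_apply]
      field_simp
      ring
  have h2 : 1 + c / z ^ d ≠ 0 := Complex.slitPlane_ne_zero (hz.one_add_mem_slitPlane hd)
  rw [bottcher_eq, bottcher_eq, mul_pow, ← Complex.exp_nat_mul, h1, Complex.exp_add,
    Complex.exp_log h2, ← mul_assoc]
  congr 1
  unfold Unicritical.poly
  field_simp

theorem IsFar.bottcher_poly_iterate (hd : 2 ≤ d) (hz : IsFar c z) (n : ℕ) :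
    bottcher d c ((Unicritical.poly d c)^[n] z) = bottcher d c z ^ d ^ n := by
  induction n with
  | zero => simp
  | succ n ih =>
    rw [Function.iterate_succ_apply', (hz.poly_iterate hd n).bottcher_poly hd, ih, ← pow_mul,
      pow_succ]

theorem poly_mul_of_pow_eq_one {w : ℂ} (hw : w ^ d = 1) (z : ℂ) :
    poly d c (w * z) = poly d c z := by
  unfold poly; rw [mul_pow, hw, one_mul]

/-- Every term of the exponent depends on `z` only through `z ^ d`. -/
theorem bottcher_mul_of_pow_eq_one {w : ℂ} (hw : w ^ d = 1) (z : ℂ) :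
    bottcher d c (w * z) = w * bottcher d c z := by
  have : bottcherExponent d c (w * z) = bottcherExponent d c z := by
    refine tsum_congr fun n => ?_
    cases n with
    | zero => simp [mul_pow, hw]
    | succ n => rw [Function.iterate_succ_apply, poly_mul_of_pow_eq_one hw,
        ← Function.iterate_succ_apply]
  rw [bottcher_eq, bottcher_eq, this, mul_assoc]

theorem IsFar.abs_log_norm_bottcher_sub_le (hd : 2 ≤ d) (hz : IsFar c z) :
    |Real.log ‖z‖ - Real.log ‖bottcher d c z‖| ≤ 3 / 16 := by
  have h0 := hz.ne_zero
  rw [bottcher_eq, norm_mul, Real.log_mul (by simpa) (by simp), Complex.norm_exp, Real.log_exp]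
  have := (Complex.abs_re_le_norm _).trans (hz.norm_bottcherExponent_le hd)
  rw [sub_add_cancel_left, abs_neg]
  exact this

theorem IsFar.log_norm_bottcher (hd : 2 ≤ d) (hz : IsFar c z) :
    Real.log ‖bottcher d c z‖ = green d c z := by
  refine (green_eq_of_tendsto hd (u := fun n =>
    Real.log ‖bottcher d c ((Unicritical.poly d c)^[n] z)‖) (.of_forall fun n => ?_)
    fun n => ?_).symm
  · have hn := hz.poly_iterate hd n
    rw [Real.posLog_eq_log (by rw [abs_of_nonneg (norm_nonneg _)]; linarith [hn.1])]
    linarith [hn.abs_log_norm_bottcher_sub_le hd]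
  · simp only [hz.bottcher_poly_iterate hd n, norm_pow, Real.log_pow]
    push_cast
    ring

/-- Rays are defined through `nearInfinity`, while the estimates need `IsFar`. The modulus grows at
each step at least by the constant factor `‖z‖ - 1 > 1`, so an orbit in the former region ends up in
the latter. -/
theorem eventually_isFar_of_mem_nearInfinity (hd : 2 ≤ d) (hz : z ∈ nearInfinity c) :
    ∀ᶠ n in atTop, IsFar c ((poly d c)^[n] z) := by
  obtain ⟨h1, h2⟩ : 2 < ‖z‖ ∧ ‖c‖ < ‖z‖ := hz
  have step : ∀ w : ℂ, ‖z‖ ≤ ‖w‖ → (‖z‖ - 1) * ‖w‖ ≤ ‖poly d c w‖ := by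
    intro w hw
    have h3 : ‖w ^ d‖ - ‖c‖ ≤ ‖w ^ d + c‖ := by
      have := norm_sub_le (w ^ d + c) c
      rw [add_sub_cancel_right] at this
      linarith
    have h4 : ‖w‖ ^ 2 ≤ ‖w‖ ^ d := pow_le_pow_right₀ (by linarith) hd
    rw [norm_pow] at h3
    unfold poly
    nlinarith
  have key : ∀ n, (‖z‖ - 1) ^ n * ‖z‖ ≤ ‖(poly d c)^[n] z‖ := by
    intro n
    induction n with
    | zero => simp
    | succ n ih =>
      have h5 : ‖z‖ ≤ ‖(poly d c)^[n] z‖ :=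
        (le_mul_of_one_le_left (norm_nonneg _) (one_le_pow₀ (by linarith))).trans ih
      rw [Function.iterate_succ_apply', pow_succ', mul_assoc]
      exact (mul_le_mul_of_nonneg_left ih (by linarith)).trans (step _ h5)
  have ht : Tendsto (fun n => ‖(poly d c)^[n] z‖) atTop atTop :=
    tendsto_atTop_mono key
      ((tendsto_pow_atTop_atTop_of_one_lt (by linarith)).atTop_mul_const (by linarith))
  filter_upwards [ht.eventually_ge_atTop (max 4 (8 * ‖c‖))] with n hn
  have h6 := (le_max_left _ _).trans hn
  have h7 := (le_max_right _ _).trans hn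
  exact ⟨h6, by nlinarith⟩

/-! ### The inverse of the Böttcher coordinate -/

/-- The exponent of the Böttcher coordinate in logarithmic coordinates. -/
def logExponent (d : ℕ) (c η : ℂ) : ℂ := bottcherExponent d c (Complex.exp η)

/-- `X` is so large that `exp η` is far for `X ≤ re η`. -/
def IsFarLog (c : ℂ) (X : ℝ) : Prop := 4 ≤ Real.exp X ∧ 8 * ‖c‖ ≤ Real.exp X ^ 2

theorem exists_isFarLog (c : ℂ) : ∃ X, IsFarLog c X := by
  have h1 := Real.tendsto_exp_atTop.eventually_ge_atTop (max 4 (8 * ‖c‖))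
  obtain ⟨X, hX⟩ := h1.exists
  have h6 := (le_max_left _ _).trans hX
  have h7 := (le_max_right _ _).trans hX
  exact ⟨X, h6, by nlinarith⟩

variable {X : ℝ}

theorem IsFarLog.isFar_exp (hX : IsFarLog c X) {η : ℂ} (h : X ≤ η.re) :
    IsFar c (Complex.exp η) := by
  have : Real.exp X ≤ ‖Complex.exp η‖ := by rw [Complex.norm_exp]; gcongr
  exact ⟨hX.1.trans this, hX.2.trans (by gcongr)⟩

theorem IsFarLog.pos (hX : IsFarLog c X) : 0 < X := by
  by_contra! h
  have := Real.exp_le_exp.2 h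
  rw [Real.exp_zero] at this
  linarith [hX.1]

theorem IsFarLog.differentiableOn (hd : 2 ≤ d) (hX : IsFarLog c X) :
    DifferentiableOn ℂ (logExponent d c) {η | X < η.re} := by
  refine Complex.differentiableOn_tsum_of_summable_norm
    (F := fun n η => Complex.log (1 + c / ((poly d c)^[n] (Complex.exp η)) ^ d)
      / (d : ℂ) ^ (n + 1))
    (hasSum_geometric_two' (3 / 16)).summable ?_
    (isOpen_lt continuous_const Complex.continuous_re) ?_
  · intro n η hη
    have hf := (hX.isFar_exp hη.le).poly_iterate hd n
    have hp : Differentiable ℂ (poly d c) := by unfold poly; fun_prop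
    have hp' : DifferentiableAt ℂ (fun η => (poly d c)^[n] (Complex.exp η)) η :=
      ((hp.iterate n).comp Complex.differentiable_exp).differentiableAt
    refine DifferentiableAt.differentiableWithinAt ?_
    have hq : DifferentiableAt ℂ (fun η => 1 + c / ((poly d c)^[n] (Complex.exp η)) ^ d) η :=
      (differentiableAt_const _).add ((differentiableAt_const _).div (hp'.pow d)
        (pow_ne_zero _ hf.ne_zero))
    exact (hq.clog (hf.one_add_mem_slitPlane hd)).div_const _
  · intro n η hη
    exact (hX.isFar_exp (le_of_lt hη)).norm_term_le hd n

theorem IsFarLog.norm_logExponent_le (hd : 2 ≤ d) (hX : IsFarLog c X) {η : ℂ} (h : X ≤ η.re) :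
    ‖logExponent d c η‖ ≤ 3 / 16 :=
  (hX.isFar_exp h).norm_bottcherExponent_le hd

/-- Cauchy's estimate on discs of radius `1` turns the bound `3 / 16` on the exponent into a bound
on its derivative; hence the margin of `1` in the real part. -/
theorem IsFarLog.lipschitz (hd : 2 ≤ d) (hX : IsFarLog c X) {η₁ η₂ : ℂ} (h₁ : X + 1 < η₁.re)
    (h₂ : X + 1 < η₂.re) :
    ‖logExponent d c η₁ - logExponent d c η₂‖ ≤ 1 / 4 * ‖η₁ - η₂‖ := by
  have hop : IsOpen {η : ℂ | X < η.re} := isOpen_lt continuous_const Complex.continuous_re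
  refine Convex.norm_image_sub_le_of_norm_deriv_le (s := {η : ℂ | X + 1 < η.re})
    (fun η hη => ?_) (fun η hη => ?_) (convex_halfSpace_re_gt _) h₂ h₁
  · have hη' : X + 1 < η.re := hη
    exact (hX.differentiableOn hd).differentiableAt
      (hop.mem_nhds (show X < η.re by linarith))
  · have hη' : X + 1 < η.re := hη
    have hsub : ∀ w ∈ Metric.closedBall η 1, X < w.re := by
      intro w hw
      have := (Complex.abs_re_le_norm (w - η)).trans (by simpa [dist_eq_norm] using hw)
      rw [Complex.sub_re] at this
      linarith [(abs_le.1 this).1]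
    have := Complex.norm_deriv_le_of_forall_mem_sphere_norm_le (c := η) (R := 1) (C := 3 / 16)
      (f := logExponent d c) one_pos
      (((hX.differentiableOn hd).mono hsub).diffContOnCl_ball subset_rfl)
      (fun w hw => hX.norm_logExponent_le hd (hsub w (Metric.sphere_subset_closedBall hw)).le)
    linarith

theorem IsFarLog.norm_sub_le (hd : 2 ≤ d) (hX : IsFarLog c X) {η₁ η₂ : ℂ} (h₁ : X + 1 < η₁.re)
    (h₂ : X + 1 < η₂.re) :
    ‖η₁ - η₂‖ ≤ 2 * ‖(η₁ + logExponent d c η₁) - (η₂ + logExponent d c η₂)‖ := by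
  have h := hX.lipschitz hd h₁ h₂
  have h3 := _root_.norm_sub_le ((η₁ + logExponent d c η₁) - (η₂ + logExponent d c η₂))
    (logExponent d c η₁ - logExponent d c η₂)
  rw [show (η₁ + logExponent d c η₁) - (η₂ + logExponent d c η₂)
    - (logExponent d c η₁ - logExponent d c η₂) = η₁ - η₂ by ring] at h3
  linarith [norm_nonneg (η₁ - η₂)]

/-- The solution is the fixed point of the contraction `η ↦ ζ - logExponent d c η`, which preserves
the half-plane `s` because the exponent is smaller than `1 / 2`. -/
theorem IsFarLog.exists_add_logExponent_eq (hd : 2 ≤ d) (hX : IsFarLog c X) {ζ : ℂ}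
    (hζ : X + 2 < ζ.re) :
    ∃ η : ℂ, X + 1 < η.re ∧ η + logExponent d c η = ζ := by
  set s : Set ℂ := {η | ζ.re - 1 / 2 ≤ η.re}
  have hs : ∀ η ∈ s, X + 1 < η.re := fun η (hη : ζ.re - 1 / 2 ≤ η.re) => by linarith
  have hmap : MapsTo (fun η => ζ - logExponent d c η) s s := by
    intro η hη
    have := (Complex.abs_re_le_norm _).trans
      (hX.norm_logExponent_le hd (by linarith [hs η hη] : X ≤ η.re))
    show ζ.re - 1 / 2 ≤ (ζ - logExponent d c η).re
    rw [Complex.sub_re]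
    linarith [(abs_le.1 this).2]
  have hcl : IsClosed s := isClosed_le continuous_const Complex.continuous_re
  have hc : ContractingWith (1 / 4) (hmap.restrict _ s s) := by
    refine ⟨by
      rw [← NNReal.coe_lt_coe]; norm_num, LipschitzWith.of_dist_le_mul fun x y => ?_⟩
    rw [Subtype.dist_eq, Subtype.dist_eq, dist_eq_norm, dist_eq_norm]
    simp only [MapsTo.val_restrict_apply, sub_sub_sub_cancel_left]
    rw [norm_sub_rev]
    have := hX.lipschitz hd (hs x x.2) (hs y y.2)
    simpa using this
  have hz : ζ ∈ s := show ζ.re - 1 / 2 ≤ ζ.re by linarith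
  obtain ⟨y, hy, hfix, -⟩ := hc.exists_fixedPoint' hcl.isComplete hmap hz (edist_ne_top _ _)
  refine ⟨y, hs y hy, ?_⟩
  have : ζ - logExponent d c y = y := hfix
  rw [← this]
  nth_rewrite 2 [this]
  ring

theorem bottcher_exp (d : ℕ) (c η : ℂ) :
    bottcher d c (Complex.exp η) = Complex.exp (η + logExponent d c η) := by
  rw [bottcher_eq, Complex.exp_add]; rfl

/-- In logarithmic coordinates the values agree up to a multiple of `2 π i`. The exponent is
periodic, so this multiple can be moved into the argument, where `IsFarLog.norm_sub_le` gives
injectivity. -/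
theorem IsFarLog.bottcher_injective (hd : 2 ≤ d) (hX : IsFarLog c X) {z w : ℂ}
    (hz : Real.exp (X + 1) < ‖z‖) (hw : Real.exp (X + 1) < ‖w‖)
    (h : bottcher d c z = bottcher d c w) : z = w := by
  have hz0 : z ≠ 0 := norm_pos_iff.1 ((Real.exp_pos _).trans hz)
  have hw0 : w ≠ 0 := norm_pos_iff.1 ((Real.exp_pos _).trans hw)
  rw [← Complex.exp_log hz0, ← Complex.exp_log hw0, bottcher_exp, bottcher_exp,
    Complex.exp_eq_exp_iff_exists_int] at h
  obtain ⟨n, hn⟩ := h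
  have he : Complex.exp (Complex.log w + n * (2 * Real.pi * Complex.I)) = w := by
    rw [Complex.exp_add, Complex.exp_int_mul_two_pi_mul_I, mul_one, Complex.exp_log hw0]
  have hper : logExponent d c (Complex.log w + n * (2 * Real.pi * Complex.I))
      = logExponent d c (Complex.log w) := by
    unfold logExponent
    rw [he, Complex.exp_log hw0]
  have hre1 : X + 1 < (Complex.log z).re := by
    rw [Complex.log_re, Real.lt_log_iff_exp_lt ((Real.exp_pos _).trans hz)]; exact hz
  have hre2 : X + 1 < (Complex.log w + n * (2 * Real.pi * Complex.I)).re := by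
    have : X + 1 < (Complex.log w).re := by
      rw [Complex.log_re, Real.lt_log_iff_exp_lt ((Real.exp_pos _).trans hw)]; exact hw
    simpa using this
  have := hX.norm_sub_le hd hre1 hre2
  rw [hper, hn, add_right_comm, sub_self, norm_zero, mul_zero] at this
  have := sub_eq_zero.1 (norm_le_zero_iff.1 this)
  rw [← he, ← this, Complex.exp_log hz0]

end

section

/-! ### Parametrization of the basin of infinity by a half-plane -/

theorem countable_setOf_pow_eq_one : {w : ℂ | ∃ n : ℕ, n ≠ 0 ∧ w ^ n = 1}.Countable := by
  have : {w : ℂ | ∃ n : ℕ, n ≠ 0 ∧ w ^ n = 1} = ⋃ n : ℕ, {w : ℂ | n ≠ 0 ∧ w ^ n = 1} := by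
    ext; simp
  rw [this]
  refine countable_iUnion fun n => ?_
  rcases Nat.eq_zero_or_pos n with rfl | hn
  · simp
  · refine ((Polynomial.nthRootsFinset n (1 : ℂ)).finite_toSet.subset ?_).countable
    intro w hw
    simpa [Polynomial.mem_nthRootsFinset hn] using hw.2

/-- Two continuous functions on a preconnected set which agree up to roots of unity and agree
at one point are equal. -/
theorem eqOn_of_pow_eq_pow {α : Type*} [TopologicalSpace α] {s : Set α} (hs : IsPreconnected s)
    {f g : α → ℂ} (hf : ContinuousOn f s) (hg : ContinuousOn g s) (hg0 : ∀ x ∈ s, g x ≠ 0)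
    (hfg : ∀ x ∈ s, ∃ n : ℕ, n ≠ 0 ∧ f x ^ n = g x ^ n) {x₀ : α} (hx₀ : x₀ ∈ s)
    (h₀ : f x₀ = g x₀) : EqOn f g s := by
  intro x hx
  -- The quotient takes values in the roots of unity, a countable and thus totally disconnected set,
  -- so it is constant.
  have himg : (fun x => f x / g x) '' s ⊆ {w : ℂ | ∃ n : ℕ, n ≠ 0 ∧ w ^ n = 1} := by
    rintro _ ⟨y, hy, rfl⟩
    obtain ⟨n, hn, he⟩ := hfg y hy
    exact ⟨n, hn, by rw [div_pow, he, div_self (pow_ne_zero _ (hg0 y hy))]⟩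
  have hsub := countable_setOf_pow_eq_one.isTotallyDisconnected _ himg
    (hs.image _ (hf.div hg hg0))
  have := hsub (mem_image_of_mem _ hx) (mem_image_of_mem _ hx₀)
  simp only [h₀, div_self (hg0 x₀ hx₀)] at this
  exact (div_eq_one_iff_eq (hg0 x hx)).1 this

/-- `Ψ` is the inverse of the Böttcher coordinate in logarithmic coordinates, continued to the
half-plane `X < re ζ`. -/
structure IsParam (d : ℕ) (c : ℂ) (X : ℝ) (Ψ : ℂ → ℂ) : Prop where
  continuousOn : ContinuousOn Ψ {ζ | X < ζ.re}
  eventually : ∃ Y, ∀ ζ : ℂ, Y < ζ.re →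
    Ψ ζ ∈ nearInfinity c ∧ IsFar c (Ψ ζ) ∧ bottcher d c (Ψ ζ) = Complex.exp ζ
  map_mul : ∀ ζ : ℂ, X < ζ.re → poly d c (Ψ ζ) = Ψ (d * ζ)
  rotate : ∀ ζ : ℂ, X < ζ.re → Ψ (ζ + 2 * Real.pi * Complex.I / d)
    = Complex.exp (2 * Real.pi * Complex.I / d) * Ψ ζ
  exp_eq : ∀ ζ ζ' : ℂ, X < ζ.re → X < ζ'.re → Ψ ζ = Ψ ζ' → Complex.exp ζ = Complex.exp ζ'

variable {d : ℕ} {c : ℂ} {X : ℝ} {Ψ : ℂ → ℂ}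

theorem natCast_mul_re (n : ℕ) (ζ : ℂ) : ((n : ℂ) * ζ).re = n * ζ.re := by simp

theorem intCast_mul_re (n : ℤ) (ζ : ℂ) : ((n : ℂ) * ζ).re = n * ζ.re := by simp

theorem natCast_pow_mul_re (d n : ℕ) (ζ : ℂ) : ((d : ℂ) ^ n * ζ).re = (d : ℝ) ^ n * ζ.re := by
  have := natCast_mul_re (d ^ n) ζ
  push_cast at this
  exact this

theorem exp_rotation_pow (hd : d ≠ 0) :
    Complex.exp (2 * Real.pi * Complex.I / d) ^ d = 1 := by
  rw [← Complex.exp_nat_mul, mul_div_cancel₀ _ (by exact_mod_cast hd), Complex.exp_two_pi_mul_I]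

theorem two_pi_I_div_re (d : ℕ) : (2 * Real.pi * Complex.I / (d : ℂ)).re = 0 := by
  rw [Complex.div_natCast_re]; simp

/-- The functional equations of `Ψ` hold because both sides lie far out and have the same Böttcher
coordinate, which is injective there. -/
theorem IsFarLog.exists_isParam (hd : 2 ≤ d) (hX : IsFarLog c X) :
    ∃ Ψ, IsParam d c (X + 2) Ψ ∧ ∀ ζ : ℂ, X + 2 < ζ.re →
      Real.exp (X + 1) < ‖Ψ ζ‖ ∧ bottcher d c (Ψ ζ) = Complex.exp ζ := by
  have hd' : (2 : ℝ) ≤ d := by exact_mod_cast hd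
  have hX0 := hX.pos
  choose! η h1 h2 using fun (ζ : ℂ) (h : X + 2 < ζ.re) => hX.exists_add_logExponent_eq hd h
  set Ψ : ℂ → ℂ := fun ζ => Complex.exp (η ζ)
  have hn : ∀ ζ : ℂ, X + 2 < ζ.re → Real.exp (X + 1) < ‖Ψ ζ‖ := fun ζ hζ => by
    show _ < ‖Complex.exp (η ζ)‖
    rw [Complex.norm_exp]
    exact Real.exp_lt_exp.2 (h1 ζ hζ)
  have hb : ∀ ζ : ℂ, X + 2 < ζ.re → bottcher d c (Ψ ζ) = Complex.exp ζ := fun ζ hζ => by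
    show bottcher d c (Complex.exp (η ζ)) = _
    rw [bottcher_exp, h2 ζ hζ]
  have hf : ∀ ζ : ℂ, X + 2 < ζ.re → IsFar c (Ψ ζ) := fun ζ hζ =>
    hX.isFar_exp (by linarith [h1 ζ hζ])
  have hinj : ∀ ζ : ℂ, X + 2 < ζ.re → ∀ z : ℂ, Real.exp (X + 1) < ‖z‖ →
      bottcher d c z = Complex.exp ζ → z = Ψ ζ := fun ζ hζ z hz h =>
    hX.bottcher_injective hd hz (hn ζ hζ) (h.trans (hb ζ hζ).symm)
  refine ⟨Ψ, ⟨?_, ?_, ?_, ?_, ?_⟩, fun ζ hζ => ⟨hn ζ hζ, hb ζ hζ⟩⟩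
  · refine Complex.continuous_exp.comp_continuousOn ?_
    refine LipschitzOnWith.continuousOn (K := 2) (LipschitzOnWith.of_dist_le_mul ?_)
    intro ζ hζ ζ' hζ'
    have := hX.norm_sub_le hd (h1 ζ hζ) (h1 ζ' hζ')
    rw [h2 ζ hζ, h2 ζ' hζ'] at this
    simpa [dist_eq_norm] using this
  · refine ⟨max (X + 2) (Real.log (‖c‖ + 2) + 1), fun ζ hζ => ?_⟩
    obtain ⟨hζ1, hζ2⟩ := max_lt_iff.1 hζ
    refine ⟨?_, hf ζ hζ1, hb ζ hζ1⟩
    have h3 := (hf ζ hζ1).abs_log_norm_bottcher_sub_le hd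
    rw [hb ζ hζ1, Complex.norm_exp ζ, Real.log_exp] at h3
    have h4 : Real.log (‖c‖ + 2) < Real.log ‖Ψ ζ‖ := by linarith [(abs_le.1 h3).1]
    have h5 := (Real.log_lt_log_iff (by positivity) (norm_pos_iff.2 (hf ζ hζ1).ne_zero)).1 h4
    exact ⟨by linarith [norm_nonneg c], by linarith⟩
  · intro ζ hζ
    have hdζ : X + 2 < ((d : ℂ) * ζ).re := by rw [natCast_mul_re]; nlinarith
    refine hinj _ hdζ _ ((hn ζ hζ).trans_le ((hf ζ hζ).norm_le_norm_poly hd)) ?_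
    rw [(hf ζ hζ).bottcher_poly hd, hb ζ hζ, ← Complex.exp_nat_mul]
  · intro ζ hζ
    have hw := exp_rotation_pow (d := d) (by omega)
    have hre : X + 2 < (ζ + 2 * Real.pi * Complex.I / d).re := by
      rw [Complex.add_re, two_pi_I_div_re, add_zero]; exact hζ
    refine (hinj _ hre _ ?_ ?_).symm
    · rw [norm_mul, Complex.norm_exp, two_pi_I_div_re, Real.exp_zero, one_mul]
      exact hn ζ hζ
    · rw [bottcher_mul_of_pow_eq_one hw, hb ζ hζ, Complex.exp_add, mul_comm]
  · intro ζ ζ' hζ hζ' h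
    rw [← hb ζ hζ, ← hb ζ' hζ', h]

theorem IsParam.mono (h : IsParam d c X Ψ) {X' : ℝ} (hX : X ≤ X') : IsParam d c X' Ψ where
  continuousOn := h.continuousOn.mono fun _ hζ => lt_of_le_of_lt hX hζ
  eventually := h.eventually
  map_mul ζ hζ := h.map_mul ζ (hX.trans_lt hζ)
  rotate ζ hζ := h.rotate ζ (hX.trans_lt hζ)
  exp_eq ζ ζ' hζ hζ' := h.exp_eq ζ ζ' (hX.trans_lt hζ) (hX.trans_lt hζ')

theorem lt_natCast_pow_mul (hd : 2 ≤ d) (hX0 : 0 ≤ X) {x : ℝ} (hx : X < x) (n : ℕ) :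
    X < (d : ℝ) ^ n * x := by
  have hd' : (1 : ℝ) ≤ d := by exact_mod_cast (by omega : 1 ≤ d)
  exact hx.trans_le (le_mul_of_one_le_left (hX0.trans hx.le) (one_le_pow₀ hd'))

theorem IsParam.map_pow_mul (hd : 2 ≤ d) (hX0 : 0 ≤ X) (h : IsParam d c X Ψ) {ζ : ℂ}
    (hζ : X < ζ.re) (n : ℕ) : (poly d c)^[n] (Ψ ζ) = Ψ ((d : ℂ) ^ n * ζ) := by
  induction n with
  | zero => simp
  | succ n ih =>
    rw [Function.iterate_succ_apply', ih, h.map_mul, pow_succ', mul_assoc]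
    rw [natCast_pow_mul_re]
    exact lt_natCast_pow_mul hd hX0 hζ n

theorem eventually_lt_pow_mul (hd : 2 ≤ d) {x : ℝ} (hx : 0 < x) (Y : ℝ) :
    ∀ᶠ n : ℕ in atTop, Y < (d : ℝ) ^ n * x := by
  have hd' : (1 : ℝ) < d := by exact_mod_cast (by omega : 1 < d)
  exact ((tendsto_pow_atTop_atTop_of_one_lt hd').atTop_mul_const hx).eventually_gt_atTop Y

theorem IsParam.green_eq (hd : 2 ≤ d) (hX0 : 0 ≤ X) (h : IsParam d c X Ψ) {ζ : ℂ}
    (hζ : X < ζ.re) : green d c (Ψ ζ) = ζ.re := by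
  obtain ⟨Y, hY⟩ := h.eventually
  obtain ⟨n, hn⟩ := (eventually_lt_pow_mul hd (hX0.trans_lt hζ) Y).exists
  rw [← natCast_pow_mul_re] at hn
  obtain ⟨-, hfar, hb⟩ := hY _ hn
  have h1 := hfar.log_norm_bottcher hd
  rw [hb, Complex.norm_exp, Real.log_exp, ← h.map_pow_mul hd hX0 hζ, green_poly_iterate hd,
    natCast_pow_mul_re] at h1
  have : (0 : ℝ) < (d : ℝ) ^ n := pow_pos (by exact_mod_cast (by omega : 0 < d)) n
  exact (mul_left_cancel₀ this.ne' h1).symm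

/-- Only the rotation rule is assumed, because the lemma is also applied to the extension of a
parametrization before that is known to satisfy `IsParam`. -/
theorem rotate_int_of_rotate (h : ∀ ζ : ℂ, X < ζ.re → Ψ (ζ + 2 * Real.pi * Complex.I / d)
    = Complex.exp (2 * Real.pi * Complex.I / d) * Ψ ζ) {ζ : ℂ} (hζ : X < ζ.re) (k : ℤ) :
    Ψ (ζ + k * (2 * Real.pi * Complex.I / d))
      = Complex.exp (k * (2 * Real.pi * Complex.I / d)) * Ψ ζ := by
  have hre : ∀ k : ℤ, X < (ζ + k * (2 * Real.pi * Complex.I / d)).re := by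
    intro k
    rw [Complex.add_re, intCast_mul_re, two_pi_I_div_re, mul_zero, add_zero]
    exact hζ
  induction k using Int.induction_on with
  | zero => simp
  | succ k ih =>
    have := h _ (hre k)
    rw [ih] at this
    push_cast at this ⊢
    rw [add_mul, one_mul, ← add_assoc, this, Complex.exp_add]
    ring
  | pred k ih =>
    have := h _ (hre (-k - 1))
    rw [add_assoc] at this
    push_cast at this ih ⊢
    rw [show (-(k : ℂ) - 1) * (2 * Real.pi * Complex.I / d) + 2 * Real.pi * Complex.I / d
      = -k * (2 * Real.pi * Complex.I / d) by ring, ih] at this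
    rw [show (-(k : ℂ)) * (2 * Real.pi * Complex.I / d)
      = (-k - 1) * (2 * Real.pi * Complex.I / d) + 2 * Real.pi * Complex.I / d by ring,
      Complex.exp_add] at this
    have h0 := Complex.exp_ne_zero (2 * Real.pi * Complex.I / d)
    refine mul_left_cancel₀ h0 ?_
    rw [← this]
    ring

theorem IsParam.periodic (hd : d ≠ 0) (h : IsParam d c X Ψ) {ζ : ℂ} (hζ : X < ζ.re) (k : ℤ) :
    Ψ (ζ + k * (2 * Real.pi * Complex.I)) = Ψ ζ := by
  have hd' : (d : ℂ) ≠ 0 := by exact_mod_cast hd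
  have := rotate_int_of_rotate h.rotate hζ (k * d)
  push_cast at this
  rw [mul_assoc, mul_div_cancel₀ _ hd', Complex.exp_int_mul_two_pi_mul_I, one_mul] at this
  exact this

theorem isPreconnected_re_gt (X : ℝ) : IsPreconnected {ζ : ℂ | X < ζ.re} :=
  (convex_halfSpace_re_gt X).isPreconnected

theorem isSimplyConnected_re_gt (X : ℝ) : IsSimplyConnected {ζ : ℂ | X < ζ.re} := by
  have := (convex_halfSpace_re_gt X).contractibleSpace ⟨((X + 1 : ℝ) : ℂ), by simp⟩
  exact (inferInstance : SimplyConnectedSpace {ζ : ℂ | X < ζ.re})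

/-- The extension is a `d`-th root of `Ψ (d * ζ) - c`, which exists because the half-plane is simply
connected and `Ψ` omits `c`. Normalized at one point, it agrees with `Ψ` and inherits the rotation
rule by `eqOn_of_pow_eq_pow`. -/
theorem IsParam.exists_extension (hd : 2 ≤ d) (hX0 : 0 ≤ X) (h : IsParam d c X Ψ)
    (hc : ∀ ζ : ℂ, X < ζ.re → Ψ ζ ≠ c) : ∃ Ψ', IsParam d c (X / d) Ψ' := by
  have hd' : (2 : ℝ) ≤ d := by exact_mod_cast hd
  have hdC : (d : ℂ) ≠ 0 := by exact_mod_cast (by omega : d ≠ 0)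
  have hdiv : X / d ≤ X := div_le_self hX0 (by linarith)
  have hmul : ∀ ζ : ℂ, X / d < ζ.re → X < ((d : ℂ) * ζ).re := by
    intro ζ hζ
    rw [natCast_mul_re]
    rwa [div_lt_iff₀' (by linarith)] at hζ
  have hcont : ContinuousOn (fun ζ => Ψ (d * ζ) - c) {ζ : ℂ | X / d < ζ.re} :=
    (h.continuousOn.comp (by fun_prop) fun ζ hζ => hmul ζ hζ).sub continuousOn_const
  obtain ⟨g, hg, hgd⟩ := Complex.exists_continuousOn_pow_eq (isSimplyConnected_re_gt (X / d))
    (isOpen_lt continuous_const Complex.continuous_re) hcont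
    (by
      rintro ⟨ζ, hζ, h0⟩
      exact hc _ (hmul ζ hζ) (sub_eq_zero.1 h0)) (n := d) (by omega)
  have hg0 : ∀ ζ : ℂ, X / d < ζ.re → g ζ ≠ 0 := by
    intro ζ hζ h0
    have := hgd ζ
    rw [h0, zero_pow (by omega)] at this
    exact hc _ (hmul ζ hζ) (sub_eq_zero.1 this.symm)
  have hΨd : ∀ ζ : ℂ, X < ζ.re → Ψ ζ ^ d = g ζ ^ d := by
    intro ζ hζ
    rw [hgd, ← h.map_mul ζ hζ]
    simp [poly]
  set ζ₀ : ℂ := ((X + 1 : ℝ) : ℂ)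
  have hζ₀ : X < ζ₀.re := by simp [ζ₀]
  have hζ₀' : X / d < ζ₀.re := hdiv.trans_lt hζ₀
  have hsub : {ζ : ℂ | X < ζ.re} ⊆ {ζ | X / d < ζ.re} := fun ζ hζ => hdiv.trans_lt hζ
  obtain ⟨Φ, hΦd, hΦc, hEq₀⟩ : ∃ Φ : ℂ → ℂ, (∀ ζ, Φ ζ ^ d = Ψ (d * ζ) - c) ∧
      ContinuousOn Φ {ζ | X / d < ζ.re} ∧ Ψ ζ₀ = Φ ζ₀ := by
    refine ⟨fun ζ => Ψ ζ₀ / g ζ₀ * g ζ, fun ζ => ?_, continuousOn_const.mul hg,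
      (div_mul_cancel₀ _ (hg0 _ hζ₀')).symm⟩
    rw [mul_pow, div_pow, hΨd _ hζ₀, div_self (pow_ne_zero _ (hg0 _ hζ₀')), one_mul, hgd]
  have hΦ0 : ∀ ζ : ℂ, X / d < ζ.re → Φ ζ ≠ 0 := by
    intro ζ hζ h0
    have := hΦd ζ
    rw [h0, zero_pow (by omega)] at this
    exact hc _ (hmul ζ hζ) (sub_eq_zero.1 this.symm)
  have hEq : EqOn Φ Ψ {ζ | X < ζ.re} := by
    refine (eqOn_of_pow_eq_pow (isPreconnected_re_gt X) h.continuousOn (hΦc.mono hsub)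
      (fun ζ hζ => hΦ0 ζ (hsub hζ)) (fun ζ hζ => ⟨d, by omega, ?_⟩) hζ₀ hEq₀).symm
    rw [hΦd, ← h.map_mul ζ hζ]
    simp [poly]
  have hrot : ∀ ζ : ℂ, X / d < ζ.re → Φ (ζ + 2 * Real.pi * Complex.I / d)
      = Complex.exp (2 * Real.pi * Complex.I / d) * Φ ζ := by
    have hre : ∀ ζ : ℂ, (ζ + 2 * Real.pi * Complex.I / d).re = ζ.re := by
      intro ζ
      rw [Complex.add_re, two_pi_I_div_re, add_zero]
    refine eqOn_of_pow_eq_pow (isPreconnected_re_gt (X / d))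
      (hΦc.comp (by fun_prop) fun ζ hζ => ?_) (continuousOn_const.mul hΦc)
      (fun ζ hζ => mul_ne_zero (Complex.exp_ne_zero _) (hΦ0 ζ hζ))
      (fun ζ hζ => ⟨d, by omega, ?_⟩) (x₀ := ζ₀) hζ₀' ?_
    · show X / d < (ζ + 2 * Real.pi * Complex.I / d).re
      rw [hre]; exact hζ
    · rw [mul_pow, exp_rotation_pow (by omega), one_mul, hΦd, hΦd, mul_add, mul_div_cancel₀ _ hdC]
      have := h.periodic (by omega) (hmul ζ hζ) 1
      simp only [Int.cast_one, one_mul] at this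
      rw [this]
    · show Φ (ζ₀ + _) = _
      rw [hEq (show X < (ζ₀ + 2 * Real.pi * Complex.I / d).re by rw [hre]; exact hζ₀), hEq hζ₀]
      exact h.rotate ζ₀ hζ₀
  obtain ⟨Y, hY⟩ := h.eventually
  have hmm : ∀ ζ : ℂ, X / d < ζ.re → poly d c (Φ ζ) = Φ (d * ζ) := by
    intro ζ hζ
    rw [hEq (hmul ζ hζ), poly]
    rw [hΦd, sub_add_cancel]
  have hev : ∃ Y, ∀ ζ : ℂ, Y < ζ.re →
      Φ ζ ∈ nearInfinity c ∧ IsFar c (Φ ζ) ∧ bottcher d c (Φ ζ) = Complex.exp ζ := by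
    refine ⟨max X Y, fun ζ hζ => ?_⟩
    rw [hEq ((le_max_left _ _).trans_lt hζ)]
    exact hY ζ ((le_max_right _ _).trans_lt hζ)
  refine ⟨Φ, hΦc, hev, hmm, hrot, ?_⟩
  intro ζ ζ' hζ hζ' he
  -- Applying `poly` moves the equality to `d * ζ` and `d * ζ'`, so these differ by a multiple of `2
  -- π i`. By the rotation rule and `Φ ζ ≠ 0`, the root of unity relating `exp ζ` and `exp ζ'` is
  -- `1`.
  have h1 := hmm ζ hζ
  rw [he, hmm ζ' hζ', hEq (hmul ζ hζ), hEq (hmul ζ' hζ')] at h1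
  have h2 := h.exp_eq _ _ (hmul ζ' hζ') (hmul ζ hζ) h1
  obtain ⟨k, hk⟩ := Complex.exp_eq_exp_iff_exists_int.1 h2
  have hk' : ζ' = ζ + k * (2 * Real.pi * Complex.I / d) := by
    field_simp
    linear_combination hk
  have h0 := rotate_int_of_rotate hrot hζ k
  rw [← hk', ← he] at h0
  have h3 := (mul_eq_right₀ (hΦ0 ζ hζ)).1 h0.symm
  rw [hk', Complex.exp_add, h3, mul_one]

/-- A parametrization above potential `X` extends down to `X / d` whenever `X` is at least the
potential of `c`, since it then omits `c`. Starting from a large multiple `d ^ n` of that potential,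
the last admissible step ends at the potential of the critical point. -/
theorem exists_isParam (hd : 2 ≤ d) (hc : 0 < green d c c) :
    ∃ Ψ, IsParam d c (green d c c / d) Ψ := by
  have hd0 : (0 : ℝ) < d := by exact_mod_cast (by omega : 0 < d)
  obtain ⟨X, hX⟩ := exists_isFarLog c
  obtain ⟨Ψ₀, h₀, -⟩ := hX.exists_isParam hd
  have hne : ∀ Y, green d c c ≤ Y → ∀ Ψ, IsParam d c Y Ψ → ∀ ζ : ℂ, Y < ζ.re → Ψ ζ ≠ c := by
    intro Y hY Ψ hΨ ζ hζ h
    have := hΨ.green_eq hd (hc.le.trans hY) hζ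
    rw [h] at this
    linarith
  have key : ∀ n : ℕ, (∃ Ψ, IsParam d c ((d : ℝ) ^ n * green d c c) Ψ) →
      ∃ Ψ, IsParam d c (green d c c / d) Ψ := by
    intro n
    induction n with
    | zero =>
      rintro ⟨Ψ, hΨ⟩
      rw [pow_zero, one_mul] at hΨ
      exact hΨ.exists_extension hd hc.le (hne _ le_rfl Ψ hΨ)
    | succ n ih =>
      rintro ⟨Ψ, hΨ⟩
      refine ih ?_
      have h1 : green d c c ≤ (d : ℝ) ^ (n + 1) * green d c c :=
        le_mul_of_one_le_left hc.le (one_le_pow₀ (by exact_mod_cast (by omega : 1 ≤ d)))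
      have := hΨ.exists_extension hd (hc.le.trans h1) (hne _ h1 Ψ hΨ)
      rwa [pow_succ', mul_assoc, mul_div_cancel_left₀ _ hd0.ne'] at this
  obtain ⟨n, hn⟩ := (eventually_lt_pow_mul hd hc (X + 2)).exists
  exact key n ⟨Ψ₀, h₀.mono hn.le⟩

theorem green_zero (hd : 2 ≤ d) (c : ℂ) : d * green d c 0 = green d c c := by
  rw [← green_poly hd]
  simp [poly, show d ≠ 0 by omega]

/-! ### Dynamical rays -/

/-- The logarithmic coordinate of the point at potential `x` on the ray at angle `y`. -/
def rayPoint (x y : ℝ) : ℂ := x + 2 * Real.pi * Complex.I * y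

@[simp] theorem rayPoint_re (x y : ℝ) : (rayPoint x y).re = x := by simp [rayPoint]

theorem continuous_rayPoint : Continuous fun q : ℝ × ℝ => rayPoint q.1 q.2 := by
  unfold rayPoint; fun_prop

theorem natCast_mul_rayPoint (n : ℕ) (x y : ℝ) : n * rayPoint x y = rayPoint (n * x) (n * y) := by
  simp only [rayPoint]; push_cast; ring

theorem natCast_pow_mul_rayPoint (d n : ℕ) (x y : ℝ) :
    (d : ℂ) ^ n * rayPoint x y = rayPoint ((d : ℝ) ^ n * x) ((d : ℝ) ^ n * y) := by
  simp only [rayPoint]; push_cast; ring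

theorem radial_exp (x y : ℝ) :
    radial (Real.exp x) (y : UnitAddCircle) = Complex.exp (rayPoint x y) := by
  rw [radial, AddCircle.toCircle_apply_mk, Circle.coe_exp, rayPoint, Complex.exp_add]
  push_cast
  congr 2
  ring

theorem exp_rayPoint_eq_iff {x y x' y' : ℝ} :
    Complex.exp (rayPoint x y) = Complex.exp (rayPoint x' y') ↔
      x = x' ∧ (y : UnitAddCircle) = (y' : UnitAddCircle) := by
  constructor
  · intro h
    have h1 : x = x' := by
      have := congrArg norm h
      rwa [Complex.norm_exp, Complex.norm_exp, rayPoint_re, rayPoint_re, Real.exp_eq_exp] at this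
    refine ⟨h1, ?_⟩
    rw [← radial_exp, ← radial_exp, radial, radial, h1] at h
    have h0 : (Real.exp x' : ℂ) ≠ 0 := by exact_mod_cast (Real.exp_pos _).ne'
    exact AddCircle.injective_toCircle one_ne_zero (Subtype.ext (mul_left_cancel₀ h0 h))
  · rintro ⟨rfl, h⟩
    rw [← radial_exp, ← radial_exp, h]

theorem IsParam.isRayOn (hd : 2 ≤ d) (h : IsParam d c X Ψ) (hX : green d c 0 ≤ X) (y : ℝ) :
    IsRayOn d c y (Real.exp X) fun r => Ψ (rayPoint (Real.log r) y) := by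
  have hX0 : 0 ≤ X := (green_nonneg hd c 0).trans hX
  have hlog : ∀ r : ℝ, Real.exp X < r → X < (rayPoint (Real.log r) y).re := by
    intro r hr
    rw [rayPoint_re]
    exact (Real.lt_log_iff_exp_lt ((Real.exp_pos _).trans hr)).2 hr
  obtain ⟨Y, hY⟩ := h.eventually
  refine ⟨?_, ?_, ?_, ?_⟩
  · refine h.continuousOn.comp (ContinuousOn.comp (g := fun x => rayPoint x y) (t := univ)
      ((continuous_rayPoint.comp (.prodMk_left y)).continuousOn) ?_ fun _ _ => trivial) hlog
    exact Real.continuousOn_log.mono fun r (hr : _ < r) => ((Real.exp_pos _).trans hr).ne'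
  · filter_upwards [eventually_gt_atTop (Real.exp Y)] with r hr
    have hr0 := (Real.exp_pos _).trans hr
    have := hY (rayPoint (Real.log r) y) (by
      rw [rayPoint_re]; exact (Real.lt_log_iff_exp_lt hr0).2 hr)
    refine ⟨this.1, ?_⟩
    rw [this.2.2, ← radial_exp, Real.exp_log hr0]
  · intro r hr
    have hr0 := (Real.exp_pos _).trans hr
    have hx := hX0.trans_lt (hlog r hr)
    filter_upwards [eventually_lt_pow_mul hd hx Y] with n hn
    rw [← natCast_pow_mul_re] at hn
    rw [h.map_pow_mul hd hX0 (hlog r hr)]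
    refine ⟨(hY _ hn).1, ?_⟩
    rw [(hY _ hn).2.2]
    have := Complex.exp_nat_mul (rayPoint (Real.log r) y) (d ^ n)
    push_cast at this
    rw [this, ← radial_exp, Real.exp_log hr0]
  · intro r hr n h0
    rw [h.map_pow_mul hd hX0 (hlog r hr)] at h0
    have h1 := lt_natCast_pow_mul hd hX0 (hlog r hr) n
    rw [← natCast_pow_mul_re] at h1
    have h2 := h.green_eq hd hX0 h1
    rw [h0] at h2
    linarith

end

section

/-! ### Uniqueness of dynamical rays -/

variable {d : ℕ} {c : ℂ} {t : UnitAddCircle} {ρ : ℝ} {γ γ₁ γ₂ : ℝ → ℂ}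

theorem continuousOn_bottcher (hd : 2 ≤ d) (c : ℂ) :
    ContinuousOn (bottcher d c) {z | IsFar c z} := by
  refine continuousOn_id.mul (Complex.continuous_exp.comp_continuousOn ?_)
  refine continuousOn_tsum (fun n => ?_) (hasSum_geometric_two' (3 / 16)).summable
    fun n z hz => hz.norm_term_le hd n
  refine ContinuousOn.div_const (ContinuousOn.clog ?_ fun z hz =>
    (hz.poly_iterate hd n).one_add_mem_slitPlane hd) _
  exact continuousOn_const.add (continuousOn_const.div
    ((continuous_poly_iterate d c n).continuousOn.pow d)
    fun z hz => pow_ne_zero _ (hz.poly_iterate hd n).ne_zero)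

theorem norm_radial (r : ℝ) (t : UnitAddCircle) : ‖radial r t‖ = |r| := by
  rw [radial, norm_mul, Circle.norm_coe, mul_one, Complex.norm_real, Real.norm_eq_abs]

theorem radial_pow (r : ℝ) (t : UnitAddCircle) (n : ℕ) :
    radial r t ^ n = radial (r ^ n) (n • t) := by
  rw [radial, radial, mul_pow, AddCircle.toCircle_nsmul]
  push_cast
  rfl

theorem continuous_radial (t : UnitAddCircle) : Continuous fun r => radial r t := by
  unfold radial; fun_prop

theorem exists_radius_of_green_gt (hd : 2 ≤ d) (c : ℂ) {X : ℝ} (hX : IsFarLog c X) :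
    ∃ Z, 0 < Z ∧ ∀ z, Z < green d c z → Real.exp (X + 1) < ‖z‖ := by
  refine ⟨X + 1 + greenBound c, by linarith [hX.pos, greenBound_nonneg c], fun z hz => ?_⟩
  have h1 := (abs_le.1 (abs_green_sub_le hd c z)).2
  have h2 : X + 1 < Real.posLog ‖z‖ := by linarith
  have h3 : 0 < Real.posLog ‖z‖ := by linarith [hX.pos]
  have h4 : Real.posLog ‖z‖ = Real.log ‖z‖ := by
    rw [Real.posLog_apply] at h3 ⊢
    rcases lt_max_iff.1 h3 with h | h
    · exact absurd h (lt_irrefl _)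
    · exact max_eq_right h.le
  rw [h4] at h2 h3
  have h5 : 0 < ‖z‖ := by
    rcases (norm_nonneg z).eq_or_lt with h | h
    · rw [← h, Real.log_zero] at h3
      exact absurd h3 (lt_irrefl _)
    · exact h
  exact (Real.lt_log_iff_exp_lt h5).1 h2

theorem IsFarLog.isFar_of_lt_norm {X : ℝ} (hX : IsFarLog c X) {z : ℂ}
    (hz : Real.exp (X + 1) < ‖z‖) : IsFar c z := by
  have h : Real.exp X ≤ ‖z‖ := (Real.exp_le_exp.2 (by linarith)).trans hz.le
  exact ⟨hX.1.trans h, hX.2.trans (by gcongr)⟩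

theorem nearInfinity_poly (hd : 2 ≤ d) {z : ℂ} (hz : z ∈ nearInfinity c) :
    poly d c z ∈ nearInfinity c := by
  obtain ⟨h1, h2⟩ : 2 < ‖z‖ ∧ ‖c‖ < ‖z‖ := hz
  have h3 : ‖z ^ d‖ - ‖c‖ ≤ ‖z ^ d + c‖ := by
    have := norm_sub_le (z ^ d + c) c
    rw [add_sub_cancel_right] at this
    linarith
  have h4 : ‖z‖ ^ 2 ≤ ‖z‖ ^ d := pow_le_pow_right₀ (by linarith) hd
  rw [norm_pow] at h3
  have h5 : ‖z‖ < ‖z ^ d + c‖ := by nlinarith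
  exact ⟨h1.trans h5, h2.trans h5⟩

theorem IsRayOn.mono (h : IsRayOn d c t ρ γ) {ρ' : ℝ} (hρ : ρ ≤ ρ') : IsRayOn d c t ρ' γ where
  continuousOn := h.continuousOn.mono (Ioi_subset_Ioi hρ)
  near_infinity := h.near_infinity
  equation r hr := h.equation r (hρ.trans_lt hr)
  not_precritical r hr := h.not_precritical r (hρ.trans_lt hr)

theorem IsRayOn.eventually_isFar (hd : 2 ≤ d) (h : IsRayOn d c t ρ γ) {r : ℝ} (hr : ρ < r) :
    ∀ᶠ n in atTop, IsFar c ((poly d c)^[n] (γ r)) ∧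
      bottcher d c ((poly d c)^[n] (γ r)) = radial r t ^ (d ^ n) := by
  have h1 := h.equation r hr
  obtain ⟨n₀, hn₀⟩ := h1.exists
  have h2 := eventually_isFar_of_mem_nearInfinity hd hn₀.1
  have h3 : ∀ᶠ n in atTop, IsFar c ((poly d c)^[n] (γ r)) := by
    rw [eventually_atTop] at h2 ⊢
    obtain ⟨m, hm⟩ := h2
    refine ⟨m + n₀, fun n hn => ?_⟩
    have := hm (n - n₀) (by omega)
    rwa [← Function.iterate_add_apply, Nat.sub_add_cancel (by omega)] at this
  filter_upwards [h1, h3] with n hn hn'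
  exact ⟨hn', hn.2⟩

theorem IsRayOn.green_eq (hd : 2 ≤ d) (h : IsRayOn d c t ρ γ) {r : ℝ} (hr : ρ < r) :
    green d c (γ r) = Real.log r := by
  obtain ⟨n, hn, hb⟩ := (h.eventually_isFar hd hr).exists
  have h1 := hn.log_norm_bottcher hd
  rw [hb, norm_pow, norm_radial, Real.log_pow, Real.log_abs, green_poly_iterate hd] at h1
  push_cast at h1
  have : (0 : ℝ) < (d : ℝ) ^ n := pow_pos (by exact_mod_cast (by omega : 0 < d)) n
  exact (mul_left_cancel₀ this.ne' h1).symm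

/-- The defining equation determines the value up to a root of unity of order a power of `d`;
continuity and the normalization near infinity remove the ambiguity. -/
theorem IsRayOn.bottcher_eq (hd : 2 ≤ d) (hρ : 1 ≤ ρ) (h : IsRayOn d c t ρ γ) {Z : ℝ}
    (hZ : ∀ z, Z < green d c z → IsFar c z) {r : ℝ} (hr : ρ < r) (hr' : Z < Real.log r) :
    bottcher d c (γ r) = radial r t := by
  set s := Ioi (max ρ (Real.exp Z)) with hs
  have hs1 : ∀ x ∈ s, ρ < x := fun x hx => (le_max_left _ _).trans_lt hx
  have hs2 : ∀ x ∈ s, IsFar c (γ x) := by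
    intro x hx
    refine hZ _ ?_
    rw [h.green_eq hd (hs1 x hx)]
    exact (Real.lt_log_iff_exp_lt (by linarith [hs1 x hx])).2 ((le_max_right _ _).trans_lt hx)
  obtain ⟨x₀, hx₀, hx₀'⟩ := (h.near_infinity.and (eventually_gt_atTop (max ρ (Real.exp Z)))).exists
  refine eqOn_of_pow_eq_pow (s := s) isPreconnected_Ioi (f := fun r => bottcher d c (γ r))
    (g := fun r => radial r t)
    ((continuousOn_bottcher hd c).comp (h.continuousOn.mono hs1) hs2)
    (continuous_radial t).continuousOn (fun x hx => ?_) (fun x hx => ?_) hx₀' hx₀.2 ?_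
  · rw [← norm_pos_iff, norm_radial]
    exact abs_pos.2 (by linarith [hs1 x hx])
  · obtain ⟨n, -, hn⟩ := (h.eventually_isFar hd (hs1 x hx)).exists
    refine ⟨d ^ n, pow_ne_zero _ (by omega), ?_⟩
    rw [← hn, (hs2 x hx).bottcher_poly_iterate hd]
  · exact max_lt hr ((Real.lt_log_iff_exp_lt (by linarith)).1 hr')

theorem IsRayOn.map (hd : 2 ≤ d) (hρ : 1 ≤ ρ) (h : IsRayOn d c t ρ γ) :
    IsRayOn d c (d • t) (ρ ^ d) fun r => poly d c (γ (r ^ (1 / (d : ℝ)))) := by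
  have hd0 : (0 : ℝ) < d := by exact_mod_cast (by omega : 0 < d)
  have hroot : ∀ r : ℝ, ρ ^ d < r → ρ < r ^ (1 / (d : ℝ)) := by
    intro r hr
    rw [one_div, Real.lt_rpow_inv_iff_of_pos (by linarith)
      ((by positivity : 0 ≤ ρ ^ d).trans hr.le) hd0]
    rwa [Real.rpow_natCast]
  have hpow : ∀ r : ℝ, 0 ≤ r → (r ^ (1 / (d : ℝ))) ^ d = r := fun r hr => by
    rw [← Real.rpow_natCast, ← Real.rpow_mul hr, one_div_mul_cancel hd0.ne', Real.rpow_one]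
  have hpos : ∀ r : ℝ, ρ ^ d < r → 0 ≤ r := fun r hr =>
    (by positivity : 0 ≤ ρ ^ d).trans hr.le
  refine ⟨?_, ?_, ?_, ?_⟩
  · refine (continuous_poly d c).comp_continuousOn (h.continuousOn.comp ?_ hroot)
    exact (Real.continuous_rpow_const (by positivity)).continuousOn
  · obtain ⟨X, hX⟩ := exists_isFarLog c
    obtain ⟨Z, -, hZ⟩ := exists_radius_of_green_gt hd c hX
    have ht : Tendsto (fun r : ℝ => r ^ (1 / (d : ℝ))) atTop atTop :=
      tendsto_rpow_atTop (by positivity)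
    filter_upwards [ht.eventually h.near_infinity, ht.eventually_gt_atTop ρ,
      (Real.tendsto_log_atTop.comp ht).eventually_gt_atTop Z, eventually_ge_atTop 0]
      with r h1 h2 h3 h4
    refine ⟨nearInfinity_poly hd h1.1, ?_⟩
    have hf : IsFar c (γ (r ^ (1 / (d : ℝ)))) := hX.isFar_of_lt_norm (hZ _ (by
      rw [h.green_eq hd h2]; exact h3))
    rw [hf.bottcher_poly hd, h1.2, radial_pow, hpow r h4]
  · intro r hr
    have := (tendsto_add_atTop_nat 1).eventually (h.equation _ (hroot r hr))
    filter_upwards [this] with n hn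
    rw [Function.iterate_succ_apply] at hn
    refine ⟨hn.1, ?_⟩
    rw [hn.2, pow_succ', pow_mul, radial_pow, hpow r (hpos r hr)]
  · intro r hr n
    rw [← Function.iterate_succ_apply]
    exact h.not_precritical _ (hroot r hr) (n + 1)

/-- Induction on the number of iterations that lift the potential above `Z`. The images under `f_c`
are rays at angle `d • t` and agree by induction, so `γ₁` and `γ₂` have equal `d`-th powers. They
never vanish and coincide near infinity, hence they are equal. -/
theorem IsRayOn.eqOn (hd : 2 ≤ d) (hρ : 1 ≤ ρ) (h₁ : IsRayOn d c t ρ γ₁)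
    (h₂ : IsRayOn d c t ρ γ₂) : EqOn γ₁ γ₂ (Ioi ρ) := by
  have hd0 : (0 : ℝ) < d := by exact_mod_cast (by omega : 0 < d)
  obtain ⟨X, hX⟩ := exists_isFarLog c
  obtain ⟨Z, hZ0, hZ⟩ := exists_radius_of_green_gt hd c hX
  have key : ∀ n : ℕ, ∀ (t : UnitAddCircle) (ρ : ℝ) (γ₁ γ₂ : ℝ → ℂ), 1 ≤ ρ →
      IsRayOn d c t ρ γ₁ → IsRayOn d c t ρ γ₂ → ∀ r, ρ < r → Z < (d : ℝ) ^ n * Real.log r →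
      γ₁ r = γ₂ r := by
    intro n
    induction n with
    | zero =>
      intro t ρ γ₁ γ₂ hρ h₁ h₂ r hr hr'
      rw [pow_zero, one_mul] at hr'
      have hfar : ∀ z, Z < green d c z → IsFar c z := fun z hz => hX.isFar_of_lt_norm (hZ z hz)
      refine hX.bottcher_injective hd (hZ _ ?_) (hZ _ ?_) ?_
      · rwa [h₁.green_eq hd hr]
      · rwa [h₂.green_eq hd hr]
      · rw [h₁.bottcher_eq hd hρ hfar hr hr', h₂.bottcher_eq hd hρ hfar hr hr']
    | succ n ih =>
      intro t ρ γ₁ γ₂ hρ h₁ h₂ r hr hr'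
      set s := Ioi (max ρ (Real.exp (Z / (d : ℝ) ^ (n + 1)))) with hs
      have hs1 : ∀ x ∈ s, ρ < x := fun x hx => (le_max_left _ _).trans_lt hx
      have hs2 : ∀ x ∈ s, Z < (d : ℝ) ^ (n + 1) * Real.log x := by
        intro x hx
        rw [← div_lt_iff₀' (by positivity)]
        exact (Real.lt_log_iff_exp_lt (by linarith [hs1 x hx])).2 ((le_max_right _ _).trans_lt hx)
      set x₀ := max r (Real.exp (Z + 1))
      have hrs : r ∈ s := by
        refine max_lt hr ((Real.lt_log_iff_exp_lt (by linarith)).1 ?_)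
        rwa [div_lt_iff₀' (by positivity)]
      have hx₀ : x₀ ∈ s := mem_Ioi.2 (lt_of_lt_of_le hrs (le_max_left _ _))
      have hZx₀ : Z < Real.log x₀ :=
        (Real.lt_log_iff_exp_lt (by linarith [hs1 _ hx₀])).2
          ((Real.exp_lt_exp.2 (by linarith)).trans_le (le_max_right _ _))
      refine eqOn_of_pow_eq_pow (s := s) isPreconnected_Ioi (h₁.continuousOn.mono hs1)
        (h₂.continuousOn.mono hs1) (fun x hx => h₂.not_precritical x (hs1 x hx) 0)
        (fun x hx => ⟨d, by omega, ?_⟩) hx₀ ?_ hrs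
      · have hx0 : 0 ≤ x := by linarith [hs1 x hx]
        have := ih (d • t) (ρ ^ d) _ _ (one_le_pow₀ hρ) (h₁.map hd hρ) (h₂.map hd hρ) (x ^ d)
          (pow_lt_pow_left₀ (hs1 x hx) (by linarith) (by omega)) (by
            rw [Real.log_pow, ← mul_assoc, ← pow_succ]; exact hs2 x hx)
        simp only [one_div, Real.pow_rpow_inv_natCast hx0 (by omega : d ≠ 0)] at this
        simpa [poly] using this
      · have hfar : ∀ z, Z < green d c z → IsFar c z := fun z hz => hX.isFar_of_lt_norm (hZ z hz)
        refine hX.bottcher_injective hd (hZ _ ?_) (hZ _ ?_) ?_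
        · rwa [h₁.green_eq hd (hs1 _ hx₀)]
        · rwa [h₂.green_eq hd (hs1 _ hx₀)]
        · rw [h₁.bottcher_eq hd hρ hfar (hs1 _ hx₀) hZx₀, h₂.bottcher_eq hd hρ hfar (hs1 _ hx₀) hZx₀]
  intro r hr
  obtain ⟨n, hn⟩ := (eventually_lt_pow_mul hd (Real.log_pos (hρ.trans_lt hr)) Z).exists
  exact key n t ρ γ₁ γ₂ hρ h₁ h₂ r hr hn

theorem IsRayOn.exists_map_iterate (hd : 2 ≤ d) (h : IsRayOn d c t 1 γ) (n : ℕ) :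
    ∃ γ' : ℝ → ℂ, IsRayOn d c (d ^ n • t) 1 γ' ∧
      ∀ x : ℝ, γ' (Real.exp ((d : ℝ) ^ n * x)) = (poly d c)^[n] (γ (Real.exp x)) := by
  have hd0 : (0 : ℝ) < d := by exact_mod_cast (by omega : 0 < d)
  induction n with
  | zero => exact ⟨γ, by simpa using h, fun x => by simp⟩
  | succ n ih =>
    obtain ⟨γ', h1, h2⟩ := ih
    have h3 := h1.map hd le_rfl
    rw [one_pow, ← mul_smul, ← pow_succ'] at h3
    refine ⟨_, h3, fun x => ?_⟩
    rw [Function.iterate_succ_apply', ← h2, ← Real.exp_mul]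
    congr 3
    field_simp
    ring

/-- The parametrization of the basin by a half-plane contains the rays. -/
theorem IsParam.eq_of_isRayOn (hd : 2 ≤ d) {X : ℝ} {Ψ : ℂ → ℂ} (h : IsParam d c X Ψ)
    (hX : green d c 0 ≤ X) {y x : ℝ} (hρ : 1 ≤ ρ) (hγ : IsRayOn d c y ρ γ)
    (hx : X < x) (hx' : ρ < Real.exp x) : γ (Real.exp x) = Ψ (rayPoint x y) := by
  have h1 := (hγ.mono (le_max_left ρ (Real.exp X))).eqOn hd (le_max_of_le_left hρ)
    ((h.isRayOn hd hX y).mono (le_max_right _ _)) (x := Real.exp x)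
    (max_lt hx' (Real.exp_lt_exp.2 hx))
  rw [h1, Real.log_exp]

theorem HasExternalAngle.green_pos (hd : 2 ≤ d) (h : HasExternalAngle d c t) :
    0 < green d c c := by
  obtain ⟨ρ, γ, hρ, hγ, r, hr, hrc⟩ := h
  have := hγ.green_eq hd hr
  rw [hrc] at this
  rw [this]
  exact Real.log_pos (hρ.trans_lt hr)

theorem HasExternalAngle.eq_param (hd : 2 ≤ d) {y : ℝ} (h : HasExternalAngle d c y) {Ψ : ℂ → ℂ}
    (hΨ : IsParam d c (green d c c / d) Ψ) : Ψ (rayPoint (green d c c) y) = c := by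
  have hd1 : (1 : ℝ) < d := by exact_mod_cast (by omega : 1 < d)
  have hpos := h.green_pos hd
  obtain ⟨ρ, γ, hρ, hγ, r, hr, hrc⟩ := h
  have hr0 : 0 < r := one_pos.trans (hρ.trans_lt hr)
  have h1 : green d c c = Real.log r := by
    have := hγ.green_eq hd hr
    rwa [hrc] at this
  have h2 := hΨ.eq_of_isRayOn hd (x := Real.log r) ?_ hρ hγ ?_ ?_
  · rw [h1, ← h2, Real.exp_log hr0, hrc]
  · rw [← green_zero hd, mul_div_cancel_left₀ _ (by linarith)]
  · rw [← h1]
    exact div_lt_self hpos hd1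
  · rwa [Real.exp_log hr0]

end

section

/-! ### Inverse branches on the complement of the ray of the critical value -/

/-- The part of the ray at angle `y₀` at potentials at least that of the critical value. -/
def slit (d : ℕ) (c : ℂ) (Ψ : ℂ → ℂ) (y₀ : ℝ) : Set ℂ :=
  {z | green d c c ≤ green d c z ∧ Ψ (rayPoint (green d c z) y₀) = z}

variable {d : ℕ} {c : ℂ} {Ψ g : ℂ → ℂ} {y₀ : ℝ}

theorem div_lt_of_green_pos (hd : 2 ≤ d) (hpos : 0 < green d c c) :
    green d c c / d < green d c c :=
  div_lt_self hpos (by exact_mod_cast (by omega : 1 < d))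

theorem isClosed_slit (hd : 2 ≤ d) (hpos : 0 < green d c c)
    (hΨ : IsParam d c (green d c c / d) Ψ) (y₀ : ℝ) : IsClosed (slit d c Ψ y₀) := by
  have hG := continuous_green hd c
  have hcl : IsClosed {z | green d c c ≤ green d c z} := isClosed_le continuous_const hG
  have hcont : ContinuousOn (fun z => Ψ (rayPoint (green d c z) y₀) - z)
      {z | green d c c ≤ green d c z} := by
    refine ContinuousOn.sub (hΨ.continuousOn.comp ?_ fun z hz => ?_) continuousOn_id
    · exact (continuous_rayPoint.comp (hG.prodMk continuous_const)).continuousOn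
    · show _ < (rayPoint _ _).re
      rw [rayPoint_re]
      exact (div_lt_of_green_pos hd hpos).trans_le hz
  have := hcont.preimage_isClosed_of_isClosed hcl (isClosed_singleton (x := (0 : ℂ)))
  convert this using 1
  ext z
  simp [slit, sub_eq_zero]

theorem IsParam.tendsto_norm_inv (hd : 2 ≤ d) {X : ℝ} (hΨ : IsParam d c X Ψ) (y : ℝ) :
    Tendsto (fun x => (Ψ (rayPoint x y))⁻¹) atTop (𝓝 0) := by
  rw [tendsto_zero_iff_norm_tendsto_zero]
  simp only [norm_inv]
  refine tendsto_inv_atTop_zero.comp ?_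
  obtain ⟨Y, hY⟩ := hΨ.eventually
  have h1 : Tendsto (fun x : ℝ => Real.exp (x - 1)) atTop atTop :=
    Real.tendsto_exp_atTop.comp (tendsto_atTop_add_const_right _ _ tendsto_id)
  refine tendsto_atTop_mono' _ ?_ h1
  filter_upwards [eventually_gt_atTop Y] with x hx
  obtain ⟨-, hf, hb⟩ := hY (rayPoint x y) (by rwa [rayPoint_re])
  have := hf.abs_log_norm_bottcher_sub_le hd
  rw [hb, Complex.norm_exp, Real.log_exp, rayPoint_re] at this
  rw [← Real.le_log_iff_exp_le (norm_pos_iff.2 hf.ne_zero)]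
  linarith [(abs_le.1 this).1]

/-- Sliding the root of `1 - z / c` along the slit to infinity deforms this function, without zeros
off the slit, to the constant `1`. Lifting the homotopy through the covering `exp` gives a
continuous logarithm, and so a `d`-th root, without any appeal to the topology of the slit plane. -/
theorem exists_branch (hd : 2 ≤ d) (hpos : 0 < green d c c)
    (hΨ : IsParam d c (green d c c / d) Ψ) (hc : Ψ (rayPoint (green d c c) y₀) = c) :
    ∃ g : ℂ → ℂ, ContinuousOn g (slit d c Ψ y₀)ᶜ ∧
      ∀ z ∉ slit d c Ψ y₀, g z ^ d = z - c := by
  classical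
  have hlt := div_lt_of_green_pos hd hpos
  have hd0 : (d : ℂ) ≠ 0 := by exact_mod_cast (by omega : d ≠ 0)
  set V : Set ℂ := (slit d c Ψ y₀)ᶜ
  -- The reciprocals of the points of the slit, from infinity at `u = 0` to `c` at `u = 1`. At `u =
  -- 0` the default value `0⁻¹ = 0` makes `q` meaningless, so `τ` replaces it there by the limit
  -- `0`.
  set q : ℝ → ℂ := fun u => (Ψ (rayPoint (green d c c - 1 + u⁻¹) y₀))⁻¹ with hq
  have hbase : ∀ u : ℝ, 0 < u → u ≤ 1 → green d c c ≤ green d c c - 1 + u⁻¹ := by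
    intro u hu hu1
    have : 1 ≤ u⁻¹ := (one_le_inv₀ hu).2 hu1
    linarith
  have hne : ∀ x : ℝ, green d c c ≤ x → Ψ (rayPoint x y₀) ≠ 0 := by
    intro x hx h0
    have h1 := hΨ.green_eq hd (by positivity) (ζ := rayPoint x y₀)
      (by rw [rayPoint_re]; exact hlt.trans_le hx)
    have h2 := green_zero hd c
    rw [h0, rayPoint_re] at h1
    rw [← h2, mul_div_cancel_left₀ _ (by exact_mod_cast hd0)] at hlt
    linarith
  set τ : ℝ → ℂ := Function.update q 0 0 with hτ
  have hτc : ContinuousOn τ (Icc 0 1) := by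
    rw [hτ, continuousOn_update_iff]
    refine ⟨?_, fun _ => ?_⟩
    · refine ContinuousOn.inv₀ (hΨ.continuousOn.comp (t := {ζ | green d c c / d < ζ.re}) ?_ ?_) ?_
      · refine continuous_rayPoint.comp_continuousOn (ContinuousOn.prodMk ?_ continuousOn_const)
        exact continuousOn_const.add (continuousOn_id.inv₀ fun u hu => hu.2)
      · intro u hu
        show _ < (rayPoint _ _).re
        rw [rayPoint_re]
        exact hlt.trans_le (hbase u (lt_of_le_of_ne hu.1.1 (Ne.symm hu.2)) hu.1.2)
      · intro u hu
        exact hne _ (hbase u (lt_of_le_of_ne hu.1.1 (Ne.symm hu.2)) hu.1.2)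
    · have h1 : Tendsto (fun u : ℝ => green d c c - 1 + u⁻¹) (𝓝[Icc 0 1 \ {0}] 0) atTop :=
        tendsto_atTop_add_const_left _ _ (tendsto_inv_nhdsGT_zero.mono_left
          (nhdsWithin_mono _ fun u hu => lt_of_le_of_ne hu.1.1 (Ne.symm hu.2)))
      exact (hΨ.tendsto_norm_inv hd y₀).comp h1
  have hH0 : ∀ (u : unitInterval) (z : V), 1 - (z : ℂ) * τ u ≠ 0 := by
    intro u z h0
    by_cases hu : (u : ℝ) = 0
    · rw [hτ, hu, Function.update_self] at h0
      simp at h0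
    · have hb := hbase u (lt_of_le_of_ne u.2.1 (Ne.symm hu)) u.2.2
      rw [hτ, Function.update_of_ne hu, hq] at h0
      simp only at h0
      have hz : (z : ℂ) = Ψ (rayPoint (green d c c - 1 + (u : ℝ)⁻¹) y₀) := by
        have h1 := sub_eq_zero.1 h0
        rw [← div_eq_mul_inv, eq_comm, div_eq_one_iff_eq (hne _ hb)] at h1
        exact h1
      have hg := hΨ.green_eq hd (by positivity)
        (ζ := rayPoint (green d c c - 1 + (u : ℝ)⁻¹) y₀)
        (by rw [rayPoint_re]; exact hlt.trans_le hb)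
      rw [rayPoint_re, ← hz] at hg
      exact z.2 ⟨by rw [hg]; exact hb, by rw [hg]; exact hz.symm⟩
  let H : C(unitInterval × V, {w : ℂ // w ≠ 0}) :=
    ⟨fun a => ⟨1 - (a.2 : ℂ) * τ a.1, hH0 a.1 a.2⟩, by
      refine Continuous.subtype_mk (continuous_const.sub (Continuous.mul (by fun_prop) ?_)) _
      exact hτc.comp_continuous (by fun_prop) fun a => a.1.2⟩
  let f₀ : C(V, ℂ) := ⟨fun _ => 0, continuous_const⟩
  have hH : ∀ a : V, H (0, a) = ⟨Complex.exp (f₀ a), Complex.exp_ne_zero _⟩ := by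
    intro a
    refine Subtype.ext ?_
    show 1 - (a : ℂ) * τ ((0 : unitInterval) : ℝ) = Complex.exp 0
    rw [hτ, Set.Icc.coe_zero, Function.update_self]
    simp
  set L := Complex.isCoveringMap_exp.liftHomotopy H f₀ hH
  have hL : ∀ z : V, Complex.exp (L (1, z)) = 1 - (z : ℂ) * c⁻¹ := by
    intro z
    have := congrFun (Complex.isCoveringMap_exp.liftHomotopy_lifts H f₀ hH) (1, z)
    have h2 := congrArg Subtype.val this
    have h3 : (H (1, z) : ℂ) = 1 - (z : ℂ) * τ ((1 : unitInterval) : ℝ) := rfl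
    rw [h3] at h2
    rw [hτ, Set.Icc.coe_one, Function.update_of_ne one_ne_zero, hq] at h2
    simp only [inv_one, sub_add_cancel, hc] at h2
    exact h2
  have hc0 : c ≠ 0 := by
    have := hne _ le_rfl
    rwa [hc] at this
  obtain ⟨b, hb⟩ := IsAlgClosed.exists_pow_nat_eq (-c) (show 0 < d by omega)
  have hLc : Continuous fun z : V => b * Complex.exp (L (1, z) / d) := by fun_prop
  refine ⟨fun z => if hz : z ∈ V then b * Complex.exp (L (1, ⟨z, hz⟩) / d) else 0, ?_, ?_⟩
  · rw [continuousOn_iff_continuous_domRestrict]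
    convert hLc using 1
    ext z
    simp
  · intro z hz
    have hz' : z ∈ V := hz
    simp only [hz', dif_pos]
    rw [mul_pow, hb, ← Complex.exp_nat_mul, mul_div_cancel₀ _ hd0, hL]
    field_simp
    ring

/-- The parametrization `Ψ` of the basin, the critical value on the ray at angle `y₀`, and a
branch `g` of the inverse of `poly d c` on the complement of the slit. -/
structure SlitData (d : ℕ) (c : ℂ) (Ψ g : ℂ → ℂ) (y₀ : ℝ) : Prop where
  two_le : 2 ≤ d
  pos : 0 < green d c c
  param : IsParam d c (green d c c / d) Ψ
  hit : Ψ (rayPoint (green d c c) y₀) = c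
  continuousOn : ContinuousOn g (slit d c Ψ y₀)ᶜ
  pow_eq : ∀ z ∉ slit d c Ψ y₀, g z ^ d = z - c

theorem HasExternalAngle.exists_slitData (hd : 2 ≤ d) (h : HasExternalAngle d c y₀) :
    ∃ Ψ g, SlitData d c Ψ g y₀ := by
  have hpos := h.green_pos hd
  obtain ⟨Ψ, hΨ⟩ := exists_isParam hd hpos
  have hc := h.eq_param hd hΨ
  obtain ⟨g, hg, hgd⟩ := exists_branch hd hpos hΨ hc
  exact ⟨Ψ, g, hd, hpos, hΨ, hc, hg, hgd⟩

namespace SlitData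

theorem natCast_pos (S : SlitData d c Ψ g y₀) : (0 : ℝ) < d := by
  exact_mod_cast (by have := S.two_le; omega : 0 < d)

theorem ne_zero (S : SlitData d c Ψ g y₀) : d ≠ 0 := by
  have := S.two_le; omega

theorem div_lt (S : SlitData d c Ψ g y₀) : green d c c / d < green d c c :=
  div_lt_of_green_pos S.two_le S.pos

theorem green_zero_eq (S : SlitData d c Ψ g y₀) : green d c 0 = green d c c / d := by
  rw [← green_zero S.two_le, mul_div_cancel_left₀ _ S.natCast_pos.ne']

theorem div_nonneg (S : SlitData d c Ψ g y₀) : 0 ≤ green d c c / d :=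
  _root_.div_nonneg S.pos.le S.natCast_pos.le

theorem isOpen (S : SlitData d c Ψ g y₀) : IsOpen (slit d c Ψ y₀)ᶜ :=
  (isClosed_slit S.two_le S.pos S.param y₀).isOpen_compl

theorem notMem_of_green_lt {z : ℂ} (h : green d c z < green d c c) :
    z ∉ slit d c Ψ y₀ := fun hz => absurd hz.1 (not_le.2 h)

theorem mul_pow_eq (S : SlitData d c Ψ g y₀) {w z : ℂ} (hw : w ^ d = 1)
    (hz : z ∉ slit d c Ψ y₀) : poly d c (w * g z) = z := by
  rw [poly, mul_pow, hw, one_mul, S.pow_eq z hz, sub_add_cancel]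

theorem branch_ne_zero (S : SlitData d c Ψ g y₀) {z : ℂ} (hz : z ∉ slit d c Ψ y₀) :
    g z ≠ 0 := by
  intro h0
  have := S.pow_eq z hz
  rw [h0, zero_pow S.ne_zero] at this
  have hzc : z = c := (sub_eq_zero.1 this.symm)
  rw [hzc] at hz
  exact hz ⟨le_rfl, S.hit⟩

theorem hasDerivAt (S : SlitData d c Ψ g y₀) {z : ℂ} (hz : z ∉ slit d c Ψ y₀) :
    HasDerivAt g (d * g z ^ (d - 1))⁻¹ z := by
  refine HasDerivAt.of_local_left_inverse (f := poly d c)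
    (S.continuousOn.continuousAt (S.isOpen.mem_nhds hz)) ?_ ?_ ?_
  · exact (hasDerivAt_pow d (g z)).add_const c
  · exact mul_ne_zero (by exact_mod_cast S.ne_zero) (pow_ne_zero _ (S.branch_ne_zero hz))
  · filter_upwards [S.isOpen.mem_nhds hz] with w hw
    simpa using S.mul_pow_eq (one_pow d) hw

/-- The root of unity which selects the inverse branch at a point. -/
def sign (d : ℕ) (c : ℂ) (g : ℂ → ℂ) (z : ℂ) : ℂ := z / g (poly d c z)

theorem sign_pow (S : SlitData d c Ψ g y₀) {z : ℂ} (hz : poly d c z ∉ slit d c Ψ y₀) :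
    sign d c g z ^ d = 1 := by
  have h0 := S.branch_ne_zero hz
  rw [sign, div_pow, S.pow_eq _ hz, poly, add_sub_cancel_right, div_self]
  rw [show z ^ d = poly d c z - c by simp [poly], ← S.pow_eq _ hz]
  exact pow_ne_zero _ h0

theorem sign_mul (S : SlitData d c Ψ g y₀) {z : ℂ} (hz : poly d c z ∉ slit d c Ψ y₀) :
    sign d c g z * g (poly d c z) = z :=
  div_mul_cancel₀ _ (S.branch_ne_zero hz)

theorem param_notMem (S : SlitData d c Ψ g y₀) {x y : ℝ} (hx : green d c c / d < x)
    (hy : (y : UnitAddCircle) ≠ y₀) : Ψ (rayPoint x y) ∉ slit d c Ψ y₀ := by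
  intro h
  have hg := S.param.green_eq S.two_le S.div_nonneg (ζ := rayPoint x y) (by rwa [rayPoint_re])
  rw [rayPoint_re] at hg
  have h2 := h.2
  rw [hg] at h2
  have := S.param.exp_eq _ _ (by rwa [rayPoint_re]) (by rwa [rayPoint_re]) h2
  exact hy (exp_rayPoint_eq_iff.1 this).2.symm

theorem poly_param (S : SlitData d c Ψ g y₀) {x : ℝ} (hx : green d c c / d < x) (y : ℝ) :
    poly d c (Ψ (rayPoint x y)) = Ψ (rayPoint (d * x) (d * y)) := by
  rw [S.param.map_mul _ (by rwa [rayPoint_re]), natCast_mul_rayPoint]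

theorem lt_mul (S : SlitData d c Ψ g y₀) {a x : ℝ} (ha : 0 ≤ a) (hx : a < x) : a < d * x := by
  have : (1 : ℝ) ≤ d := by exact_mod_cast (by have := S.two_le; omega : 1 ≤ d)
  nlinarith

theorem poly_param_notMem (S : SlitData d c Ψ g y₀) {x y : ℝ} (hx : green d c c / d < x)
    (hy : ((d * y : ℝ) : UnitAddCircle) ≠ y₀) : poly d c (Ψ (rayPoint x y)) ∉ slit d c Ψ y₀ := by
  rw [S.poly_param hx]
  exact S.param_notMem (S.lt_mul S.div_nonneg hx) hy

/-- The root of unity of the inverse branch along the ray at angle `y`. -/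
def symbol (d : ℕ) (c : ℂ) (Ψ g : ℂ → ℂ) (y : ℝ) : ℂ :=
  sign d c g (Ψ (rayPoint (green d c c) y))

/-- The sign is a `d`-th root of unity that varies continuously over a product of intervals, where
the image under `f_c` avoids the slit. -/
theorem sign_param_eq (S : SlitData d c Ψ g y₀) {x x' y y' : ℝ} (hx : green d c c / d < x)
    (hx' : green d c c / d < x')
    (hy : ∀ s ∈ uIcc y y', ((d * s : ℝ) : UnitAddCircle) ≠ y₀) :
    sign d c g (Ψ (rayPoint x y)) = sign d c g (Ψ (rayPoint x' y')) := by
  set s : Set (ℝ × ℝ) := Ioi (green d c c / d) ×ˢ uIcc y y'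
  have hs : ∀ a ∈ s, poly d c (Ψ (rayPoint a.1 a.2)) ∉ slit d c Ψ y₀ :=
    fun a ha => S.poly_param_notMem ha.1 (hy _ ha.2)
  have hmem : (x', y') ∈ s := ⟨hx', right_mem_uIcc⟩
  have hc : ContinuousOn (fun a : ℝ × ℝ => Ψ (rayPoint a.1 a.2)) s := by
    refine S.param.continuousOn.comp continuous_rayPoint.continuousOn fun a ha => ?_
    show _ < (rayPoint _ _).re
    rw [rayPoint_re]
    exact ha.1
  refine eqOn_of_pow_eq_pow (s := s) (isPreconnected_Ioi.prod isPreconnected_uIcc)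
    (f := fun a => sign d c g (Ψ (rayPoint a.1 a.2)))
    (g := fun _ => sign d c g (Ψ (rayPoint x' y'))) ?_ continuousOn_const
    (fun _ _ h0 => ?_) (fun a ha => ⟨d, S.ne_zero, ?_⟩) hmem rfl (x := (x, y))
    ⟨hx, left_mem_uIcc⟩
  · exact hc.div (S.continuousOn.comp ((continuous_poly d c).comp_continuousOn hc) hs)
      fun a ha => S.branch_ne_zero (hs a ha)
  · have := S.sign_pow (hs _ hmem)
    simp only at this
    rw [h0, zero_pow S.ne_zero] at this
    exact zero_ne_one this
  · rw [S.sign_pow (hs a ha)]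
    exact (S.sign_pow (hs _ hmem)).symm

theorem sign_param (S : SlitData d c Ψ g y₀) {x y : ℝ} (hx : green d c c / d < x)
    (hy : ((d * y : ℝ) : UnitAddCircle) ≠ y₀) :
    sign d c g (Ψ (rayPoint x y)) = symbol d c Ψ g y :=
  S.sign_param_eq hx S.div_lt fun s hs => by
    rw [uIcc_self] at hs
    rw [mem_singleton_iff.1 hs]
    exact hy

theorem symbol_pow (S : SlitData d c Ψ g y₀) {y : ℝ}
    (hy : ((d * y : ℝ) : UnitAddCircle) ≠ y₀) : symbol d c Ψ g y ^ d = 1 :=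
  S.sign_pow (S.poly_param_notMem S.div_lt hy)

theorem symbol_add_div (S : SlitData d c Ψ g y₀) (y : ℝ) (k : ℤ) :
    symbol d c Ψ g (y + k / d)
      = Complex.exp (k * (2 * Real.pi * Complex.I / d)) * symbol d c Ψ g y := by
  have h1 : rayPoint (green d c c) (y + k / d)
      = rayPoint (green d c c) y + k * (2 * Real.pi * Complex.I / d) := by
    simp only [rayPoint]
    push_cast
    ring
  have h2 : Complex.exp (k * (2 * Real.pi * Complex.I / d)) ^ d = 1 := by
    rw [← Complex.exp_nat_mul, ← Complex.exp_int_mul_two_pi_mul_I k]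
    congr 1
    have : (d : ℂ) ≠ 0 := by exact_mod_cast S.ne_zero
    field_simp
  unfold symbol sign
  rw [h1, rotate_int_of_rotate S.param.rotate (by rw [rayPoint_re]; exact S.div_lt),
    poly_mul_of_pow_eq_one h2, mul_div_assoc]

theorem symbol_add_int (S : SlitData d c Ψ g y₀) (y : ℝ) (k : ℤ) :
    symbol d c Ψ g (y + k) = symbol d c Ψ g y := by
  have h0 : (d : ℝ) ≠ 0 := S.natCast_pos.ne'
  have h0' : (d : ℂ) ≠ 0 := by exact_mod_cast S.ne_zero
  have := S.symbol_add_div y (k * d)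
  push_cast at this
  rw [mul_div_cancel_right₀ _ h0, mul_assoc, mul_div_cancel₀ _ h0',
    Complex.exp_int_mul_two_pi_mul_I, one_mul] at this
  exact this

theorem coe_ne_coe_of_floor {a b : ℝ} (h : 0 < Int.fract (a - b)) :
    (a : UnitAddCircle) ≠ b := by
  intro hab
  rw [← sub_eq_zero, ← AddCircle.coe_sub, AddCircle.coe_eq_zero_iff] at hab
  obtain ⟨n, hn⟩ := hab
  rw [← hn] at h
  simp at h

theorem fract_pos_of_coe_ne_coe {a b : ℝ} (h : (a : UnitAddCircle) ≠ b) :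
    0 < Int.fract (a - b) := by
  refine (Int.fract_nonneg _).lt_of_ne fun h0 => h ?_
  rw [← sub_eq_zero, ← AddCircle.coe_sub, AddCircle.coe_eq_zero_iff]
  refine ⟨⌊a - b⌋, ?_⟩
  have := Int.floor_add_fract (a - b)
  rw [← h0, add_zero] at this
  simpa using this

/-- An angle can be moved to the midpoint of its sector without crossing a preimage of `y₀`. The
midpoints differ by multiples of `1 / d`, where `symbol_add_div` applies. -/
theorem symbol_eq_floor (S : SlitData d c Ψ g y₀) {y : ℝ}
    (hy : ((d * y : ℝ) : UnitAddCircle) ≠ y₀) :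
    symbol d c Ψ g y = Complex.exp (⌊d * y - y₀⌋ * (2 * Real.pi * Complex.I / d))
      * symbol d c Ψ g ((y₀ + 1 / 2) / d) := by
  have hd0 := S.natCast_pos
  rw [← S.symbol_add_div]
  refine S.sign_param_eq S.div_lt S.div_lt fun s hs => coe_ne_coe_of_floor ?_
  have hf := fract_pos_of_coe_ne_coe hy
  have hf1 := Int.fract_lt_one (d * y - y₀)
  have hsum := Int.floor_add_fract (d * y - y₀)
  set k := ⌊d * y - y₀⌋
  set φ := Int.fract (d * y - y₀)
  have hs' : d * s ∈ uIcc (d * y) (y₀ + 1 / 2 + k) := by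
    have he : d * ((y₀ + 1 / 2) / d + k / d) = y₀ + 1 / 2 + k := by field_simp
    rw [← he]
    rw [mem_uIcc] at hs ⊢
    rcases hs with ⟨h1, h2⟩ | ⟨h1, h2⟩
    · exact .inl ⟨by gcongr, by gcongr⟩
    · exact .inr ⟨by gcongr, by gcongr⟩
  have hb : k < d * s - y₀ ∧ d * s - y₀ < k + 1 := by
    rw [mem_uIcc] at hs'
    rcases hs' with ⟨h1, h2⟩ | ⟨h1, h2⟩ <;> constructor <;> linarith
  have hfl : ⌊d * s - y₀⌋ = k := Int.floor_eq_iff.2 ⟨hb.1.le, hb.2⟩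
  rw [Int.fract, hfl]
  linarith [hb.1]

theorem symbol_eq_iff (S : SlitData d c Ψ g y₀) {y y' : ℝ}
    (hy : ((d * y : ℝ) : UnitAddCircle) ≠ y₀) (hy' : ((d * y' : ℝ) : UnitAddCircle) ≠ y₀) :
    symbol d c Ψ g y = symbol d c Ψ g y' ↔
      ∃ n : ℤ, ⌊d * y - y₀⌋ = ⌊d * y' - y₀⌋ + n * d := by
  have hd0 : (d : ℂ) ≠ 0 := by exact_mod_cast S.ne_zero
  have h0 : symbol d c Ψ g ((y₀ + 1 / 2) / d) ≠ 0 := by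
    intro h0
    have h1 := S.symbol_eq_floor hy
    have h2 := S.symbol_pow hy
    rw [h1, h0, mul_zero, zero_pow S.ne_zero] at h2
    exact zero_ne_one h2
  rw [S.symbol_eq_floor hy, S.symbol_eq_floor hy', mul_left_inj' h0,
    Complex.exp_eq_exp_iff_exists_int]
  have hpi : (2 * Real.pi * Complex.I : ℂ) ≠ 0 := Complex.two_pi_I_ne_zero
  constructor
  · rintro ⟨n, hn⟩
    refine ⟨n, ?_⟩
    have h1 : (2 * Real.pi * Complex.I : ℂ) * (⌊d * y - y₀⌋ : ℂ)
        = 2 * Real.pi * Complex.I * (⌊d * y' - y₀⌋ + n * d) := by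
      field_simp at hn
      linear_combination (2 * Real.pi * Complex.I : ℂ) * hn
    exact_mod_cast mul_left_cancel₀ hpi h1
  · rintro ⟨n, hn⟩
    refine ⟨n, ?_⟩
    rw [hn]
    push_cast
    field_simp

end SlitData

end

section

/-! ### Dynamical rays below the potential of the critical point -/

/-- The point at potential `x` on the ray at angle `y`, for potentials above
`green d c c / d ^ (n + 1)`. -/
def rayApprox (d : ℕ) (c : ℂ) (Ψ g : ℂ → ℂ) : ℕ → ℝ → ℝ → ℂ
  | 0, x, y => Ψ (rayPoint x y)
  | n + 1, x, y => SlitData.symbol d c Ψ g y * g (rayApprox d c Ψ g n (d * x) (d * y))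

/-- The point at potential `x > 0` on the ray at angle `y`. -/
def ray (d : ℕ) (c : ℂ) (Ψ g : ℂ → ℂ) (x y : ℝ) : ℂ :=
  rayApprox d c Ψ g ⌈green d c c / x⌉₊ x y

/-- The ray at angle `y` does not meet an iterated preimage of the critical point, if the
critical value has angle `y₀`. -/
def NonPrecritical (d : ℕ) (y₀ y : ℝ) : Prop :=
  ∀ n : ℕ, ((d ^ (n + 1) * y : ℝ) : UnitAddCircle) ≠ y₀

variable {d : ℕ} {c : ℂ} {Ψ g : ℂ → ℂ} {y₀ y : ℝ}

theorem NonPrecritical.ne (h : NonPrecritical d y₀ y) :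
    ((d * y : ℝ) : UnitAddCircle) ≠ y₀ := by simpa using h 0

theorem NonPrecritical.mul (h : NonPrecritical d y₀ y) : NonPrecritical d y₀ (d * y) := by
  intro n
  rw [← mul_assoc, ← pow_succ]
  exact h (n + 1)

theorem NonPrecritical.pow_mul (h : NonPrecritical d y₀ y) (n : ℕ) :
    NonPrecritical d y₀ (d ^ n * y) := by
  intro k
  rw [← mul_assoc, ← pow_add]
  have := h (k + n)
  rwa [show k + n + 1 = k + 1 + n by ring] at this

namespace SlitData

theorem div_pow_lt_iff (S : SlitData d c Ψ g y₀) {x : ℝ} (n : ℕ) :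
    green d c c / d ^ (n + 1) < d * x ↔ green d c c / d ^ (n + 2) < x := by
  have h0 := S.natCast_pos
  rw [pow_succ _ (n + 1), ← div_div, div_lt_iff₀ h0, mul_comm]

theorem div_pow_anti (S : SlitData d c Ψ g y₀) {m n : ℕ} (h : m ≤ n) :
    green d c c / d ^ (n + 1) ≤ green d c c / d ^ (m + 1) := by
  have h1 : (1 : ℝ) ≤ d := by exact_mod_cast (by have := S.two_le; omega : 1 ≤ d)
  have := S.pos
  gcongr

/-- Above the potential of the critical point, the branch selected by the symbol returns the point
of the ray itself. This starts the induction; deeper levels are pull-backs of it. -/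
theorem rayApprox_succ_eq (S : SlitData d c Ψ g y₀) (n : ℕ) :
    ∀ x y : ℝ, NonPrecritical d y₀ y → green d c c / d ^ (n + 1) < x →
      rayApprox d c Ψ g (n + 1) x y = rayApprox d c Ψ g n x y := by
  induction n with
  | zero =>
    intro x y hy hx
    rw [zero_add, pow_one] at hx
    simp only [rayApprox]
    rw [← S.poly_param hx, ← S.sign_param hx hy.ne, S.sign_mul (S.poly_param_notMem hx hy.ne)]
  | succ n ih =>
    intro x y hy hx
    show symbol d c Ψ g y * g (rayApprox d c Ψ g (n + 1) (d * x) (d * y)) = _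
    rw [ih _ _ hy.mul ((S.div_pow_lt_iff n).2 hx), rayApprox]

theorem rayApprox_eq_of_le (S : SlitData d c Ψ g y₀) (hy : NonPrecritical d y₀ y) {x : ℝ}
    {m n : ℕ} (hmn : m ≤ n) (hx : green d c c / d ^ (m + 1) < x) :
    rayApprox d c Ψ g n x y = rayApprox d c Ψ g m x y := by
  induction n, hmn using Nat.le_induction with
  | base => rfl
  | succ n hmn ih =>
    rw [S.rayApprox_succ_eq n x y hy ((S.div_pow_anti hmn).trans_lt hx), ih]

/-- The crude bound `n < d ^ (n + 1)` is enough: the ceiling in `ray` is only a convenient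
sufficient depth of recursion. -/
theorem div_pow_ceil_lt (S : SlitData d c Ψ g y₀) {x : ℝ} (hx : 0 < x) :
    green d c c / d ^ (⌈green d c c / x⌉₊ + 1) < x := by
  have h1 : green d c c / x ≤ ⌈green d c c / x⌉₊ := Nat.le_ceil _
  have h2 : (⌈green d c c / x⌉₊ : ℝ) < (d : ℝ) ^ (⌈green d c c / x⌉₊ + 1) := by
    have := Nat.lt_pow_self (n := ⌈green d c c / x⌉₊ + 1) (a := d) (by have := S.two_le; omega)
    exact_mod_cast (by omega : ⌈green d c c / x⌉₊ < d ^ (⌈green d c c / x⌉₊ + 1))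
  have h3 := S.natCast_pos
  rw [div_lt_iff₀ (by positivity), ← div_lt_iff₀' hx]
  linarith

theorem ray_eq_rayApprox (S : SlitData d c Ψ g y₀) (hy : NonPrecritical d y₀ y) {x : ℝ} {n : ℕ}
    (hx : green d c c / d ^ (n + 1) < x) : ray d c Ψ g x y = rayApprox d c Ψ g n x y := by
  have h3 := S.natCast_pos
  have hx0 : 0 < x := (_root_.div_nonneg S.pos.le (by positivity)).trans_lt hx
  rcases le_total ⌈green d c c / x⌉₊ n with h | h
  · exact (S.rayApprox_eq_of_le hy h (S.div_pow_ceil_lt hx0)).symm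
  · exact S.rayApprox_eq_of_le hy h hx

theorem ray_eq_param (S : SlitData d c Ψ g y₀) (hy : NonPrecritical d y₀ y) {x : ℝ}
    (hx : green d c c / d < x) : ray d c Ψ g x y = Ψ (rayPoint x y) :=
  S.ray_eq_rayApprox hy (n := 0) (by simpa using hx)

/-- Potential and avoidance of the slit are proved together: the next pull-back needs a point off
the slit, and this follows from the potential below that of `c` and from the angle above it. -/
theorem rayApprox_green (S : SlitData d c Ψ g y₀) (n : ℕ) :
    ∀ x y : ℝ, NonPrecritical d y₀ y → green d c c / d ^ (n + 1) < x →
      green d c (rayApprox d c Ψ g n x y) = x ∧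
      ((y : UnitAddCircle) ≠ y₀ → rayApprox d c Ψ g n x y ∉ slit d c Ψ y₀) := by
  have step : ∀ n x y, NonPrecritical d y₀ y → green d c (rayApprox d c Ψ g n x y) = x →
      (y : UnitAddCircle) ≠ y₀ → rayApprox d c Ψ g n x y ∉ slit d c Ψ y₀ := by
    intro n x y hy hg hy0
    rcases lt_or_ge x (green d c c) with hx | hx
    · exact notMem_of_green_lt (by rwa [hg])
    · have hx1 : green d c c / d < x := S.div_lt.trans_le hx
      rw [S.rayApprox_eq_of_le hy n.zero_le (by simpa using hx1)]
      exact S.param_notMem hx1 hy0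
  induction n with
  | zero =>
    intro x y hy hx
    rw [zero_add, pow_one] at hx
    have : green d c (rayApprox d c Ψ g 0 x y) = x := by
      have := S.param.green_eq S.two_le S.div_nonneg (ζ := rayPoint x y) (by rwa [rayPoint_re])
      rwa [rayPoint_re] at this
    exact ⟨this, step 0 x y hy this⟩
  | succ n ih =>
    intro x y hy hx
    obtain ⟨h1, h2⟩ := ih _ _ hy.mul ((S.div_pow_lt_iff n).2 hx)
    have h3 := S.mul_pow_eq (S.symbol_pow hy.ne) (h2 hy.ne)
    have : green d c (rayApprox d c Ψ g (n + 1) x y) = x := by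
      have h4 := green_poly S.two_le c (rayApprox d c Ψ g (n + 1) x y)
      rw [rayApprox, h3, h1] at h4
      exact (mul_left_cancel₀ S.natCast_pos.ne' h4).symm
    exact ⟨this, step _ x y hy this⟩

theorem green_ray (S : SlitData d c Ψ g y₀) (hy : NonPrecritical d y₀ y) {x : ℝ} (hx : 0 < x) :
    green d c (ray d c Ψ g x y) = x :=
  (S.rayApprox_green _ x y hy (S.div_pow_ceil_lt hx)).1

theorem ray_notMem (S : SlitData d c Ψ g y₀) (hy : NonPrecritical d y₀ y)
    (hy0 : (y : UnitAddCircle) ≠ y₀) {x : ℝ} (hx : 0 < x) :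
    ray d c Ψ g x y ∉ slit d c Ψ y₀ :=
  (S.rayApprox_green _ x y hy (S.div_pow_ceil_lt hx)).2 hy0

theorem ray_eq_symbol_mul (S : SlitData d c Ψ g y₀) (hy : NonPrecritical d y₀ y) {x : ℝ}
    (hx : 0 < x) : ray d c Ψ g x y
      = symbol d c Ψ g y * g (ray d c Ψ g (d * x) (d * y)) := by
  have h1 := S.div_pow_ceil_lt (mul_pos S.natCast_pos hx)
  rw [S.ray_eq_rayApprox hy ((S.div_pow_lt_iff _).1 h1), S.ray_eq_rayApprox hy.mul h1, rayApprox]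

theorem poly_ray (S : SlitData d c Ψ g y₀) (hy : NonPrecritical d y₀ y) {x : ℝ}
    (hx : 0 < x) : poly d c (ray d c Ψ g x y) = ray d c Ψ g (d * x) (d * y) := by
  rw [S.ray_eq_symbol_mul hy hx]
  exact S.mul_pow_eq (S.symbol_pow hy.ne) (S.ray_notMem hy.mul hy.ne (mul_pos S.natCast_pos hx))

theorem poly_iterate_ray (S : SlitData d c Ψ g y₀) (hy : NonPrecritical d y₀ y) {x : ℝ}
    (hx : 0 < x) (n : ℕ) :
    (poly d c)^[n] (ray d c Ψ g x y) = ray d c Ψ g (d ^ n * x) (d ^ n * y) := by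
  have h0 := S.natCast_pos
  induction n with
  | zero => simp
  | succ n ih =>
    rw [Function.iterate_succ_apply', ih, S.poly_ray (hy.pow_mul n) (by positivity), pow_succ',
      mul_assoc, mul_assoc]

theorem ray_add_int (S : SlitData d c Ψ g y₀) {x : ℝ} (hx : 0 < x)
    (hy : NonPrecritical d y₀ y) (k : ℤ) : ray d c Ψ g x (y + k) = ray d c Ψ g x y := by
  have key : ∀ n : ℕ, ∀ (x y : ℝ) (k : ℤ), NonPrecritical d y₀ y →
      green d c c / d ^ (n + 1) < x →
      rayApprox d c Ψ g n x (y + k) = rayApprox d c Ψ g n x y := by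
    intro n
    induction n with
    | zero =>
      intro x y k _ hx
      rw [zero_add, pow_one] at hx
      have := S.param.periodic S.ne_zero (ζ := rayPoint x y) (by rwa [rayPoint_re]) k
      rw [rayApprox, rayApprox, ← this]
      congr 1
      simp only [rayPoint]
      push_cast
      ring
    | succ n ih =>
      intro x y k hy hx
      have := ih (d * x) (d * y) (d * k) hy.mul ((S.div_pow_lt_iff n).2 hx)
      push_cast at this
      rw [rayApprox, rayApprox, S.symbol_add_int, mul_add, this]
  exact key _ x y k hy (S.div_pow_ceil_lt hx)

theorem continuousOn_ray (S : SlitData d c Ψ g y₀) (hy : NonPrecritical d y₀ y) :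
    ContinuousOn (fun x => ray d c Ψ g x y) (Ioi 0) := by
  have key : ∀ n : ℕ, ∀ y : ℝ, NonPrecritical d y₀ y →
      ContinuousOn (fun x => rayApprox d c Ψ g n x y) (Ioi (green d c c / d ^ (n + 1))) := by
    intro n
    induction n with
    | zero =>
      intro y _
      refine S.param.continuousOn.comp
        (continuous_rayPoint.comp (.prodMk_left y)).continuousOn fun x hx => ?_
      rw [zero_add, pow_one] at hx
      show _ < (rayPoint x y).re
      rw [rayPoint_re]
      exact hx
    | succ n ih =>
      intro y hy
      have hm : MapsTo (fun x : ℝ => d * x) (Ioi (green d c c / d ^ (n + 1 + 1)))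
        (Ioi (green d c c / d ^ (n + 1))) := fun x hx => (S.div_pow_lt_iff n).2 hx
      exact continuousOn_const.mul (S.continuousOn.comp
        ((ih _ hy.mul).comp (by fun_prop) hm)
        fun x hx => (S.rayApprox_green n _ _ hy.mul (hm hx)).2 hy.ne)
  intro x hx
  have h1 := S.div_pow_ceil_lt hx
  have hn := Ioi_mem_nhds h1
  have h2 := (key _ y hy).continuousAt hn
  refine (h2.congr ?_).continuousWithinAt
  filter_upwards [hn] with z hz
  exact (S.ray_eq_rayApprox hy hz).symm

theorem isRayOn_ray (S : SlitData d c Ψ g y₀) (hy : NonPrecritical d y₀ y) :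
    IsRayOn d c y 1 fun r => ray d c Ψ g (Real.log r) y := by
  have h0 := S.natCast_pos
  obtain ⟨Y, hY⟩ := S.param.eventually
  have hlog : ∀ r : ℝ, 1 < r → 0 < Real.log r := fun r hr => Real.log_pos hr
  have hb : ∀ x : ℝ, max Y (green d c c / d) < x → ∀ y : ℝ, NonPrecritical d y₀ y →
      ray d c Ψ g x y ∈ nearInfinity c ∧
      bottcher d c (ray d c Ψ g x y) = Complex.exp (rayPoint x y) := by
    intro x hx y hy
    obtain ⟨h1, h2⟩ := max_lt_iff.1 hx
    have := hY (rayPoint x y) (by rwa [rayPoint_re])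
    rw [S.ray_eq_param hy h2]
    exact ⟨this.1, this.2.2⟩
  refine ⟨?_, ?_, ?_, ?_⟩
  · exact (S.continuousOn_ray hy).comp
      (Real.continuousOn_log.mono fun r (hr : (1 : ℝ) < r) => (one_pos.trans hr).ne') hlog
  · filter_upwards [eventually_gt_atTop 0,
      Real.tendsto_log_atTop.eventually_gt_atTop (max Y (green d c c / d))] with r hr0 hr
    refine ⟨(hb _ hr y hy).1, ?_⟩
    rw [(hb _ hr y hy).2, ← radial_exp, Real.exp_log hr0]
  · intro r hr
    have hr0 : (0 : ℝ) < r := one_pos.trans hr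
    filter_upwards [eventually_lt_pow_mul S.two_le (hlog r hr) (max Y (green d c c / d))]
      with n hn
    rw [S.poly_iterate_ray hy (hlog r hr)]
    refine ⟨(hb _ hn _ (hy.pow_mul n)).1, ?_⟩
    rw [(hb _ hn _ (hy.pow_mul n)).2, ← natCast_pow_mul_rayPoint]
    have := Complex.exp_nat_mul (rayPoint (Real.log r) y) (d ^ n)
    push_cast at this
    rw [this, ← radial_exp, Real.exp_log hr0]
  · intro r hr n hn
    rw [S.poly_iterate_ray hy (hlog r hr)] at hn
    have hpos : 0 < (d : ℝ) ^ n * Real.log r := mul_pos (by positivity) (hlog r hr)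
    have hy' := hy.pow_mul n
    rw [S.ray_eq_symbol_mul hy' hpos] at hn
    rcases mul_eq_zero.1 hn with h | h
    · have := S.symbol_pow hy'.ne
      rw [h, zero_pow S.ne_zero] at this
      exact zero_ne_one this
    · exact S.branch_ne_zero (S.ray_notMem hy'.mul hy'.ne (mul_pos h0 hpos)) h

/-- A ray which is defined down to the filled-in Julia set is not precritical. -/
theorem nonPrecritical_of_isRayOn (S : SlitData d c Ψ g y₀) {γ : ℝ → ℂ}
    (h : IsRayOn d c y 1 γ) : NonPrecritical d y₀ y := by
  intro n hn
  have h0 := S.natCast_pos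
  obtain ⟨γ', h1, h2⟩ := h.exists_map_iterate S.two_le (n + 1)
  have hang : d ^ (n + 1) • (y : UnitAddCircle) = (y₀ : UnitAddCircle) := by
    rw [← hn, ← AddCircle.coe_nsmul]
    congr 1
    simp
  rw [hang] at h1
  have h3 := S.param.eq_of_isRayOn S.two_le S.green_zero_eq.le le_rfl h1 S.div_lt
    (Real.one_lt_exp_iff.2 S.pos)
  -- The point at this potential is mapped by `f_c^(n+1)` to `c`, hence by `f_c^n` to the critical
  -- point.
  have h4 := h2 (green d c c / d ^ (n + 1))
  rw [mul_div_cancel₀ _ (by positivity), h3, S.hit, Function.iterate_succ_apply'] at h4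
  refine h.not_precritical (Real.exp (green d c c / d ^ (n + 1)))
    (Real.one_lt_exp_iff.2 (div_pos S.pos (by positivity))) n ?_
  have h5 := h4.symm
  rw [poly, add_eq_right] at h5
  exact eq_zero_of_pow_eq_zero h5

end SlitData

end

section

/-! ### Contraction of the inverse branches -/

variable {d : ℕ} {c : ℂ} {Ψ g : ℂ → ℂ} {y₀ y : ℝ}

/-- The composition of the first `n` inverse branches `z ↦ ξ k * g z`. -/
def branchWord (g : ℂ → ℂ) : (ℕ → ℂ) → ℕ → ℂ → ℂ
  | _, 0, z => z
  | ξ, n + 1, z => ξ 0 * g (branchWord g (fun k => ξ (k + 1)) n z)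

/-- The points at potential below that of the critical value. -/
def belowValue (d : ℕ) (c : ℂ) : Set ℂ := {z | green d c z < green d c c}

namespace SlitData

theorem isOpen_belowValue (S : SlitData d c Ψ g y₀) : IsOpen (belowValue d c) :=
  isOpen_lt (continuous_green S.two_le c) continuous_const

theorem green_branch (S : SlitData d c Ψ g y₀) {w z : ℂ} (hw : w ^ d = 1)
    (hz : z ∈ belowValue d c) : green d c (w * g z) = green d c z / d := by
  have h := green_poly S.two_le c (w * g z)
  rw [S.mul_pow_eq hw (notMem_of_green_lt hz)] at h
  rw [h, mul_div_cancel_left₀ _ S.natCast_pos.ne']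

theorem branch_mem (S : SlitData d c Ψ g y₀) {w z : ℂ} (hw : w ^ d = 1)
    (hz : z ∈ belowValue d c) : green d c (w * g z) < green d c c / d := by
  rw [S.green_branch hw hz]
  exact div_lt_div_of_pos_right hz S.natCast_pos

theorem branchWord_mem (S : SlitData d c Ψ g y₀) (n : ℕ) : ∀ (ξ : ℕ → ℂ), (∀ k, ξ k ^ d = 1) →
    ∀ z ∈ belowValue d c, branchWord g ξ n z ∈ belowValue d c := by
  induction n with
  | zero => intro _ _ z hz; exact hz
  | succ n ih =>
    intro ξ hξ z hz
    exact (S.branch_mem (hξ 0) (ih _ (fun k => hξ (k + 1)) z hz)).trans S.div_lt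

theorem poly_iterate_branchWord (S : SlitData d c Ψ g y₀) (n : ℕ) : ∀ (ξ : ℕ → ℂ),
    (∀ k, ξ k ^ d = 1) → ∀ z ∈ belowValue d c, (poly d c)^[n] (branchWord g ξ n z) = z := by
  induction n with
  | zero => intro _ _ z _; rfl
  | succ n ih =>
    intro ξ hξ z hz
    rw [Function.iterate_succ_apply, branchWord, S.mul_pow_eq (hξ 0)
      (notMem_of_green_lt (S.branchWord_mem n _ (fun k => hξ (k + 1)) z hz))]
    exact ih _ (fun k => hξ (k + 1)) z hz

theorem differentiableAt_branch (S : SlitData d c Ψ g y₀) {z : ℂ} (hz : z ∈ belowValue d c) :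
    DifferentiableAt ℂ g z := (S.hasDerivAt (notMem_of_green_lt hz)).differentiableAt

theorem differentiableAt_branchWord (S : SlitData d c Ψ g y₀) (n : ℕ) : ∀ (ξ : ℕ → ℂ),
    (∀ k, ξ k ^ d = 1) → ∀ z ∈ belowValue d c, DifferentiableAt ℂ (branchWord g ξ n) z := by
  induction n with
  | zero => intro _ _ z _; exact differentiableAt_id
  | succ n ih =>
    intro ξ hξ z hz
    have h1 := ih _ (fun k => hξ (k + 1)) z hz
    have h2 := S.differentiableAt_branch (S.branchWord_mem n _ (fun k => hξ (k + 1)) z hz)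
    exact (h2.comp z h1).const_mul (ξ 0)

theorem exists_norm_le (S : SlitData d c Ψ g y₀) :
    ∃ R, 0 < R ∧ ∀ z ∈ belowValue d c, ‖z‖ ≤ R :=
  ⟨_, Real.exp_pos _, fun _ hz => norm_le_of_green_le S.two_le (le_of_lt hz)⟩

/-- An elementary substitute for the hyperbolic metric. Each inverse branch `β` of the word is
replaced by `β + τ * (β - β x')`, with `x'` the point the word has reached. This keeps the value at
`x'` and multiplies the derivative by `1 + τ`. It still maps the region into itself, because the
images of the branches stay a definite distance inside. -/
theorem exists_expanded (S : SlitData d c Ψ g y₀) : ∃ τ : ℝ, 0 < τ ∧ ∀ (n : ℕ) (ξ : ℕ → ℂ),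
    (∀ k, ξ k ^ d = 1) → ∀ x ∈ belowValue d c, ∃ h : ℂ → ℂ,
      DifferentiableOn ℂ h (belowValue d c) ∧ MapsTo h (belowValue d c) (belowValue d c) ∧
      h x = branchWord g ξ n x ∧ deriv h x = (1 + τ) ^ n * deriv (branchWord g ξ n) x := by
  obtain ⟨R, hR, hR'⟩ := S.exists_norm_le
  have hsub : {z | green d c z ≤ green d c c / d} ⊆ belowValue d c :=
    fun z hz => lt_of_le_of_lt hz S.div_lt
  obtain ⟨ε, hε, hε'⟩ := (isCompact_green_le S.two_le c (green d c c / d)).exists_thickening_subset_open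
    S.isOpen_belowValue hsub
  -- Values of the branch differ by at most `2 * R`, so the added term has norm at most `τ * (2 * R)
  -- = ε / 2`.
  have hτ0 : 0 < ε / (4 * R) := by positivity
  refine ⟨ε / (4 * R), hτ0, ?_⟩
  set τ := ε / (4 * R) with hτ
  intro n
  induction n with
  | zero =>
    intro ξ _ x _
    exact ⟨id, differentiableOn_id, mapsTo_id _, rfl, by simp [branchWord]⟩
  | succ n ih =>
    intro ξ hξ x hx
    obtain ⟨h, h1, h2, h3, h4⟩ := ih _ (fun k => hξ (k + 1)) x hx
    set x' := branchWord g (fun k => ξ (k + 1)) n x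
    have hx' : x' ∈ belowValue d c := S.branchWord_mem n _ (fun k => hξ (k + 1)) x hx
    set b : ℂ → ℂ := fun y => ξ 0 * g y + τ * (ξ 0 * g y - ξ 0 * g x') with hb
    have hbmem : MapsTo b (belowValue d c) (belowValue d c) := by
      intro y hy
      refine hε' (Metric.mem_thickening_iff.2 ⟨ξ 0 * g y, (S.branch_mem (hξ 0) hy).le, ?_⟩)
      rw [dist_eq_norm, hb]
      simp only [add_sub_cancel_left, norm_mul]
      rw [← mul_sub, norm_mul, ← norm_mul, mul_sub]
      have e1 := hR' _ (hsub (S.branch_mem (hξ 0) hy).le)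
      have e2 := hR' _ (hsub (S.branch_mem (hξ 0) hx').le)
      have e3 := (norm_sub_le (ξ 0 * g y) (ξ 0 * g x')).trans (add_le_add e1 e2)
      rw [Complex.norm_real, Real.norm_of_nonneg hτ0.le]
      calc τ * ‖ξ 0 * g y - ξ 0 * g x'‖ ≤ τ * (R + R) := by gcongr
        _ = ε / 2 := by rw [hτ]; field_simp; ring
        _ < ε := by linarith
    have hbd : ∀ y ∈ belowValue d c, HasDerivAt b (ξ 0 * deriv g y + τ * (ξ 0 * deriv g y)) y := by
      intro y hy
      have := (S.differentiableAt_branch hy).hasDerivAt.const_mul (ξ 0)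
      exact this.add ((this.sub_const _).const_mul _)
    have hop := S.isOpen_belowValue
    refine ⟨b ∘ h, fun y hy => ?_, hbmem.comp h2, ?_, ?_⟩
    · exact ((hbd _ (h2 hy)).differentiableAt.comp y
        (h1.differentiableAt (hop.mem_nhds hy))).differentiableWithinAt
    · rw [Function.comp_apply, h3, hb]
      simp only [sub_self, mul_zero, add_zero]
      rfl
    · have e1 : HasDerivAt h (deriv h x) x := (h1.differentiableAt (hop.mem_nhds hx)).hasDerivAt
      have e2 := hbd _ hx'
      rw [← h3] at e2
      have e3 := (e2.comp x e1).deriv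
      rw [e3, h4, h3]
      have e4 : HasDerivAt (branchWord g ξ (n + 1))
          (ξ 0 * (deriv g x' * deriv (branchWord g (fun k => ξ (k + 1)) n) x)) x :=
        ((S.differentiableAt_branch hx').hasDerivAt.comp x
          (S.differentiableAt_branchWord n _ (fun k => hξ (k + 1)) x hx).hasDerivAt).const_mul _
      rw [e4.deriv]
      ring

/-- The stretched map takes values in a fixed disc, so Cauchy's estimate bounds its derivative,
which is `(1 + τ) ^ n` times that of the word. -/
theorem exists_deriv_le (S : SlitData d c Ψ g y₀) : ∃ R l : ℝ, 0 < R ∧ 0 < l ∧ l < 1 ∧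
    ∀ (x : ℂ) (s : ℝ), 0 < s → Metric.closedBall x s ⊆ belowValue d c →
      ∀ (n : ℕ) (ξ : ℕ → ℂ), (∀ k, ξ k ^ d = 1) →
        ‖deriv (branchWord g ξ n) x‖ ≤ R / s * l ^ n := by
  obtain ⟨R, hR, hR'⟩ := S.exists_norm_le
  obtain ⟨τ, hτ, H⟩ := S.exists_expanded
  refine ⟨R, (1 + τ)⁻¹, hR, by positivity, inv_lt_one_of_one_lt₀ (by linarith), ?_⟩
  intro x s hs hsub n ξ hξ
  obtain ⟨h, h1, h2, -, h4⟩ := H n ξ hξ x (hsub (Metric.mem_closedBall_self hs.le))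
  have h5 := Complex.norm_deriv_le_of_forall_mem_sphere_norm_le (f := h) (c := x) (C := R) hs
    ((h1.mono hsub).diffContOnCl_ball subset_rfl)
    fun z hz => hR' _ (h2 (hsub (Metric.sphere_subset_closedBall hz)))
  have h6 : ‖deriv h x‖ = (1 + τ) ^ n * ‖deriv (branchWord g ξ n) x‖ := by
    rw [h4, norm_mul, norm_pow]
    congr 2
    rw [show (1 + τ : ℂ) = ((1 + τ : ℝ) : ℂ) by push_cast; rfl, Complex.norm_real,
      Real.norm_of_nonneg (by linarith)]
  rw [inv_pow, ← div_eq_mul_inv, le_div_iff₀ (by positivity), mul_comm, ← h6]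
  exact h5

/-- Words contract small balls by the mean value inequality. Connectedness of `Q` chains balls from
any point to a base point, and compactness makes the constant uniform. It is essential that `C` does
not depend on the word. -/
theorem exists_contraction (S : SlitData d c Ψ g y₀) : ∃ l : ℝ, 0 < l ∧ l < 1 ∧
    (∀ x ∈ belowValue d c, ∃ C, ∀ (n : ℕ) (ξ : ℕ → ℂ), (∀ k, ξ k ^ d = 1) →
      ‖deriv (branchWord g ξ n) x‖ ≤ C * l ^ n) ∧
    ∀ Q ⊆ belowValue d c, IsPreconnected Q → IsCompact Q → ∃ C, ∀ x ∈ Q, ∀ y ∈ Q,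
      ∀ (n : ℕ) (ξ : ℕ → ℂ), (∀ k, ξ k ^ d = 1) →
        ‖branchWord g ξ n x - branchWord g ξ n y‖ ≤ C * l ^ n := by
  obtain ⟨R, l, hR, hl0, hl1, H⟩ := S.exists_deriv_le
  have hball : ∀ x ∈ belowValue d c, ∃ s > 0, Metric.closedBall x (2 * s) ⊆ belowValue d c := by
    intro x hx
    obtain ⟨s, hs, h⟩ := Metric.nhds_basis_closedBall.mem_iff.1 (S.isOpen_belowValue.mem_nhds hx)
    exact ⟨s / 2, by positivity, by rwa [mul_div_cancel₀ _ two_ne_zero]⟩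
  have hloc : ∀ x ∈ belowValue d c, ∃ U ∈ 𝓝 x, ∀ y ∈ U, ∀ y' ∈ U, ∀ (n : ℕ) (ξ : ℕ → ℂ),
      (∀ k, ξ k ^ d = 1) →
        ‖branchWord g ξ n y - branchWord g ξ n y'‖ ≤ 2 * R * l ^ n := by
    intro x hx
    obtain ⟨s, hs, hsub⟩ := hball x hx
    refine ⟨Metric.ball x s, Metric.ball_mem_nhds x hs, fun y hy y' hy' n ξ hξ => ?_⟩
    have hin : ∀ w ∈ Metric.ball x s, Metric.closedBall w s ⊆ belowValue d c := by
      intro w hw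
      refine (Metric.closedBall_subset_closedBall' ?_).trans hsub
      linarith [Metric.mem_ball.1 hw]
    have h1 := Convex.norm_image_sub_le_of_norm_deriv_le (f := branchWord g ξ n)
      (s := Metric.ball x s) (C := R / s * l ^ n)
      (fun w hw => S.differentiableAt_branchWord n ξ hξ w
        (hin w hw (Metric.mem_closedBall_self hs.le)))
      (fun w hw => H w s hs (hin w hw) n ξ hξ) (convex_ball x s) hy' hy
    have h2 : ‖y - y'‖ ≤ 2 * s := by
      rw [← dist_eq_norm]
      linarith [dist_triangle_right y y' x, Metric.mem_ball.1 hy, Metric.mem_ball.1 hy']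
    calc _ ≤ R / s * l ^ n * ‖y - y'‖ := h1
      _ ≤ R / s * l ^ n * (2 * s) := by gcongr
      _ = 2 * R * l ^ n := by field_simp
  refine ⟨l, hl0, hl1, fun x hx => ?_, fun Q hQ hQc hQk => ?_⟩
  · obtain ⟨s, hs, hsub⟩ := hball x hx
    exact ⟨R / (2 * s), H x (2 * s) (by positivity) hsub⟩
  · rcases Q.eq_empty_or_nonempty with rfl | ⟨x₀, hx₀⟩
    · exact ⟨0, by simp⟩
    have hrel := fun (a : ℂ) (ha : a ∈ Q) => hQc.induction₂ (x := a) (y := x₀) (fun x y => ∃ C, ∀ (n : ℕ) (ξ : ℕ → ℂ), (∀ k, ξ k ^ d = 1) →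
        ‖branchWord g ξ n x - branchWord g ξ n y‖ ≤ C * l ^ n)
      (fun x hx => by
        obtain ⟨U, hU, hU'⟩ := hloc x (hQ hx)
        filter_upwards [mem_nhdsWithin_of_mem_nhds hU] with y hy
        exact ⟨2 * R, hU' x (mem_of_mem_nhds hU) y hy⟩)
      (fun x y z _ _ _ ⟨C, hC⟩ ⟨C', hC'⟩ => ⟨C + C', fun n ξ hξ => by
        rw [add_mul]
        exact (norm_sub_le_norm_sub_add_norm_sub _ _ _).trans
          (add_le_add (hC n ξ hξ) (hC' n ξ hξ))⟩)
      (fun x y _ _ ⟨C, hC⟩ => ⟨C, fun n ξ hξ => by rw [norm_sub_rev]; exact hC n ξ hξ⟩) ha hx₀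
    have hunif : ∃ C, ∀ x ∈ Q, ∀ (n : ℕ) (ξ : ℕ → ℂ), (∀ k, ξ k ^ d = 1) →
        ‖branchWord g ξ n x - branchWord g ξ n x₀‖ ≤ C * l ^ n := by
      refine hQk.induction_on (p := fun s => ∃ C, ∀ x ∈ s, ∀ (n : ℕ) (ξ : ℕ → ℂ),
        (∀ k, ξ k ^ d = 1) → ‖branchWord g ξ n x - branchWord g ξ n x₀‖ ≤ C * l ^ n)
        ⟨0, by simp⟩ (fun s t hst ⟨C, hC⟩ => ⟨C, fun x hx => hC x (hst hx)⟩) ?_ ?_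
      · rintro s t ⟨C, hC⟩ ⟨C', hC'⟩
        refine ⟨max C C', fun x hx n ξ hξ => ?_⟩
        rcases hx with hx | hx
        · exact (hC x hx n ξ hξ).trans (by gcongr; exact le_max_left _ _)
        · exact (hC' x hx n ξ hξ).trans (by gcongr; exact le_max_right _ _)
      · intro x hx
        obtain ⟨U, hU, hU'⟩ := hloc x (hQ hx)
        obtain ⟨C, hC⟩ := hrel x hx
        refine ⟨U, mem_nhdsWithin_of_mem_nhds hU, 2 * R + C, fun y hy n ξ hξ => ?_⟩
        rw [add_mul]
        exact (norm_sub_le_norm_sub_add_norm_sub _ _ _).trans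
          (add_le_add (hU' y hy x (mem_of_mem_nhds hU) n ξ hξ) (hC n ξ hξ))
    obtain ⟨C, hC⟩ := hunif
    refine ⟨C + C, fun x hx y hy n ξ hξ => ?_⟩
    rw [add_mul]
    refine (norm_sub_le_norm_sub_add_norm_sub _ (branchWord g ξ n x₀) _).trans
      (add_le_add (hC x hx n ξ hξ) ?_)
    rw [norm_sub_rev]
    exact hC y hy n ξ hξ

end SlitData

end

section

/-! ### Landing of periodic rays -/

variable {d : ℕ} {c z z' : ℂ} {Ψ g : ℂ → ℂ} {y₀ y y' : ℝ}

theorem branchWord_apply_orbit {g : ℂ → ℂ} (n : ℕ) : ∀ (ξ w : ℕ → ℂ),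
    (∀ k, w k = ξ k * g (w (k + 1))) → branchWord g ξ n (w n) = w 0 := by
  induction n with
  | zero => intro _ _ _; rfl
  | succ n ih =>
    intro ξ w h
    rw [branchWord, ih (fun k => ξ (k + 1)) (fun k => w (k + 1)) fun k => h (k + 1), ← h 0]

/-- The ray at angle `y` converges to `z` as the potential tends to `0`. -/
def Lands (d : ℕ) (c : ℂ) (Ψ g : ℂ → ℂ) (y : ℝ) (z : ℂ) : Prop :=
  Tendsto (fun x => ray d c Ψ g x y) (𝓝[>] 0) (𝓝 z)

namespace SlitData

theorem branchWord_ray (S : SlitData d c Ψ g y₀) (hy : NonPrecritical d y₀ y) {x : ℝ}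
    (hx : 0 < x) (n : ℕ) :
    branchWord g (fun k => symbol d c Ψ g (d ^ k * y)) n (ray d c Ψ g (d ^ n * x) (d ^ n * y))
      = ray d c Ψ g x y := by
  have h0 := S.natCast_pos
  have := branchWord_apply_orbit (g := g) n (fun k => symbol d c Ψ g (d ^ k * y))
    (fun k => ray d c Ψ g (d ^ k * x) (d ^ k * y)) fun k => by
      rw [S.ray_eq_symbol_mul (hy.pow_mul k) (by positivity), pow_succ', mul_assoc, mul_assoc]
  simpa using this

/-- The segment of the ray between the potentials `x₀ / D` and `x₀` is a fundamental segment for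
`f_c^m`. Its pull-backs are consecutive pieces of the ray whose diameters decrease geometrically. -/
theorem exists_lands (S : SlitData d c Ψ g y₀) (hy : NonPrecritical d y₀ y) {m : ℕ} {k : ℤ}
    (hm : m ≠ 0) (hk : (d : ℝ) ^ m * y = y + k) : ∃ z, Lands d c Ψ g y z := by
  have h0 := S.natCast_pos
  have hd1 : (1 : ℝ) < d := by exact_mod_cast (by have := S.two_le; omega : 1 < d)
  obtain ⟨l, hl0, hl1, -, hl⟩ := S.exists_contraction
  set D : ℝ := (d : ℝ) ^ m with hD
  have hD1 : 1 < D := one_lt_pow₀ hd1 hm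
  have hD0 : 0 < D := by positivity
  obtain ⟨x₀, hx₀⟩ := exists_between S.pos
  have hper : ∀ (j : ℕ) (x : ℝ), 0 < x →
      ray d c Ψ g x ((d : ℝ) ^ (m * j) * y) = ray d c Ψ g x y := by
    intro j x hx
    induction j with
    | zero => simp
    | succ j ih =>
      rw [← ih, mul_add, mul_one, pow_add, mul_assoc, ← hD, hk, mul_add]
      have := S.ray_add_int hx (hy.pow_mul (m * j)) (d ^ (m * j) * k)
      push_cast at this
      exact this
  have hword : ∀ (j : ℕ) (x : ℝ), 0 < x → ray d c Ψ g x y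
      = branchWord g (fun k => symbol d c Ψ g (d ^ k * y)) (m * j)
        (ray d c Ψ g (D ^ j * x) y) := by
    intro j x hx
    rw [← S.branchWord_ray hy hx (m * j), hper j _ (by positivity), pow_mul]
  have hcont : ContinuousOn (fun x => ray d c Ψ g x y) (Icc (x₀ / D) x₀) :=
    (S.continuousOn_ray hy).mono fun x hx => (div_pos hx₀.1 hD0).trans_le hx.1
  obtain ⟨C, hC⟩ := hl ((fun x => ray d c Ψ g x y) '' Icc (x₀ / D) x₀)
    (by
      rintro _ ⟨x, hx, rfl⟩
      show green d c _ < _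
      rw [S.green_ray hy ((div_pos hx₀.1 hD0).trans_le hx.1)]
      exact hx.2.trans_lt hx₀.2)
    (isPreconnected_Icc.image _ hcont) (isCompact_Icc.image_of_continuousOn hcont)
  have hle : x₀ / D ≤ x₀ := div_le_self hx₀.1.le hD1.le
  have hsym : ∀ k, (fun k : ℕ => symbol d c Ψ g (d ^ k * y)) k ^ d = 1 :=
    fun k => S.symbol_pow (hy.pow_mul k).ne
  have key : ∀ (j : ℕ) (x : ℝ), D ^ j * x ∈ Icc (x₀ / D) x₀ →
      ‖ray d c Ψ g x y - ray d c Ψ g (x₀ / D ^ j) y‖ ≤ C * (l ^ m) ^ j := by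
    intro j x hx
    have hx0 : 0 < x := by
      have := (div_pos hx₀.1 hD0).trans_le hx.1
      exact (mul_pos_iff_of_pos_left (by positivity)).1 this
    rw [hword j x hx0, hword j (x₀ / D ^ j) (div_pos hx₀.1 (by positivity)),
      mul_div_cancel₀ _ (by positivity), ← pow_mul l]
    exact hC _ (mem_image_of_mem _ hx) _ (mem_image_of_mem _ ⟨hle, le_rfl⟩) _ _ hsym
  have hl' : l ^ m < 1 := pow_lt_one₀ hl0.le hl1 hm
  have hcauchy : CauchySeq fun j : ℕ => ray d c Ψ g (x₀ / D ^ j) y := by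
    refine cauchySeq_of_le_geometric (l ^ m) C hl' fun j => ?_
    rw [dist_comm, dist_eq_norm]
    refine key j _ ?_
    have : D ^ j * (x₀ / D ^ (j + 1)) = x₀ / D := by field_simp; ring
    rw [this]
    exact ⟨le_rfl, hle⟩
  obtain ⟨z, hz⟩ := cauchySeq_tendsto_of_complete hcauchy
  refine ⟨z, Metric.tendsto_nhds.2 fun ε hε => ?_⟩
  have hC0 : Tendsto (fun j : ℕ => C * (l ^ m) ^ j) atTop (𝓝 0) := by
    have := (tendsto_pow_atTop_nhds_zero_of_lt_one (by positivity) hl').const_mul C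
    rwa [mul_zero] at this
  obtain ⟨J, hJ⟩ := eventually_atTop.1 ((hC0.eventually_lt_const (half_pos hε)).and
    (Metric.tendsto_nhds.1 hz (ε / 2) (half_pos hε)))
  have hpos : 0 < x₀ / D ^ J := div_pos hx₀.1 (by positivity)
  filter_upwards [Ioo_mem_nhdsGT hpos] with x hx
  -- With `D ^ j * x ≤ x₀ < D ^ (j + 1) * x`, the iterate `f_c^(m j)` carries the point at potential
  -- `x` into the fundamental segment.
  obtain ⟨j, hj1, hj2⟩ := exists_nat_pow_near (x := x₀ / x) (y := D) (by
    rw [one_le_div hx.1]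
    exact hx.2.le.trans (div_le_self hx₀.1.le (one_le_pow₀ hD1.le))) hD1
  have hJj : J ≤ j := by
    by_contra! hlt
    have h1 : D ^ (j + 1) ≤ D ^ J := pow_le_pow_right₀ hD1.le hlt
    have h2 : x₀ < D ^ J * x := by
      rw [div_lt_iff₀ hx.1] at hj2
      exact hj2.trans_le (by have := hx.1; gcongr)
    have h3 := hx.2
    rw [lt_div_iff₀ (by positivity)] at h3
    linarith
  have hmem : D ^ j * x ∈ Icc (x₀ / D) x₀ := by
    rw [le_div_iff₀ hx.1] at hj1
    rw [div_lt_iff₀ hx.1, pow_succ] at hj2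
    refine ⟨?_, hj1⟩
    rw [div_le_iff₀ hD0]
    linarith
  obtain ⟨h1, h2⟩ := hJ j hJj
  have h3 := key j x hmem
  rw [← dist_eq_norm] at h3
  linarith [dist_triangle (ray d c Ψ g x y) (ray d c Ψ g (x₀ / D ^ j) y) z]

theorem green_of_lands (S : SlitData d c Ψ g y₀) (hy : NonPrecritical d y₀ y)
    (h : Lands d c Ψ g y z) : green d c z = 0 := by
  have h1 := ((continuous_green S.two_le c).tendsto z).comp h
  refine tendsto_nhds_unique h1 ?_
  have h2 : Tendsto (fun x : ℝ => x) (𝓝[>] 0) (𝓝 0) := tendsto_nhdsWithin_of_tendsto_nhds tendsto_id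
  refine h2.congr' ?_
  filter_upwards [self_mem_nhdsWithin] with x hx
  exact (S.green_ray hy hx).symm

theorem mem_closure_of_lands (h : Lands d c Ψ g y z) :
    z ∈ closure ((fun x => ray d c Ψ g x y) '' Ioi 0) := by
  refine mem_closure_of_tendsto h ?_
  filter_upwards [self_mem_nhdsWithin] with x hx
  exact mem_image_of_mem _ hx

/-- Points of the ray close to a point of zero potential have small potential, and those are close
to the landing point. -/
theorem eq_of_mem_closure (S : SlitData d c Ψ g y₀) (hy : NonPrecritical d y₀ y)
    (h : Lands d c Ψ g y z) (hz' : green d c z' = 0)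
    (hcl : z' ∈ closure ((fun x => ray d c Ψ g x y) '' Ioi 0)) : z' = z := by
  by_contra hne
  obtain ⟨U, V, hU, hV, hzU, hzV, hdisj⟩ := t2_separation hne
  obtain ⟨δ, hδ, hδ'⟩ := (mem_nhdsGT_iff_exists_Ioo_subset).1 (h (hV.mem_nhds hzV))
  have hδ0 : (0 : ℝ) < δ := hδ
  have hop : IsOpen (U ∩ {w | green d c w < δ}) :=
    hU.inter (isOpen_lt (continuous_green S.two_le c) continuous_const)
  obtain ⟨w, ⟨hwU, hwδ⟩, x, hx, rfl⟩ := mem_closure_iff.1 hcl _ hop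
    ⟨hzU, by show green d c z' < δ; rwa [hz']⟩
  have hxδ : x < δ := by
    have : green d c (ray d c Ψ g x y) < δ := hwδ
    rwa [S.green_ray hy hx] at this
  exact hdisj.le_bot ⟨hwU, hδ' ⟨hx, hxδ⟩⟩

theorem ray_image_eq (d : ℕ) (c : ℂ) (Ψ g : ℂ → ℂ) (y : ℝ) :
    (fun r => ray d c Ψ g (Real.log r) y) '' Ioi 1 = (fun x => ray d c Ψ g x y) '' Ioi 0 := by
  ext w
  constructor
  · rintro ⟨r, hr, rfl⟩
    exact ⟨Real.log r, Real.log_pos hr, rfl⟩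
  · rintro ⟨x, hx, rfl⟩
    exact ⟨Real.exp x, Real.one_lt_exp_iff.2 hx, by simp⟩

theorem rayLandsAt_of_lands (S : SlitData d c Ψ g y₀) (hy : NonPrecritical d y₀ y)
    (h : Lands d c Ψ g y z) : RayLandsAt d c y z := by
  refine ⟨_, S.isRayOn_ray hy, ?_⟩
  rw [ray_image_eq]
  ext w
  constructor
  · rintro ⟨h1, h2⟩
    exact S.eq_of_mem_closure hy h ((mem_filledJulia_iff S.two_le).1 h2) h1
  · rintro rfl
    exact ⟨mem_closure_of_lands h, (mem_filledJulia_iff S.two_le).2 (S.green_of_lands hy h)⟩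

theorem of_rayLandsAt (S : SlitData d c Ψ g y₀) (h : RayLandsAt d c y z) :
    NonPrecritical d y₀ y ∧ green d c z = 0 ∧
      z ∈ closure ((fun x => ray d c Ψ g x y) '' Ioi 0) := by
  obtain ⟨γ, hγ, hz⟩ := h
  have hy := S.nonPrecritical_of_isRayOn hγ
  have hmem : z ∈ closure (γ '' Ioi 1) ∩ filledJulia d c := by rw [hz]; rfl
  refine ⟨hy, (mem_filledJulia_iff S.two_le).1 hmem.2, ?_⟩
  rw [← ray_image_eq, ← (hγ.eqOn S.two_le le_rfl (S.isRayOn_ray hy)).image_eq]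
  exact hmem.1

theorem mem_closure_poly (S : SlitData d c Ψ g y₀) (hy : NonPrecritical d y₀ y)
    (hcl : z ∈ closure ((fun x => ray d c Ψ g x y) '' Ioi 0)) :
    poly d c z ∈ closure ((fun x => ray d c Ψ g x (d * y)) '' Ioi 0) := by
  have := image_closure_subset_closure_image (continuous_poly d c) (mem_image_of_mem _ hcl)
  refine closure_mono ?_ this
  rintro _ ⟨_, ⟨x, hx, rfl⟩, rfl⟩
  exact ⟨d * x, mul_pos S.natCast_pos hx, (S.poly_ray hy hx).symm⟩

/-- The pull-back identity holds along the ray and passes to its closure, since `g` is continuous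
near `f_c(z)`. -/
theorem eq_symbol_mul_of_mem_closure (S : SlitData d c Ψ g y₀) (hy : NonPrecritical d y₀ y)
    (hz : green d c z = 0)
    (hcl : z ∈ closure ((fun x => ray d c Ψ g x y) '' Ioi 0)) :
    z = symbol d c Ψ g y * g (poly d c z) := by
  have hpz : poly d c z ∉ slit d c Ψ y₀ := notMem_of_green_lt (by
    rw [green_poly S.two_le, hz, mul_zero]; exact S.pos)
  have hc : ContinuousAt (fun w => symbol d c Ψ g y * g (poly d c w) - w) z := by
    refine ContinuousAt.sub (continuousAt_const.mul ?_) continuousAt_id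
    exact ContinuousAt.comp (f := poly d c) (S.hasDerivAt hpz).continuousAt
      (continuous_poly d c).continuousAt
  have h1 : (fun w => symbol d c Ψ g y * g (poly d c w) - w) z ∈
      closure ((fun w => symbol d c Ψ g y * g (poly d c w) - w) ''
        ((fun x => ray d c Ψ g x y) '' Ioi 0)) :=
    hc.continuousWithinAt.mem_closure_image hcl
  have h2 : (fun w => symbol d c Ψ g y * g (poly d c w) - w) ''
        ((fun x => ray d c Ψ g x y) '' Ioi 0) ⊆ {0} := by
    rintro _ ⟨_, ⟨x, hx, rfl⟩, rfl⟩
    simp only [mem_singleton_iff]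
    rw [S.poly_ray hy hx, ← S.ray_eq_symbol_mul hy hx, sub_self]
  have h3 := closure_mono h2 h1
  rw [closure_singleton, mem_singleton_iff] at h3
  exact (sub_eq_zero.1 h3).symm

theorem iterate_eq_symbol_mul (S : SlitData d c Ψ g y₀) (hy : NonPrecritical d y₀ y)
    (hz : green d c z = 0) (hcl : z ∈ closure ((fun x => ray d c Ψ g x y) '' Ioi 0)) (n : ℕ) :
    (poly d c)^[n] z = symbol d c Ψ g (d ^ n * y) * g ((poly d c)^[n + 1] z) := by
  have h1 : (poly d c)^[n] z ∈ closure ((fun x => ray d c Ψ g x (d ^ n * y)) '' Ioi 0) := by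
    induction n with
    | zero => simpa using hcl
    | succ n ih =>
      have := S.mem_closure_poly (hy.pow_mul n) ih
      rwa [← mul_assoc, ← pow_succ', ← Function.iterate_succ_apply' (poly d c)] at this
  rw [Function.iterate_succ_apply']
  refine S.eq_symbol_mul_of_mem_closure (hy.pow_mul n) ?_ h1
  rw [green_poly_iterate S.two_le, hz, mul_zero]

/-- Cancelling the nonzero value of `g` recovers the symbols from the orbit of `z`. Periodicity is
not needed, so this excludes all further rays, rational or not. -/
theorem symbol_eq_of_mem_closure (S : SlitData d c Ψ g y₀) (hy : NonPrecritical d y₀ y)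
    (hy' : NonPrecritical d y₀ y') (hz : green d c z = 0)
    (hcl : z ∈ closure ((fun x => ray d c Ψ g x y) '' Ioi 0))
    (hcl' : z ∈ closure ((fun x => ray d c Ψ g x y') '' Ioi 0)) (n : ℕ) :
    symbol d c Ψ g (d ^ n * y) = symbol d c Ψ g (d ^ n * y') := by
  have h1 := S.iterate_eq_symbol_mul hy hz hcl n
  have h2 := S.iterate_eq_symbol_mul hy' hz hcl' n
  have h3 : (poly d c)^[n + 1] z ∉ slit d c Ψ y₀ := notMem_of_green_lt (by
    rw [green_poly_iterate S.two_le, hz, mul_zero]; exact S.pos)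
  exact mul_right_cancel₀ (S.branch_ne_zero h3) (h1.symm.trans h2)

theorem lands_mul (S : SlitData d c Ψ g y₀) (hy : NonPrecritical d y₀ y)
    (h : Lands d c Ψ g y z) : Lands d c Ψ g (d * y) (poly d c z) := by
  have h0 := S.natCast_pos
  have h1 := ((continuous_poly d c).tendsto z).comp h
  have h2 : Tendsto (fun x : ℝ => x / d) (𝓝[>] 0) (𝓝[>] 0) := by
    refine tendsto_nhdsWithin_iff.2 ⟨?_, ?_⟩
    · have : Tendsto (fun x : ℝ => x / d) (𝓝 0) (𝓝 (0 / d)) := by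
        exact (continuous_id.div_const (d : ℝ)).tendsto 0
      rw [zero_div] at this
      exact this.mono_left nhdsWithin_le_nhds
    · filter_upwards [self_mem_nhdsWithin] with x hx
      exact div_pos hx h0
  refine (h1.comp h2).congr' ?_
  filter_upwards [self_mem_nhdsWithin] with x hx
  simp only [Function.comp_apply]
  rw [S.poly_ray hy (div_pos hx h0), mul_div_cancel₀ _ h0.ne']

/-- An equipotential arc joins the two rays. Equal symbols mean that both rays are pulled back by
the same words, and under these the arc shrinks to a point. -/
theorem lands_unique (S : SlitData d c Ψ g y₀) (hy : NonPrecritical d y₀ y)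
    (hy' : NonPrecritical d y₀ y') {m : ℕ} {k k' : ℤ} (hm : m ≠ 0)
    (hk : (d : ℝ) ^ m * y = y + k) (hk' : (d : ℝ) ^ m * y' = y' + k')
    (hsym : ∀ n : ℕ, symbol d c Ψ g (d ^ n * y) = symbol d c Ψ g (d ^ n * y'))
    (h : Lands d c Ψ g y z) (h' : Lands d c Ψ g y' z') : z = z' := by
  have h0 := S.natCast_pos
  have hd1 : (1 : ℝ) < d := by exact_mod_cast (by have := S.two_le; omega : 1 < d)
  obtain ⟨l, hl0, hl1, -, hl⟩ := S.exists_contraction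
  -- A potential between those of the critical point and the critical value: the arc is then given
  -- by `Ψ` and also lies in the region where words contract.
  obtain ⟨x₀, hx₀, hx₀'⟩ := exists_between S.div_lt
  have hx0 : 0 < x₀ := S.div_nonneg.trans_lt hx₀
  set σ : ℝ → ℂ := fun s => Ψ (rayPoint x₀ s)
  have hσ : Continuous σ := by
    refine S.param.continuousOn.comp_continuous
      (continuous_rayPoint.comp (.prodMk_right x₀)) fun s => ?_
    show _ < (rayPoint x₀ s).re
    rwa [rayPoint_re]
  obtain ⟨C, hC⟩ := hl (σ '' uIcc y y')
    (by
      rintro _ ⟨s, -, rfl⟩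
      have := S.param.green_eq S.two_le S.div_nonneg (ζ := rayPoint x₀ s) (by rwa [rayPoint_re])
      rw [rayPoint_re] at this
      show green d c (Ψ (rayPoint x₀ s)) < _
      rwa [this])
    (isPreconnected_uIcc.image _ hσ.continuousOn) (isCompact_uIcc.image hσ)
  have hper : ∀ (y : ℝ) (k : ℤ), NonPrecritical d y₀ y → (d : ℝ) ^ m * y = y + k → ∀ j : ℕ,
      ray d c Ψ g x₀ ((d : ℝ) ^ (m * j) * y) = Ψ (rayPoint x₀ y) := by
    intro y k hy hk j
    induction j with
    | zero => simpa using S.ray_eq_param hy hx₀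
    | succ j ih =>
      rw [← ih, mul_add, mul_one, pow_add, mul_assoc, hk, mul_add]
      have := S.ray_add_int hx0 (hy.pow_mul (m * j)) (d ^ (m * j) * k)
      push_cast at this
      exact this
  have hword : ∀ (y : ℝ) (k : ℤ), NonPrecritical d y₀ y → (d : ℝ) ^ m * y = y + k → ∀ j : ℕ,
      ray d c Ψ g (x₀ / d ^ (m * j)) y
        = branchWord g (fun k => symbol d c Ψ g (d ^ k * y)) (m * j) (Ψ (rayPoint x₀ y)) := by
    intro y k hy hk j
    rw [← S.branchWord_ray hy (div_pos hx0 (by positivity)) (m * j),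
      mul_div_cancel₀ _ (by positivity), hper y k hy hk j]
  have hlim : Tendsto (fun j : ℕ => x₀ / (d : ℝ) ^ (m * j)) atTop (𝓝[>] 0) := by
    refine tendsto_nhdsWithin_iff.2 ⟨?_, .of_forall fun j => div_pos hx0 (by positivity)⟩
    simp only [pow_mul]
    exact tendsto_const_nhds.div_atTop (tendsto_pow_atTop_atTop_of_one_lt (one_lt_pow₀ hd1 hm))
  have h1 := (h.comp hlim).sub (h'.comp hlim)
  have h2 : Tendsto (fun j : ℕ => C * (l ^ m) ^ j) atTop (𝓝 0) := by
    have := (tendsto_pow_atTop_nhds_zero_of_lt_one (by positivity)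
      (pow_lt_one₀ hl0.le hl1 hm)).const_mul C
    rwa [mul_zero] at this
  have h3 := squeeze_zero_norm (fun j => ?_) h2 (f := fun j : ℕ =>
    ray d c Ψ g (x₀ / (d : ℝ) ^ (m * j)) y - ray d c Ψ g (x₀ / (d : ℝ) ^ (m * j)) y')
  · exact sub_eq_zero.1 (tendsto_nhds_unique h1 h3)
  · rw [hword y k hy hk j, hword y' k' hy' hk' j, ← funext hsym, ← pow_mul]
    exact hC _ (mem_image_of_mem _ left_mem_uIcc) _ (mem_image_of_mem _ right_mem_uIcc) _ _
      fun k => S.symbol_pow (hy.pow_mul k).ne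

/-- The word that follows the orbit of `z` through `j` periods fixes `z` and inverts `f_c^(p j)`
there. For large `j` its derivative is smaller than `1`, and its product with the `j`-th power of
the multiplier is `1`. -/
theorem one_lt_norm_deriv (S : SlitData d c Ψ g y₀) (hy : NonPrecritical d y₀ y)
    (hz : green d c z = 0) (hcl : z ∈ closure ((fun x => ray d c Ψ g x y) '' Ioi 0)) {p : ℕ}
    (hp : p ≠ 0) (hper : (poly d c)^[p] z = z) : 1 < ‖deriv (poly d c)^[p] z‖ := by
  obtain ⟨l, hl0, hl1, hl, -⟩ := S.exists_contraction
  have hzW : z ∈ belowValue d c := by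
    show green d c z < _
    rw [hz]
    exact S.pos
  obtain ⟨C, hC⟩ := hl z hzW
  have hlim : Tendsto (fun j : ℕ => C * (l ^ p) ^ j) atTop (𝓝 0) := by
    have := (tendsto_pow_atTop_nhds_zero_of_lt_one (by positivity)
      (pow_lt_one₀ hl0.le hl1 hp)).const_mul C
    rwa [mul_zero] at this
  obtain ⟨j, hj⟩ := (hlim.eventually_lt_const one_pos).exists
  set ξ : ℕ → ℂ := fun k => symbol d c Ψ g (d ^ k * y)
  have hξ : ∀ k, ξ k ^ d = 1 := fun k => S.symbol_pow (hy.pow_mul k).ne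
  have hperj : (poly d c)^[p * j] z = z := by
    rw [Function.iterate_mul]
    exact Function.IsFixedPt.iterate (show Function.IsFixedPt (poly d c)^[p] z from hper) j
  have hw := branchWord_apply_orbit (g := g) (p * j) ξ (fun k => (poly d c)^[k] z)
    (S.iterate_eq_symbol_mul hy hz hcl)
  simp only [Function.iterate_zero, id_eq, hperj] at hw
  have hdf : Differentiable ℂ (poly d c) := by unfold poly; fun_prop
  have h1 : HasDerivAt (poly d c)^[p] (deriv (poly d c)^[p] z) z :=
    ((hdf.iterate p) z).hasDerivAt
  have h2 := HasDerivAt.iterate z h1 hper j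
  rw [← Function.iterate_mul] at h2
  have h3 := (S.differentiableAt_branchWord (p * j) ξ hξ z hzW).hasDerivAt
  have h4 := (hw.symm ▸ h2 : HasDerivAt (poly d c)^[p * j] (deriv (poly d c)^[p] z ^ j)
    (branchWord g ξ (p * j) z)).comp z h3
  have h5 : HasDerivAt ((poly d c)^[p * j] ∘ branchWord g ξ (p * j)) 1 z := by
    refine (hasDerivAt_id z).congr_of_eventuallyEq ?_
    filter_upwards [S.isOpen_belowValue.mem_nhds hzW] with w hw
    exact S.poly_iterate_branchWord (p * j) ξ hξ w hw
  have h6 := congrArg norm (h4.unique h5)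
  rw [norm_mul, norm_pow, norm_one] at h6
  have h7 := hC (p * j) ξ hξ
  rw [pow_mul] at h7
  by_contra! hle
  have h8 : ‖deriv (poly d c)^[p] z‖ ^ j ≤ 1 := pow_le_one₀ (norm_nonneg _) hle
  have h9 : ‖deriv (branchWord g ξ (p * j)) z‖ < 1 := h7.trans_lt hj
  nlinarith [norm_nonneg (deriv (branchWord g ξ (p * j)) z),
    norm_nonneg (deriv (poly d c)^[p] z)]

end SlitData

end

section

/-! ### Arc length and itineraries -/

theorem arcLength_pos (a b : UnitAddCircle) : 0 < arcLength a b :=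
  (AddCircle.equivIoc 1 0 (b - a)).2.1

theorem arcLength_le_one (a b : UnitAddCircle) : arcLength a b ≤ 1 := by
  simpa [arcLength] using (AddCircle.equivIoc 1 0 (b - a)).2.2

theorem add_arcLength (a b : UnitAddCircle) : a + (arcLength a b : UnitAddCircle) = b := by
  rw [arcLength, AddCircle.coe_equivIoc, add_sub_cancel]

theorem arcLength_eq {a b : UnitAddCircle} {s : ℝ} (hs0 : 0 < s) (hs1 : s ≤ 1)
    (h : b = a + (s : UnitAddCircle)) : arcLength a b = s := by
  rw [arcLength, h, add_sub_cancel_left,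
    AddCircle.equivIoc_coe_eq (p := (1 : ℝ)) (a := 0) (x := s) ⟨hs0, by simpa using hs1⟩]

theorem coe_eq_coe_iff {a b : ℝ} :
    (a : UnitAddCircle) = b ↔ ∃ n : ℤ, a = b + n := by
  rw [← sub_eq_zero, ← AddCircle.coe_sub, AddCircle.coe_eq_zero_iff]
  refine exists_congr fun n => ?_
  rw [zsmul_eq_mul, mul_one]
  constructor <;> intro h <;> linarith

theorem coe_add_intCast (a : ℝ) (n : ℤ) : ((a + n : ℝ) : UnitAddCircle) = a :=
  coe_eq_coe_iff.2 ⟨n, rfl⟩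

theorem nsmul_coe (n : ℕ) (y : ℝ) : n • (y : UnitAddCircle) = ((n * y : ℝ) : UnitAddCircle) := by
  rw [← AddCircle.coe_nsmul, nsmul_eq_mul]

theorem pow_nsmul_coe (d n : ℕ) (y : ℝ) :
    d ^ n • (y : UnitAddCircle) = (((d : ℝ) ^ n * y : ℝ) : UnitAddCircle) := by
  rw [nsmul_coe]; push_cast; rfl

/-- The angles `θ` and `θ'` lie in the same component of the complement of the preimages of `t`
under multiplication by `d`. -/
def SameSector (d : ℕ) (t θ θ' : UnitAddCircle) : Prop :=
  ∃ e, d • e = t ∧ arcLength e θ < 1 / d ∧ arcLength e θ' < 1 / d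

/-- The angles `θ` and `θ'` have the same itinerary with respect to the complement of the
preimages of `t` under multiplication by `d`. -/
def SameItinerary (d : ℕ) (t θ θ' : UnitAddCircle) : Prop :=
  ∀ n : ℕ, SameSector d t (d ^ n • θ) (d ^ n • θ')

namespace SlitData

variable {d : ℕ} {c : ℂ} {Ψ g : ℂ → ℂ} {y₀ : ℝ}

/-- Both sides say that neither angle is a preimage of `y₀` and that the floors of `d * Y - y₀` and
`d * Y' - y₀` are congruent modulo `d`. The sector of `Y` starts at `(y₀ + ⌊d * Y - y₀⌋) / d`. -/
theorem sameSector_iff (S : SlitData d c Ψ g y₀) (Y Y' : ℝ) :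
    SameSector d y₀ Y Y' ↔ ((d * Y : ℝ) : UnitAddCircle) ≠ y₀ ∧
      ((d * Y' : ℝ) : UnitAddCircle) ≠ y₀ ∧ symbol d c Ψ g Y = symbol d c Ψ g Y' := by
  have h0 := S.natCast_pos
  have hd1 : (1 : ℝ) ≤ d := by exact_mod_cast (by have := S.two_le; omega : 1 ≤ d)
  constructor
  · rintro ⟨e, he, h1, h2⟩
    obtain ⟨e, rfl⟩ := QuotientAddGroup.mk_surjective e
    change d • (e : UnitAddCircle) = (y₀ : UnitAddCircle) at he
    rw [nsmul_coe, coe_eq_coe_iff] at he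
    obtain ⟨j, hj⟩ := he
    have key : ∀ Y : ℝ, arcLength (e : UnitAddCircle) Y < 1 / d →
        ∃ i : ℤ, ⌊d * Y - y₀⌋ = j + d * i ∧ 0 < Int.fract (d * Y - y₀) := by
      intro Y hY
      have hpos := arcLength_pos (e : UnitAddCircle) Y
      have hs := add_arcLength (e : UnitAddCircle) Y
      set s := arcLength (e : UnitAddCircle) Y
      rw [← AddCircle.coe_add, eq_comm, coe_eq_coe_iff] at hs
      obtain ⟨i, hi⟩ := hs
      have h3 : d * Y - y₀ = ((j + d * i : ℤ) : ℝ) + d * s := by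
        rw [hi]; push_cast; linear_combination hj
      have h4 : d * s < 1 := by rwa [lt_div_iff₀' h0] at hY
      have hfl : ⌊d * Y - y₀⌋ = j + d * i :=
        Int.floor_eq_iff.2 ⟨by rw [h3]; linarith [mul_pos h0 hpos], by rw [h3]; linarith⟩
      refine ⟨i, hfl, ?_⟩
      rw [Int.fract, hfl, h3, add_sub_cancel_left]
      positivity
    obtain ⟨i, hi, hf⟩ := key Y h1
    obtain ⟨i', hi', hf'⟩ := key Y' h2
    have hne := coe_ne_coe_of_floor hf
    have hne' := coe_ne_coe_of_floor hf'
    refine ⟨hne, hne', (S.symbol_eq_iff hne hne').2 ⟨i - i', ?_⟩⟩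
    rw [hi, hi']
    ring
  · rintro ⟨hne, hne', hs⟩
    obtain ⟨n, hn⟩ := (S.symbol_eq_iff hne hne').1 hs
    refine ⟨(((y₀ + ⌊d * Y - y₀⌋) / d : ℝ) : UnitAddCircle), ?_, ?_, ?_⟩
    · rw [nsmul_coe, mul_div_cancel₀ _ h0.ne', coe_add_intCast]
    · have hf := fract_pos_of_coe_ne_coe hne
      have hf1 := Int.fract_lt_one (d * Y - y₀)
      rw [arcLength_eq (s := Int.fract (d * Y - y₀) / d) (by positivity)]
      · gcongr
      · rw [div_le_one h0]; linarith
      · rw [← AddCircle.coe_add, ← add_div, add_assoc, Int.floor_add_fract]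
        congr 1
        field_simp
        ring
    · have hf := fract_pos_of_coe_ne_coe hne'
      have hf1 := Int.fract_lt_one (d * Y' - y₀)
      rw [arcLength_eq (s := Int.fract (d * Y' - y₀) / d) (by positivity)]
      · gcongr
      · rw [div_le_one h0]; linarith
      · rw [← AddCircle.coe_add, eq_comm, coe_eq_coe_iff]
        refine ⟨n, ?_⟩
        have := Int.floor_add_fract (d * Y' - y₀)
        rw [hn]
        push_cast
        field_simp
        linarith

theorem sameItinerary_iff (S : SlitData d c Ψ g y₀) (Y Y' : ℝ) :
    SameItinerary d y₀ Y Y' ↔ NonPrecritical d y₀ Y ∧ NonPrecritical d y₀ Y' ∧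
      ∀ n : ℕ, symbol d c Ψ g (d ^ n * Y) = symbol d c Ψ g (d ^ n * Y') := by
  unfold SameItinerary NonPrecritical
  simp only [pow_nsmul_coe, S.sameSector_iff, forall_and, pow_succ', mul_assoc]

end SlitData

/-- A portrait whose parts are exactly the itinerary classes of periodic angles, with respect to
the external angle of `c`, is the portrait of a repelling periodic orbit. -/
theorem hasRepellingOrbitWithPortrait_of_itinerary {d : ℕ} (hd : 2 ≤ d) {c : ℂ}
    {t : UnitAddCircle} (hc : HasExternalAngle d c t) {p : ℕ} [NeZero p]
    {A : ZMod p → Set UnitAddCircle} (hne : ∀ j, (A j).Nonempty)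
    (hmap : ∀ j, ∀ θ ∈ A j, d • θ ∈ A (j + 1))
    {m : ℕ} (hm : m ≠ 0) (hper : ∀ j, ∀ θ ∈ A j, d ^ m • θ = θ)
    (hit : ∀ j, ∀ θ ∈ A j, ∀ θ', θ' ∈ A j ↔ SameItinerary d t θ θ')
    (hdisj : ∀ i j θ, θ ∈ A i → θ ∈ A j → i = j) :
    HasRepellingOrbitWithPortrait d c A := by
  obtain ⟨y₀, rfl⟩ := QuotientAddGroup.mk_surjective t
  change HasExternalAngle d c (y₀ : UnitAddCircle) at hc
  change ∀ j, ∀ θ ∈ A j, ∀ θ', θ' ∈ A j ↔ SameItinerary d (y₀ : UnitAddCircle) θ θ' at hit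
  obtain ⟨Ψ, g, S⟩ := hc.exists_slitData hd
  have hlift : ∀ j, ∃ Y : ℝ, (Y : UnitAddCircle) ∈ A j := fun j => by
    obtain ⟨θ, hθ⟩ := hne j
    obtain ⟨Y, rfl⟩ := QuotientAddGroup.mk_surjective θ
    exact ⟨Y, hθ⟩
  choose Y hY using hlift
  have hnp : ∀ j (y : ℝ), (y : UnitAddCircle) ∈ A j → NonPrecritical d y₀ y := fun j y hy =>
    ((S.sameItinerary_iff y y).1 ((hit j _ hy _).1 hy)).1
  have hk : ∀ j (y : ℝ), (y : UnitAddCircle) ∈ A j → ∃ k : ℤ, (d : ℝ) ^ m * y = y + k := by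
    intro j y hy
    have := hper j _ hy
    rwa [pow_nsmul_coe, coe_eq_coe_iff] at this
  have hlands : ∀ j, ∃ z, Lands d c Ψ g (Y j) z := fun j => by
    obtain ⟨k, hk⟩ := hk j _ (hY j)
    exact S.exists_lands (hnp j _ (hY j)) hm hk
  choose z hz using hlands
  have huniq : ∀ j (y : ℝ) w, (y : UnitAddCircle) ∈ A j → Lands d c Ψ g y w → w = z j := by
    intro j y w hy hw
    obtain ⟨k, hk1⟩ := hk j y hy
    obtain ⟨k', hk2⟩ := hk j _ (hY j)
    exact S.lands_unique (hnp j y hy) (hnp j _ (hY j)) hm hk1 hk2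
      ((S.sameItinerary_iff _ _).1 ((hit j _ hy _).1 (hY j))).2.2 hw (hz j)
  have hall : ∀ j (y : ℝ), (y : UnitAddCircle) ∈ A j → Lands d c Ψ g y (z j) := by
    intro j y hy
    obtain ⟨k, hk1⟩ := hk j y hy
    obtain ⟨w, hw⟩ := S.exists_lands (hnp j y hy) hm hk1
    rwa [huniq j y w hy hw] at hw
  have hgreen : ∀ j, green d c (z j) = 0 := fun j => S.green_of_lands (hnp j _ (hY j)) (hz j)
  have hcl := fun j => SlitData.mem_closure_of_lands (hz j)
  -- Any ray landing at `z j` has the symbols of `Y j`, so its angle belongs to the itinerary class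
  -- `A j`.
  have hexact : ∀ j (y : ℝ), RayLandsAt d c y (z j) → (y : UnitAddCircle) ∈ A j := by
    intro j y hy
    obtain ⟨h1, h2, h3⟩ := S.of_rayLandsAt hy
    refine (hit j _ (hY j) _).2 ((S.sameItinerary_iff _ _).2 ⟨hnp j _ (hY j), h1, ?_⟩)
    exact S.symbol_eq_of_mem_closure (hnp j _ (hY j)) h1 h2 (hcl j) h3
  have hstep : ∀ j, poly d c (z j) = z (j + 1) := by
    intro j
    refine huniq (j + 1) (d * Y j) _ ?_ (S.lands_mul (hnp j _ (hY j)) (hz j))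
    rw [← nsmul_coe]
    exact hmap j _ (hY j)
  have hiter : ∀ (n : ℕ) j, (poly d c)^[n] (z j) = z (j + n) := by
    intro n j
    induction n with
    | zero => simp
    | succ n ih =>
      rw [Function.iterate_succ_apply', ih, hstep]
      push_cast
      rw [add_assoc]
  refine ⟨z, fun i j hij => ?_, hstep, fun j => ?_, fun j => ?_⟩
  -- If two points of the orbit coincided, a single angle would belong to two parts; so the exact
  -- period is `p`.
  · have h1 := hall j _ (hY j)
    rw [← hij] at h1
    exact hdisj i j (Y j) (hexact i (Y j) (S.rayLandsAt_of_lands (hnp j _ (hY j)) h1)) (hY j)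
  · refine S.one_lt_norm_deriv (hnp j _ (hY j)) (hgreen j) (hcl j) (NeZero.ne p) ?_
    rw [hiter, ZMod.natCast_self, add_zero]
  · ext θ
    obtain ⟨y, rfl⟩ := QuotientAddGroup.mk_surjective θ
    exact ⟨fun h => S.rayLandsAt_of_lands (hnp j y h) (hall j y h), hexact j y⟩

end

section

/-! ### Parameters with a prescribed external angle -/

variable {d : ℕ} {c z : ℂ}

theorem continuousOn_bottcherExponent_diagonal (hd : 2 ≤ d) :
    ContinuousOn (fun c => bottcherExponent d c c) {c | IsFar c c} := by
  refine continuousOn_tsum (fun n c hc => ?_) (hasSum_geometric_two' (3 / 16)).summable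
    fun n c hc => IsFar.norm_term_le hd hc n
  have hc : IsFar c c := hc
  have hn := hc.poly_iterate hd n
  have hcont : Continuous fun c : ℂ => (poly d c)^[n] c := by
    clear hc hn
    induction n with
    | zero => exact continuous_id
    | succ n ih =>
      simp only [Function.iterate_succ_apply']
      exact (ih.pow d).add continuous_id
  have hquot : ContinuousAt (fun c => 1 + c / ((poly d c)^[n] c) ^ d) c :=
    continuousAt_const.add (continuousAt_id.div (hcont.pow d).continuousAt
      (pow_ne_zero _ hn.ne_zero))
  exact ((hquot.clog (hn.one_add_mem_slitPlane hd)).div_const _).continuousWithinAt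

/-- As `c = exp (20 + i s)` moves around a large circle, the argument of `φ_c(c)` is `s` plus a
bounded continuous function, so it attains every value. -/
theorem exists_hasExternalAngle (hd : 2 ≤ d) (t : UnitAddCircle) :
    ∃ c : ℂ, 2 < ‖c‖ ∧ HasExternalAngle d c t := by
  obtain ⟨y, rfl⟩ := QuotientAddGroup.mk_surjective t
  set η : ℝ → ℂ := fun s => 20 + s * Complex.I
  have hη : ∀ s, (η s).re = 20 := fun s => by simp [η]
  have hnorm : ∀ s, ‖Complex.exp (η s)‖ = Real.exp 20 := fun s => by
    rw [Complex.norm_exp, hη]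
  have h8 : (8 : ℝ) ≤ Real.exp 3 := by
    have := Real.add_one_le_exp (1 : ℝ)
    rw [show (3 : ℝ) = ((3 : ℕ) : ℝ) * 1 by norm_num, Real.exp_nat_mul]
    nlinarith [sq_nonneg (Real.exp 1 - 2)]
  -- The threshold `23 / 2` comes from `8 * e ^ 20 ≤ e ^ 23`. Moreover `23 / 2 + 2` lies below the
  -- potential of `c`, at least `20 - 3 / 16`, and above that of the critical point, at most `21 /
  -- 2`.
  have hX : ∀ s, IsFarLog (Complex.exp (η s)) (23 / 2) := fun s => by
    constructor
    · linarith [Real.add_one_le_exp (23 / 2 : ℝ)]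
    · rw [hnorm, ← Real.exp_nat_mul,
        show ((2 : ℕ) : ℝ) * (23 / 2) = 3 + 20 by norm_num, Real.exp_add]
      gcongr
  have hfar : ∀ s, IsFar (Complex.exp (η s)) (Complex.exp (η s)) := fun s =>
    (hX s).isFar_exp (by rw [hη]; norm_num)
  set u : ℝ → ℂ := fun s => bottcherExponent d (Complex.exp (η s)) (Complex.exp (η s))
  have hu : ∀ s, ‖u s‖ ≤ 3 / 16 := fun s => (hfar s).norm_bottcherExponent_le hd
  have hcont : Continuous fun s => s + (u s).im := by
    refine continuous_id.add (Complex.continuous_im.comp ?_)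
    exact (continuousOn_bottcherExponent_diagonal hd).comp_continuous (by fun_prop) hfar
  obtain ⟨s, hs⟩ : ∃ s, s + (u s).im = 2 * Real.pi * y := by
    have him : ∀ s, |(u s).im| ≤ 1 := fun s => (Complex.abs_im_le_norm _).trans
      ((hu s).trans (by norm_num))
    obtain ⟨s, -, hs⟩ := intermediate_value_Icc
      (show 2 * Real.pi * y - 1 ≤ 2 * Real.pi * y + 1 by linarith) hcont.continuousOn
      (show 2 * Real.pi * y ∈ Icc _ _ from
        ⟨by linarith [(abs_le.1 (him (2 * Real.pi * y - 1))).2],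
          by linarith [(abs_le.1 (him (2 * Real.pi * y + 1))).1]⟩)
    exact ⟨s, hs⟩
  set c := Complex.exp (η s)
  set x := 20 + (u s).re
  have hζ : η s + logExponent d c (η s) = rayPoint x y := by
    apply Complex.ext
    · rw [Complex.add_re, hη, rayPoint_re]; rfl
    · have : (η s).im = s := by simp [η]
      rw [Complex.add_im, this]
      refine Eq.trans hs ?_
      simp [rayPoint]
  have hre := abs_le.1 ((Complex.abs_re_le_norm _).trans (hu s))
  obtain ⟨Ψ, hΨ, hΨ'⟩ := (hX s).exists_isParam hd
  have hx : 23 / 2 + 2 < (rayPoint x y).re := by rw [rayPoint_re]; linarith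
  have heq : Ψ (rayPoint x y) = c := by
    refine (hX s).bottcher_injective hd (hΨ' _ hx).1 ?_ ?_
    · rw [hnorm]; gcongr; norm_num
    · rw [(hΨ' _ hx).2, bottcher_exp, hζ]
  have hg : green d c 0 ≤ 23 / 2 + 2 := by
    have h1 : green d c c ≤ 21 := by
      rw [← (hfar s).log_norm_bottcher hd, bottcher_exp, hζ, Complex.norm_exp, Real.log_exp,
        rayPoint_re]
      linarith
    have h2 := green_zero hd c
    have h3 := green_nonneg hd c 0
    have hd' : (2 : ℝ) ≤ d := by exact_mod_cast hd
    nlinarith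
  refine ⟨c, ?_, Real.exp (23 / 2 + 2), _, Real.one_le_exp (by norm_num),
    hΨ.isRayOn hd hg y, Real.exp x, ?_, ?_⟩
  · rw [hnorm]
    linarith [Real.add_one_le_exp (20 : ℝ)]
  · rw [rayPoint_re] at hx
    exact Real.exp_lt_exp.2 hx
  · rw [← heq]
    show Ψ (rayPoint (Real.log (Real.exp x)) y) = _
    rw [Real.log_exp]

/-! ### Disconnected Julia sets -/

theorem poly_mem_filledJulia_iff (hd : 2 ≤ d) : poly d c z ∈ filledJulia d c ↔
    z ∈ filledJulia d c := by
  have : (d : ℝ) ≠ 0 := by exact_mod_cast (by omega : d ≠ 0)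
  rw [mem_filledJulia_iff hd, mem_filledJulia_iff hd, green_poly hd]
  simp [this]

theorem isCompact_filledJulia (hd : 2 ≤ d) (c : ℂ) : IsCompact (filledJulia d c) := by
  convert isCompact_green_le hd c 0 using 1
  ext z
  rw [mem_filledJulia_iff hd]
  exact ⟨fun h => h.le, fun h => le_antisymm h (green_nonneg hd c z)⟩

theorem norm_lt_of_mem_filledJulia (hd : 2 ≤ d) (hc : 2 < ‖c‖) (hz : z ∈ filledJulia d c) :
    ‖z‖ < ‖c‖ := by
  by_contra! h
  have hd' : (2 : ℝ) ≤ d := by exact_mod_cast hd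
  have hstep : ∀ w : ℂ, ‖c‖ ≤ ‖w‖ → (‖c‖ - 1) * ‖w‖ ≤ ‖poly d c w‖ := by
    intro w hw
    have h1 : ‖w ^ d‖ - ‖c‖ ≤ ‖w ^ d + c‖ := by
      have := norm_sub_le (w ^ d + c) c
      rw [add_sub_cancel_right] at this
      linarith
    have h2 : ‖w‖ ^ 2 ≤ ‖w‖ ^ d := pow_le_pow_right₀ (by linarith) hd
    rw [norm_pow] at h1
    have : (‖c‖ - 1) * ‖w‖ ≤ ‖w‖ ^ 2 - ‖c‖ := by nlinarith
    exact this.trans (by unfold poly; linarith)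
  have hiter : ∀ n : ℕ, (‖c‖ - 1) ^ n * ‖c‖ ≤ ‖(poly d c)^[n] z‖ := by
    intro n
    induction n with
    | zero => simpa using h
    | succ n ih =>
      rw [Function.iterate_succ_apply', pow_succ']
      have : ‖c‖ ≤ ‖(poly d c)^[n] z‖ :=
        (le_mul_of_one_le_left (by linarith) (one_le_pow₀ (by linarith))).trans ih
      refine le_trans ?_ (hstep _ this)
      rw [mul_assoc]
      exact mul_le_mul_of_nonneg_left ih (by linarith)
  have hz : Bornology.IsBounded (range fun n : ℕ => (poly d c)^[n] z) := hz
  obtain ⟨M, hM⟩ := hz.exists_norm_le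
  have ht : Tendsto (fun n : ℕ => (‖c‖ - 1) ^ n * ‖c‖) atTop atTop :=
    (tendsto_pow_atTop_atTop_of_one_lt (by linarith)).atTop_mul_const (by linarith)
  obtain ⟨n, hn⟩ := (ht.eventually_gt_atTop M).exists
  exact absurd (hM _ ⟨n, rfl⟩) (not_le.2 (hn.trans_le (hiter n)))

theorem rotation_mem_julia_iff {w : ℂ} (hd : d ≠ 0) (hw : w ^ d = 1) (z : ℂ) :
    w * z ∈ julia d c ↔ z ∈ julia d c := by
  have hw0 : w ≠ 0 := by rintro rfl; simp [hd] at hw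
  have hpre : (Homeomorph.mulLeft₀ w hw0) ⁻¹' filledJulia d c = filledJulia d c := by
    ext z
    have : ∀ n : ℕ, (poly d c)^[n + 1] (w * z) = (poly d c)^[n + 1] z := fun n => by
      rw [Function.iterate_succ_apply, poly_mul_of_pow_eq_one hw, Function.iterate_succ_apply]
    have hr : ∀ z, range (fun n : ℕ => (poly d c)^[n] z) =
        {z} ∪ range (fun n : ℕ => (poly d c)^[n + 1] z) := by
      intro z
      ext x
      simp only [mem_range, mem_union, mem_singleton_iff]
      constructor
      · rintro ⟨_ | n, rfl⟩
        · exact .inl rfl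
        · exact .inr ⟨n, rfl⟩
      · rintro (rfl | ⟨n, rfl⟩)
        · exact ⟨0, rfl⟩
        · exact ⟨n + 1, rfl⟩
    simp only [mem_preimage, Homeomorph.coe_mulLeft₀, filledJulia, mem_ofPred_eq]
    rw [hr, hr z, Bornology.isBounded_union, Bornology.isBounded_union]
    simp only [this, Bornology.isBounded_singleton, true_and]
  have := (Homeomorph.mulLeft₀ w hw0).preimage_frontier (filledJulia d c)
  rw [hpre] at this
  exact Set.ext_iff.1 this z

/-- On the Julia set `‖f_c(z)‖ < ‖c‖`, so `z ^ d / (-c) = 1 - f_c(z) / c` stays in a disc about `1`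
that avoids `0`, and `z ^ d` has a continuous `d`-th root `g`. On a connected Julia set, the
identity would be a constant multiple of `g`. But `g` depends only on `z ^ d`, and the set is
invariant under rotation by `1 / d` of a turn. -/
theorem notMem_multibrot (hd : 2 ≤ d) (hc : 2 < ‖c‖) : c ∉ multibrot d := by
  intro hconn
  have hconn : IsConnected (julia d c) := hconn
  have hdC : (d : ℂ) ≠ 0 := by exact_mod_cast (by omega : d ≠ 0)
  have hc0 : c ≠ 0 := by rintro rfl; simp at hc; linarith
  have hsub : julia d c ⊆ filledJulia d c := (isCompact_filledJulia hd c).isClosed.frontier_subset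
  have hslit : ∀ z ∈ julia d c, z ^ d / (-c) ∈ Complex.slitPlane := fun z hz => by
    have h1 := norm_lt_of_mem_filledJulia hd hc ((poly_mem_filledJulia_iff hd).2 (hsub hz))
    have h2 : z ^ d / (-c) = 1 + -(poly d c z / c) := by
      unfold poly; field_simp; ring
    rw [h2]
    refine Complex.mem_slitPlane_of_norm_lt_one ?_
    rw [norm_neg, norm_div, div_lt_one (by linarith)]
    exact h1
  obtain ⟨b, hb⟩ := IsAlgClosed.exists_pow_nat_eq (-c) (by omega : 0 < d)
  have hb0 : b ≠ 0 := by
    rintro rfl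
    rw [zero_pow (by omega)] at hb
    exact hc0 (neg_eq_zero.1 hb.symm)
  set g : ℂ → ℂ := fun z => b * Complex.exp (Complex.log (z ^ d / (-c)) / d)
  have hg0 : ∀ z, g z ≠ 0 := fun z => mul_ne_zero hb0 (Complex.exp_ne_zero _)
  have hgc : ContinuousOn g (julia d c) := continuousOn_const.mul
    ((ContinuousOn.div_const (ContinuousOn.clog (by fun_prop) hslit) _).cexp)
  have hgd : ∀ z ∈ julia d c, g z ^ d = z ^ d := fun z hz => by
    have h0 := Complex.slitPlane_ne_zero (hslit z hz)
    simp only [g]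
    rw [mul_pow, hb, ← Complex.exp_nat_mul, mul_div_cancel₀ _ hdC, Complex.exp_log h0]
    field_simp
  obtain ⟨z₀, hz₀⟩ := hconn.nonempty
  have hz₀0 : z₀ ≠ 0 := fun h => by
    have := hgd z₀ hz₀
    rw [h, zero_pow (by omega)] at this
    exact hg0 _ (eq_zero_of_pow_eq_zero this)
  set k := z₀ / g z₀
  have hk0 : k ≠ 0 := div_ne_zero hz₀0 (hg0 _)
  have hkd : k ^ d = 1 := by
    rw [div_pow, hgd z₀ hz₀, div_self (pow_ne_zero _ hz₀0)]
  have hEq : EqOn id (fun z => k * g z) (julia d c) :=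
    eqOn_of_pow_eq_pow hconn.isPreconnected continuousOn_id (continuousOn_const.mul hgc)
      (fun z _ => mul_ne_zero hk0 (hg0 z))
      (fun z hz => ⟨d, by omega, by rw [mul_pow, hkd, one_mul, hgd z hz]; rfl⟩) hz₀
      (by simp [k, hg0])
  have hω := exp_rotation_pow (d := d) (by omega)
  have hω1 : Complex.exp (2 * Real.pi * Complex.I / d) ≠ 1 :=
    (Complex.isPrimitiveRoot_exp d (by omega)).ne_one (by omega)
  set ω := Complex.exp (2 * Real.pi * Complex.I / d)
  have h1 := hEq ((rotation_mem_julia_iff (by omega) hω z₀).2 hz₀)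
  have h2 := hEq hz₀
  have h3 : g (ω * z₀) = g z₀ := by simp only [g]; rw [mul_pow, hω, one_mul]
  simp only [id, h3] at h1 h2
  rw [← h2] at h1
  exact hω1 (mul_right_cancel₀ hz₀0 (h1.trans (one_mul _).symm))

end

section

/-! ### Arithmetic of arcs -/

variable {d : ℕ} {t x y z w e : UnitAddCircle}

/-- The sum represents `z - x` modulo `1` and lies in `(0, 2]`. -/
theorem arcLength_add (x y z : UnitAddCircle) :
    arcLength x y + arcLength y z = arcLength x z ∨
      arcLength x y + arcLength y z = arcLength x z + 1 := by
  have h1 := arcLength_pos x y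
  have h2 := arcLength_pos y z
  have h3 := arcLength_le_one x y
  have h4 := arcLength_le_one y z
  have hz : z = x + ((arcLength x y + arcLength y z : ℝ) : UnitAddCircle) := by
    rw [AddCircle.coe_add, ← add_assoc, add_arcLength, add_arcLength]
  by_cases h : arcLength x y + arcLength y z ≤ 1
  · exact .inl (arcLength_eq (by linarith) h hz).symm
  · refine .inr ?_
    have := arcLength_eq (a := x) (b := z) (s := arcLength x y + arcLength y z - 1)
      (by linarith) (by linarith) (by
        refine hz.trans (congrArg (x + ·) (coe_eq_coe_iff.2 ⟨1, ?_⟩))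
        push_cast
        ring)
    linarith

theorem arcLength_self (x : UnitAddCircle) : arcLength x x = 1 := by
  have h1 := arcLength_pos x x
  rcases arcLength_add x x x with h | h <;> linarith

theorem arcLength_right_injective (h : arcLength x y = arcLength x z) : y = z := by
  rw [← add_arcLength x y, h, add_arcLength]

theorem arcLength_left_injective (h : arcLength x z = arcLength y z) : x = y := by
  have h1 := add_arcLength x z
  rw [h] at h1
  exact add_right_cancel (h1.trans (add_arcLength y z).symm)

theorem arcLength_lt_one_iff : arcLength x y < 1 ↔ x ≠ y := by
  constructor
  · rintro h rfl
    rw [arcLength_self] at h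
    exact lt_irrefl _ h
  · intro h
    refine lt_of_le_of_ne (arcLength_le_one x y) fun h1 => h ?_
    rw [← arcLength_self x] at h1
    exact (arcLength_right_injective h1).symm

theorem arcLength_add_arcLength_comm (h : x ≠ y) : arcLength x y + arcLength y x = 1 := by
  have h1 := arcLength_lt_one_iff.2 h
  have h2 := arcLength_lt_one_iff.2 h.symm
  rcases arcLength_add x y x with h3 | h3 <;> rw [arcLength_self] at h3 <;> linarith

theorem arcLength_sub_of_lt (h : arcLength x y < arcLength x z) :
    arcLength y z = arcLength x z - arcLength x y := by
  have := arcLength_le_one y z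
  rcases arcLength_add x y z with h1 | h1 <;> linarith

theorem arcLength_sub_add_one_of_le (h : arcLength x z ≤ arcLength x y) :
    arcLength y z = arcLength x z - arcLength x y + 1 := by
  have := arcLength_pos y z
  rcases arcLength_add x y z with h1 | h1 <;> linarith

theorem arcLength_eq_ite (e x y : UnitAddCircle) : arcLength x y =
    if arcLength e x < arcLength e y then arcLength e y - arcLength e x
    else arcLength e y - arcLength e x + 1 := by
  split_ifs with h
  · exact arcLength_sub_of_lt h
  · exact arcLength_sub_add_one_of_le (not_lt.1 h)

theorem arcLength_nsmul (hd : d ≠ 0) (h : arcLength x y ≤ 1 / d) :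
    arcLength (d • x) (d • y) = d * arcLength x y := by
  have h0 : (0 : ℝ) < d := by exact_mod_cast (by omega : 0 < d)
  refine arcLength_eq (mul_pos h0 (arcLength_pos x y)) ?_ ?_
  · rwa [le_div_iff₀' h0] at h
  · conv_lhs => rw [← add_arcLength x y]
    rw [smul_add, nsmul_coe]

theorem openArc_eq_image (x y : UnitAddCircle) :
    openArc x y = (fun s : ℝ => x + (s : UnitAddCircle)) '' Ioo 0 (arcLength x y) := by
  ext θ
  constructor
  · intro h
    exact ⟨_, ⟨arcLength_pos x θ, h⟩, add_arcLength x θ⟩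
  · rintro ⟨s, ⟨h1, h2⟩, rfl⟩
    show arcLength x _ < _
    rwa [arcLength_eq h1 (h2.le.trans (arcLength_le_one x y)) rfl]

theorem mem_openArc : z ∈ openArc x y ↔ arcLength x z < arcLength x y := Iff.rfl

theorem isOpen_openArc (x y : UnitAddCircle) : IsOpen (openArc x y) := by
  have hmap : IsOpenMap fun s : ℝ => x + (s : UnitAddCircle) :=
    (Homeomorph.addLeft x).isOpenMap.comp QuotientAddGroup.isOpenMap_coe
  rw [openArc_eq_image]
  exact hmap _ isOpen_Ioo

theorem mem_openArc_or (hxy : x ≠ y) (hx : z ≠ x) (hy : z ≠ y) :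
    z ∈ openArc x y ∨ z ∈ openArc y x := by
  have h1 : arcLength x z ≠ arcLength x y := fun h => hy (arcLength_right_injective h)
  rcases lt_or_gt_of_ne h1 with h | h
  · exact .inl h
  · refine .inr ?_
    have h2 := arcLength_sub_of_lt h
    have h3 := arcLength_add_arcLength_comm hxy
    have h4 := arcLength_lt_one_iff.2 hx.symm
    rw [mem_openArc]
    linarith

theorem openArc_disjoint (hxy : x ≠ y) : Disjoint (openArc x y) (openArc y x) := by
  rw [Set.disjoint_left]
  intro z h1 h2
  rw [mem_openArc] at h1 h2
  have h3 := arcLength_add_arcLength_comm hxy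
  have h4 := arcLength_add_arcLength_comm (x := x) (y := z) (by
    rintro rfl; rw [arcLength_self] at h1; linarith [arcLength_le_one x y])
  have := arcLength_pos x z
  rcases arcLength_add x y z with h5 | h5 <;> have := arcLength_pos y z <;> linarith

/-- If `I` missed a point `u` of one arc and a point `v` of the other, the disjoint open arcs `(u,
v)` and `(v, u)` would separate `y` from `x` within `I`. -/
theorem openArc_subset_or_of_isPreconnected {I : Set UnitAddCircle} (hI : IsPreconnected I)
    (hx : x ∈ I) (hy : y ∈ I) (hxy : x ≠ y) : openArc x y ⊆ I ∨ openArc y x ⊆ I := by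
  by_contra! h
  obtain ⟨⟨u, hu, huI⟩, ⟨v, hv, hvI⟩⟩ := h.imp Set.not_subset.1 Set.not_subset.1
  have huv : u ≠ v := by
    rintro rfl
    exact Set.disjoint_left.1 (openArc_disjoint hxy) hu hv
  have hyuv : y ∈ openArc u v := by
    rw [mem_openArc] at hu hv ⊢
    have h1 := arcLength_sub_of_lt hu
    have h2 := arcLength_add_arcLength_comm hxy
    have h3 := arcLength_pos x u
    rcases arcLength_add u y v with h4 | h4
    · linarith [arcLength_pos y v]
    · linarith [arcLength_pos u v]
  have hxvu : x ∈ openArc v u := by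
    rw [mem_openArc] at hu hv ⊢
    have h1 := arcLength_sub_of_lt hv
    have h2 := arcLength_add_arcLength_comm hxy
    have h3 := arcLength_pos y v
    rcases arcLength_add v x u with h4 | h4
    · linarith [arcLength_pos x u]
    · linarith [arcLength_pos v u]
  obtain ⟨z, -, hz1, hz2⟩ := hI _ _ (isOpen_openArc u v) (isOpen_openArc v u)
    (fun z hz => mem_openArc_or huv (by rintro rfl; exact huI hz) (by rintro rfl; exact hvI hz))
    ⟨y, hy, hyuv⟩ ⟨x, hx, hxvu⟩
  exact Set.disjoint_left.1 (openArc_disjoint huv) hz1 hz2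

theorem Unlinked.disjoint {B C : Set UnitAddCircle} (h : Unlinked B C) : Disjoint B C := by
  obtain ⟨I, J, -, -, hIJ, hB, hC⟩ := h
  exact hIJ.mono hB hC

/-- The connected set around `B` contains one of the two arcs between `x` and `y`, and that arc can
contain no point of `C`. -/
theorem Unlinked.not_crossing {B C : Set UnitAddCircle} (h : Unlinked B C) (hx : x ∈ B)
    (hy : y ∈ B) (hz : z ∈ C) (hw : w ∈ C) (hxy : x ≠ y) (hz' : z ∈ openArc x y) :
    w ∉ openArc y x := by
  obtain ⟨I, J, hI, hJ, hIJ, hB, hC⟩ := h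
  intro hw'
  rcases openArc_subset_or_of_isPreconnected hI.isPreconnected (hB hx) (hB hy) hxy with h | h
  · exact Set.disjoint_left.1 hIJ (h hz') (hC hz)
  · exact Set.disjoint_left.1 hIJ (h hw') (hC hw)

/-! ### Sectors and itineraries -/

theorem arcLength_of_sector (hd : d ≠ 0) (he : d • e = t) (hx : arcLength e x < 1 / d) :
    arcLength t (d • x) = d * arcLength e x := by
  rw [← he, arcLength_nsmul hd hx.le]

theorem sector_unique (hd : d ≠ 0) {e' : UnitAddCircle} (he : d • e = t)
    (hx : arcLength e x < 1 / d) (he' : d • e' = t) (hx' : arcLength e' x < 1 / d) : e = e' := by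
  have h0 : (d : ℝ) ≠ 0 := by exact_mod_cast hd
  have h := arcLength_of_sector hd he hx
  rw [arcLength_of_sector hd he' hx'] at h
  exact arcLength_left_injective (mul_left_cancel₀ h0 h).symm

theorem SameSector.symm (h : SameSector d t x y) : SameSector d t y x := by
  obtain ⟨e, he, hx, hy⟩ := h
  exact ⟨e, he, hy, hx⟩

theorem SameSector.trans (hd : d ≠ 0) (h : SameSector d t x y) (h' : SameSector d t y z) :
    SameSector d t x z := by
  obtain ⟨e, he, hx, hy⟩ := h
  obtain ⟨e', he', hy', hz⟩ := h'
  obtain rfl := sector_unique hd he hy he' hy'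
  exact ⟨e, he, hx, hz⟩

theorem sameSector_self (hd : d ≠ 0) (h : d • x ≠ t) : SameSector d t x x := by
  have h0 : (0 : ℝ) < d := by exact_mod_cast (by omega : 0 < d)
  have hs := arcLength_pos t (d • x)
  have hs1 := arcLength_lt_one_iff.2 h.symm
  have hd1 : (1 : ℝ) ≤ d := by exact_mod_cast (by omega : 1 ≤ d)
  set s := arcLength t (d • x)
  have harc : arcLength (x - ((s / d : ℝ) : UnitAddCircle)) x = s / d :=
    arcLength_eq (by positivity) ((div_le_one h0).2 (by linarith)) (by abel)
  have hlt : s / d < 1 / d := by gcongr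
  refine ⟨x - ((s / d : ℝ) : UnitAddCircle), ?_, by rwa [harc], by rwa [harc]⟩
  rw [smul_sub, nsmul_coe, mul_div_cancel₀ _ h0.ne', sub_eq_iff_eq_add]
  exact (add_arcLength t (d • x)).symm

/-- Multiplication by `d` scales the distances inside a sector, and preserves their order. -/
theorem SameSector.arcLength_nsmul (hd : d ≠ 0) (h : SameSector d t x y) :
    (arcLength (d • x) (d • y) = d * arcLength x y ∧ arcLength x y < 1 / d ∧
      arcLength (d • x) (d • y) < arcLength (d • x) t) ∨
    (1 - arcLength (d • x) (d • y) = d * (1 - arcLength x y) ∧ 1 - arcLength x y < 1 / d ∧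
      arcLength (d • x) t < arcLength (d • x) (d • y)) := by
  have h0 : (0 : ℝ) < d := by exact_mod_cast (by omega : 0 < d)
  obtain ⟨e, he, hx, hy⟩ := h
  have hx' := arcLength_of_sector hd he hx
  have hy' := arcLength_of_sector hd he hy
  have hpx := arcLength_pos e x
  have hpy := arcLength_pos e y
  have hx1 : d * arcLength e x < 1 := by rwa [lt_div_iff₀' h0] at hx
  have hxt : arcLength (d • x) t = 1 - d * arcLength e x := by
    have := arcLength_add_arcLength_comm (x := t) (y := d • x)
      (arcLength_lt_one_iff.1 (by rw [hx']; exact hx1))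
    linarith
  rcases lt_or_ge (arcLength e x) (arcLength e y) with hlt | hle
  · left
    have h1 := arcLength_sub_of_lt hlt
    have hlt' : arcLength t (d • x) < arcLength t (d • y) := by
      rw [hx', hy']; exact mul_lt_mul_of_pos_left hlt h0
    have h2 := arcLength_sub_of_lt hlt'
    have hy1 : d * arcLength e y < 1 := by rwa [lt_div_iff₀' h0] at hy
    refine ⟨?_, by linarith, by linarith⟩
    rw [h2, h1, hx', hy']; ring
  · right
    have h1 := arcLength_sub_add_one_of_le hle
    have hle' : arcLength t (d • y) ≤ arcLength t (d • x) := by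
      rw [hx', hy']; exact mul_le_mul_of_nonneg_left hle h0.le
    have h2 := arcLength_sub_add_one_of_le hle'
    have := mul_pos h0 hpy
    refine ⟨?_, by linarith, by linarith⟩
    rw [h2, h1, hx', hy']; ring

theorem SameSector.nsmul_injective (hd : d ≠ 0) (h : SameSector d t x y) (hxy : d • x = d • y) :
    x = y := by
  have h0 : (d : ℝ) ≠ 0 := by exact_mod_cast hd
  obtain ⟨e, he, hx, hy⟩ := h
  have h1 := arcLength_of_sector hd he hx
  rw [hxy, arcLength_of_sector hd he hy] at h1
  exact arcLength_right_injective (mul_left_cancel₀ h0 h1.symm)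

/-- Measured from the left end `e` of the sector, multiplication by `d` is a scaling. It keeps the
cyclic order of the three points, even if an arc between them runs outside the sector. -/
theorem SameSector.arcLength_lt (hd : d ≠ 0) (h : SameSector d t x y) (h' : SameSector d t x z)
    (hlt : arcLength x y < arcLength x z) :
    arcLength (d • x) (d • y) < arcLength (d • x) (d • z) := by
  have h0 : (0 : ℝ) < d := by exact_mod_cast (by omega : 0 < d)
  obtain ⟨e, he, hx, hy⟩ := h
  obtain ⟨e', he', hx', hz⟩ := h'
  obtain rfl := sector_unique hd he hx he' hx'
  have hz1 := arcLength_le_one e z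
  have hpy := arcLength_pos e y
  have hpz := mul_pos h0 (arcLength_pos e z)
  have hy1 : d * arcLength e y < 1 := by rwa [lt_div_iff₀' h0] at hy
  rw [arcLength_eq_ite t (d • x), arcLength_eq_ite t (d • x) (d • z), arcLength_of_sector hd he hx,
    arcLength_of_sector hd he hy, arcLength_of_sector hd he hz]
  rw [arcLength_eq_ite e x, arcLength_eq_ite e x z] at hlt
  simp only [mul_lt_mul_iff_right₀ h0]
  have key : arcLength e y < arcLength e z → d * arcLength e y < d * arcLength e z := fun h =>
    mul_lt_mul_of_pos_left h h0
  split_ifs at hlt ⊢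
  · linarith [key (by linarith)]
  · linarith
  · linarith
  · linarith [key (by linarith)]

theorem SameSector.arcLength_lt_iff (hd : d ≠ 0) (h : SameSector d t x y)
    (h' : SameSector d t x z) :
    arcLength (d • x) (d • y) < arcLength (d • x) (d • z) ↔ arcLength x y < arcLength x z := by
  refine ⟨fun hlt => ?_, h.arcLength_lt hd h'⟩
  by_contra! hle
  rcases hle.lt_or_eq with h1 | h1
  · linarith [h'.arcLength_lt hd h h1]
  · rw [arcLength_right_injective h1] at hlt
    exact lt_irrefl _ hlt

/-- Crossing pairs in two sectors lie in the same sector. -/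
theorem SameSector.of_crossing (hd : d ≠ 0) {x' y' : UnitAddCircle} (h : SameSector d t x x')
    (h' : SameSector d t y y') (hxx' : x ≠ x') (hy : y ∈ openArc x x')
    (hy' : y' ∈ openArc x' x) :
    SameSector d t x y := by
  obtain ⟨e, he, hx, hx'⟩ := h
  obtain ⟨e', he', hey, hey'⟩ := h'
  rw [mem_openArc] at hy hy'
  obtain rfl : e = e' := by
    rcases lt_trichotomy (arcLength e x) (arcLength e x') with hlt | heq | hlt
    · refine sector_unique hd he ?_ he' hey
      have h2 := arcLength_sub_of_lt hlt
      rcases arcLength_add e x y with h3 | h3 <;> linarith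
    · exact absurd (arcLength_right_injective heq) hxx'
    · refine sector_unique hd he ?_ he' hey'
      have h2 := arcLength_sub_of_lt hlt
      rcases arcLength_add e x' y' with h3 | h3 <;> linarith
  exact ⟨e, he, hx, hey⟩

end

/-! ### Itineraries: order, crossing pairs and periodicity -/

section

variable {d : ℕ} {t x y z w : UnitAddCircle}

theorem pow_add_nsmul (d m n : ℕ) (x : UnitAddCircle) :
    d ^ (m + n) • x = d ^ m • d ^ n • x := by
  rw [smul_smul, pow_add]

namespace SameItinerary

theorem symm (h : SameItinerary d t x y) : SameItinerary d t y x := fun n => (h n).symm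

theorem trans (hd : d ≠ 0) (h : SameItinerary d t x y) (h' : SameItinerary d t y z) :
    SameItinerary d t x z := fun n => (h n).trans hd (h' n)

theorem sameSector (h : SameItinerary d t x y) : SameSector d t x y := by simpa using h 0

theorem iterate (h : SameItinerary d t x y) (n : ℕ) :
    SameItinerary d t (d ^ n • x) (d ^ n • y) := fun k => by
  rw [← pow_add_nsmul, ← pow_add_nsmul]
  exact h (k + n)

theorem nsmul (h : SameItinerary d t x y) : SameItinerary d t (d • x) (d • y) := by
  simpa using h.iterate 1

theorem eq_of_pow_nsmul_eq (hd : d ≠ 0) (h : SameItinerary d t x y) {n : ℕ}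
    (hxy : d ^ n • x = d ^ n • y) : x = y := by
  induction n with
  | zero => simpa using hxy
  | succ n ih =>
    refine ih ((h n).nsmul_injective hd ?_)
    rwa [add_comm, pow_add_nsmul, pow_add_nsmul, pow_one] at hxy

theorem arcLength_lt_iff (hd : d ≠ 0) (h : SameItinerary d t x y) (h' : SameItinerary d t x z)
    (n : ℕ) : arcLength (d ^ n • x) (d ^ n • y) < arcLength (d ^ n • x) (d ^ n • z) ↔
      arcLength x y < arcLength x z := by
  induction n with
  | zero => simp
  | succ n ih =>
    rw [← ih, ← (h n).arcLength_lt_iff hd (h' n)]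
    simp only [add_comm n 1, pow_add_nsmul d 1 n, pow_one]

/-- Crossing pairs, each within a sector, lie in the same sector, so multiplication by `d` preserves
the order of their four points and they go on crossing. Distinct itinerary classes are therefore
never linked. -/
theorem of_crossing (hd : d ≠ 0) {x' y' : UnitAddCircle} (h : SameItinerary d t x x')
    (h' : SameItinerary d t y y') (hxx' : x ≠ x') (hy : y ∈ openArc x x')
    (hy' : y' ∈ openArc x' x) : SameItinerary d t x y := by
  have key : ∀ n : ℕ, d ^ n • y ∈ openArc (d ^ n • x) (d ^ n • x') ∧
      d ^ n • y' ∈ openArc (d ^ n • x') (d ^ n • x) ∧ SameSector d t (d ^ n • x) (d ^ n • y) := by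
    intro n
    have hne : d ^ n • x ≠ d ^ n • x' := fun he => hxx' (h.eq_of_pow_nsmul_eq hd he)
    have hsuff : d ^ n • y ∈ openArc (d ^ n • x) (d ^ n • x') ∧
        d ^ n • y' ∈ openArc (d ^ n • x') (d ^ n • x) := by
      clear hne
      induction n with
      | zero => simpa using ⟨hy, hy'⟩
      | succ n ih =>
        have hne : d ^ n • x ≠ d ^ n • x' := fun he => hxx' (h.eq_of_pow_nsmul_eq hd he)
        have hs := (h n).of_crossing hd (h' n) hne ih.1 ih.2
        simp only [add_comm n 1, pow_add_nsmul d 1 n, pow_one]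
        exact ⟨hs.arcLength_lt hd (h n) ih.1,
          ((h n).symm.trans hd (hs.trans hd (h' n))).arcLength_lt hd (h n).symm ih.2⟩
    exact ⟨hsuff.1, hsuff.2, (h n).of_crossing hd (h' n) hne hsuff.1 hsuff.2⟩
  exact fun n => (key n).2.2

theorem _root_.Unicritical.exists_arcLength_nsmul (n : ℕ) (x y : UnitAddCircle) :
    ∃ k : ℤ, arcLength (n • x) (n • y) = n * arcLength x y + k := by
  rw [← coe_eq_coe_iff]
  have h1 := add_arcLength (n • x) (n • y)
  have h2 := congrArg (n • ·) (add_arcLength x y)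
  simp only [smul_add, nsmul_coe] at h2
  exact add_left_cancel (h1.trans h2.symm)

/-- A periodic angle forces the angles of its itinerary class to be periodic. -/
theorem pow_nsmul_eq (hd : 2 ≤ d) (h : SameItinerary d t x y) {n : ℕ} (hn : n ≠ 0)
    (hx : d ^ n • x = x) : d ^ n • y = y := by
  have hd0 : d ≠ 0 := by omega
  have hdn : (2 : ℝ) ≤ (d : ℝ) ^ n := by
    have : (2 : ℝ) ≤ d := by exact_mod_cast hd
    exact this.trans (le_self_pow₀ (by linarith) hn)
  have hxk : ∀ k : ℕ, d ^ (n * k) • x = x := by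
    intro k
    induction k with
    | zero => simp
    | succ k ih => rw [mul_add, mul_one, pow_add_nsmul, hx, ih]
  have hsame : ∀ k : ℕ, SameItinerary d t x (d ^ (n * k) • y) := fun k => by
    have := h.iterate (n * k)
    rwa [hxk] at this
  -- Since `d ^ n` fixes `x` and respects the order within the class, the distances from `x` form a
  -- monotone sequence, which converges.
  set a : ℕ → ℝ := fun k => arcLength x (d ^ (n * k) • y)
  have hsucc : ∀ k, d ^ (n * (k + 1)) • y = d ^ n • d ^ (n * k) • y := fun k => by
    rw [← pow_add_nsmul]; ring_nf
  have ha : ∀ k, ∃ j : ℤ, a (k + 1) = d ^ n * a k + j := by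
    intro k
    obtain ⟨j, hj⟩ := exists_arcLength_nsmul (d ^ n) x (d ^ (n * k) • y)
    rw [hx, ← hsucc] at hj
    refine ⟨j, ?_⟩
    push_cast at hj
    exact hj
  have hlt : ∀ k l, a (k + 1) < a (l + 1) ↔ a k < a l := by
    intro k l
    have := (hsame k).arcLength_lt_iff hd0 (hsame l) n
    rwa [hx, ← hsucc, ← hsucc] at this
  have hlim : ∃ L, Tendsto a atTop (𝓝 L) := by
    rcases le_or_gt (a 0) (a 1) with h01 | h01
    · have hm : Monotone a := monotone_nat_of_le_succ fun k => by
        induction k with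
        | zero => exact h01
        | succ k ih => exact not_lt.1 fun hc => not_lt.2 ih ((hlt _ _).1 hc)
      exact ⟨_, tendsto_atTop_ciSup hm ⟨1, by rintro _ ⟨k, rfl⟩; exact arcLength_le_one _ _⟩⟩
    · have hm : Antitone a := antitone_nat_of_succ_le fun k => by
        induction k with
        | zero => exact h01.le
        | succ k ih => exact not_lt.1 fun hc => not_lt.2 ih ((hlt _ _).1 hc)
      exact ⟨_, tendsto_atTop_ciInf hm ⟨0, by rintro _ ⟨k, rfl⟩; exact (arcLength_pos _ _).le⟩⟩
  obtain ⟨L, hL⟩ := hlim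
  -- The increments tend to `0` and satisfy `b (k + 1) = d ^ n * b k` modulo `1`, hence exactly for
  -- large `k`. The expansion then forces them to vanish.
  set b : ℕ → ℝ := fun k => a (k + 1) - a k
  have hb : Tendsto b atTop (𝓝 0) := by
    simpa using ((tendsto_add_atTop_iff_nat 1).2 hL).sub hL
  have hb' : Tendsto (fun k => b (k + 1) - d ^ n * b k) atTop (𝓝 0) := by
    simpa using ((tendsto_add_atTop_iff_nat 1).2 hb).sub (hb.const_mul ((d : ℝ) ^ n))
  obtain ⟨K, hK⟩ := eventually_atTop.1 (hb'.eventually (Ioo_mem_nhds neg_one_lt_zero one_pos))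
  have hstep : ∀ k, K ≤ k → b (k + 1) = d ^ n * b k := by
    intro k hk
    obtain ⟨i, hi⟩ := ha k
    obtain ⟨j, hj⟩ := ha (k + 1)
    have h1 : b (k + 1) - d ^ n * b k = ((j - i : ℤ) : ℝ) := by
      simp only [b]; push_cast; linear_combination hj - hi
    have h2 := hK k hk
    rw [h1] at h2
    have h3 : j - i = 0 := by
      have h4 : (-1 : ℤ) < j - i := by exact_mod_cast h2.1
      have h5 : j - i < (1 : ℤ) := by exact_mod_cast h2.2
      omega
    rw [h3, Int.cast_zero] at h1
    linarith
  have hbK : ∀ k, |b K| ≤ |b (K + k)| := by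
    intro k
    induction k with
    | zero => rfl
    | succ k ih =>
      refine ih.trans ?_
      rw [← add_assoc, hstep _ (by omega), abs_mul,
        abs_of_nonneg (show (0 : ℝ) ≤ (d : ℝ) ^ n by positivity)]
      exact le_mul_of_one_le_left (abs_nonneg _) (by linarith)
  have hb0 : b K = 0 := by
    have h1 : Tendsto (fun k => |b (K + k)|) atTop (𝓝 0) := by
      have := ((tendsto_add_atTop_iff_nat K).2 hb).abs
      simpa [add_comm] using this
    exact abs_nonpos_iff.1 (ge_of_tendsto' h1 hbK)
  have h1 : d ^ (n * (K + 1)) • y = d ^ (n * K) • y :=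
    arcLength_right_injective (x := x) (by simp only [b, a] at hb0; linarith)
  -- Iterates are injective on an itinerary class, so eventual periodicity is periodicity.
  have h2 := hsame 1
  rw [mul_one] at h2
  refine ((h.symm.trans hd0 h2).eq_of_pow_nsmul_eq hd0 (n := n * K) ?_).symm
  rw [← pow_add_nsmul, ← h1]
  ring_nf

end SameItinerary

end

section

/-! ### Formal orbit portraits -/

variable {d p : ℕ} {A : ZMod p → Set UnitAddCircle} {a b t x y z w : UnitAddCircle}

theorem rotate_zero (d : ℕ) (B : Set UnitAddCircle) : rotate d 0 B = B := by
  simp [rotate]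

theorem add_mem_rotate {B : Set UnitAddCircle} (hx : x ∈ B) (k : ℕ) :
    x + (((k : ℝ) / (d : ℝ) : ℝ) : UnitAddCircle) ∈ rotate d k B :=
  mem_image_of_mem _ hx

theorem nsmul_add_translate (hd : d ≠ 0) (x : UnitAddCircle) (k : ℕ) :
    d • (x + (((k : ℝ) / (d : ℝ) : ℝ) : UnitAddCircle)) = d • x := by
  have h0 : (d : ℝ) ≠ 0 := by exact_mod_cast hd
  rw [smul_add, nsmul_coe, mul_div_cancel₀ _ h0, add_eq_left]
  have := coe_add_intCast 0 k
  simpa using this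

theorem exists_eq_add_translate (hd : d ≠ 0) (h : d • x = d • y) :
    ∃ k < d, x = y + (((k : ℝ) / (d : ℝ) : ℝ) : UnitAddCircle) := by
  have h0 : (d : ℝ) ≠ 0 := by exact_mod_cast hd
  obtain ⟨x, rfl⟩ := QuotientAddGroup.mk_surjective x
  obtain ⟨y, rfl⟩ := QuotientAddGroup.mk_surjective y
  change d • (x : UnitAddCircle) = d • (y : UnitAddCircle) at h
  rw [nsmul_coe, nsmul_coe, coe_eq_coe_iff] at h
  obtain ⟨n, hn⟩ := h
  have hdz : (d : ℤ) ≠ 0 := by exact_mod_cast hd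
  have hr := Int.emod_nonneg n hdz
  obtain ⟨k, hk⟩ := Int.eq_ofNat_of_zero_le hr
  refine ⟨k, ?_, ?_⟩
  · have := Int.emod_lt_of_pos n (show (0 : ℤ) < d by omega)
    omega
  · change (x : UnitAddCircle) = (y : UnitAddCircle) + _
    rw [← AddCircle.coe_add, coe_eq_coe_iff]
    refine ⟨n / d, ?_⟩
    have h1 : (n : ℝ) = d * ((n / d : ℤ) : ℝ) + k := by
      have := Int.mul_ediv_add_emod n d
      rw [hk] at this
      exact_mod_cast this.symm
    have h2 : d * x = d * (y + k / d + ((n / d : ℤ) : ℝ)) := by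
      rw [mul_add, mul_add, mul_div_cancel₀ _ h0, hn, h1]; ring
    exact mul_left_cancel₀ h0 h2

theorem arcLength_add_right (x y z : UnitAddCircle) :
    arcLength (x + z) (y + z) = arcLength x y := by
  rw [arcLength, arcLength, add_sub_add_right_eq_sub]

theorem exists_isComplementaryArc {B : Set UnitAddCircle} (hB : B.Finite) (hx : x ∈ B) :
    ∃ y, IsComplementaryArc B x y ∧ ∀ z ∈ B, arcLength x y ≤ arcLength x z := by
  obtain ⟨y, hy, hmin⟩ := Set.exists_min_image B (arcLength x) hB ⟨x, hx⟩
  exact ⟨y, ⟨hx, hy, Set.disjoint_left.2 fun z hz hzB => not_lt.2 (hmin z hzB) hz⟩, hmin⟩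

theorem openArc_nonempty (a b : UnitAddCircle) : (openArc a b).Nonempty := by
  rw [openArc_eq_image]
  exact (nonempty_Ioo.2 (arcLength_pos a b)).image _

namespace IsCharacteristicArc

theorem le_arcLength (hab : IsCharacteristicArc A a b) (hfin : ∀ j, (A j).Finite) {i : ZMod p}
    (hx : x ∈ A i) (hy : y ∈ A i) : arcLength a b ≤ arcLength x y := by
  obtain ⟨z, hz, hmin⟩ := exists_isComplementaryArc (hfin i) hx
  exact (hab.2 i x z hz).trans (hmin y hy)

theorem exists_of_finite [NeZero p] (hne : ∀ j, (A j).Nonempty) (hfin : ∀ j, (A j).Finite) :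
    ∃ a b, IsCharacteristicArc A a b := by
  have hS : {q : UnitAddCircle × UnitAddCircle | ∃ j, IsComplementaryArc (A j) q.1 q.2}.Finite := by
    refine (Set.finite_iUnion fun j => (hfin j).prod (hfin j)).subset ?_
    rintro ⟨u, v⟩ ⟨j, hj⟩
    exact Set.mem_iUnion.2 ⟨j, hj.1, hj.2.1⟩
  obtain ⟨x, hx⟩ := hne 0
  obtain ⟨y, hy, -⟩ := exists_isComplementaryArc (hfin 0) hx
  obtain ⟨⟨u, v⟩, huv, hmin⟩ := Set.exists_min_image _ (fun q => arcLength q.1 q.2) hS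
    ⟨(x, y), 0, hy⟩
  exact ⟨u, v, huv, fun i a' b' h => hmin (a', b') ⟨i, h⟩⟩

end IsCharacteristicArc

namespace IsFormalOrbitPortrait

theorem eq_of_mem (hd : d ≠ 0) (hA : IsFormalOrbitPortrait d A) {i j : ZMod p} (hi : x ∈ A i)
    (hj : x ∈ A j) : i = j := by
  by_contra h
  have := (hA.unlinked_others i j h 0 (by omega)).disjoint
  rw [rotate_zero] at this
  exact Set.disjoint_left.1 this hi hj

theorem nsmul_mem (hA : IsFormalOrbitPortrait d A) {j : ZMod p} (hx : x ∈ A j) :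
    d • x ∈ A (j + 1) := (hA.bijOn j).mapsTo hx

theorem pow_nsmul_mem (hA : IsFormalOrbitPortrait d A) {j : ZMod p} (hx : x ∈ A j) (n : ℕ) :
    d ^ n • x ∈ A (j + n) := by
  induction n with
  | zero => simpa using hx
  | succ n ih =>
    have := hA.nsmul_mem ih
    rwa [smul_smul, ← pow_succ', add_assoc, ← Nat.cast_succ] at this

theorem exists_period [NeZero p] (hA : IsFormalOrbitPortrait d A) :
    ∃ m : ℕ, m ≠ 0 ∧ ∀ j, ∀ x ∈ A j, d ^ m • x = x := by
  obtain ⟨r, hr, h⟩ := hA.common_period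
  refine ⟨r * p, mul_ne_zero (by omega) (NeZero.ne p), fun j x hx => ?_⟩
  have := Function.iterate_minimalPeriod (f := fun x : UnitAddCircle => d • x) (x := x)
  rwa [h j x hx, smul_iterate] at this

theorem nontrivial [NeZero p] (hA : IsFormalOrbitPortrait d A) {i : ZMod p}
    (hi : (A i).Nontrivial) (j : ZMod p) : (A j).Nontrivial := by
  have h : ∀ n : ℕ, (A (i + n)).Nontrivial := by
    intro n
    induction n with
    | zero => simpa using hi
    | succ n ih =>
      have := ih.image_of_injOn (hA.bijOn _).injOn
      rwa [(hA.bijOn _).image_eq, add_assoc, ← Nat.cast_succ] at this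
  have := h (j - i).val
  rwa [ZMod.natCast_zmod_val, add_sub_cancel] at this

theorem arcLength_lt_or (hd : d ≠ 0) (hA : IsFormalOrbitPortrait d A) {j : ZMod p} (hx : x ∈ A j)
    (hy : y ∈ A j) (hxy : x ≠ y) : arcLength x y < 1 / d ∨ arcLength y x < 1 / d := by
  have hd1 : (1 : ℝ) / d ≤ 1 := by
    rw [div_le_one (by exact_mod_cast (by omega : 0 < d))]
    exact_mod_cast (by omega : 1 ≤ d)
  obtain ⟨u, l, hl, hsub⟩ := hA.short_arc j
  obtain ⟨r, hr, rfl⟩ := hsub hx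
  obtain ⟨s, hs, rfl⟩ := hsub hy
  have key : ∀ {r s : ℝ}, r ∈ Icc 0 l → s ∈ Icc 0 l → r < s →
      arcLength (u + (r : UnitAddCircle)) (u + (s : UnitAddCircle)) < 1 / d := by
    intro r s hr hs hrs
    rw [arcLength_eq (s := s - r) (by linarith) (by linarith [hr.1, hs.2])]
    · linarith [hr.1, hs.2]
    · rw [add_assoc, ← AddCircle.coe_add, add_sub_cancel]
  rcases lt_trichotomy r s with h | rfl | h
  · exact .inl (key hr hs h)
  · exact absurd rfl hxy
  · exact .inr (key hs hr h)

/-- The characteristic arc is the image of the long complementary arc of the preceding part: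
its end points have preimages bounding an arc of length less than `1 / d`. -/
theorem exists_preimage_arc (hd : 2 ≤ d) (hA : IsFormalOrbitPortrait d A)
    (hab : IsCharacteristicArc A a b) (hne : a ≠ b) :
    ∃ q a' b', a' ∈ A q ∧ b' ∈ A q ∧ d • a' = a ∧ d • b' = b ∧ arcLength b' a' < 1 / d ∧
      Disjoint (openArc a b) (A (q + 1)) := by
  obtain ⟨j, haj, hbj, hdisj⟩ := hab.1
  have hj : j - 1 + 1 = j := sub_add_cancel j 1
  rw [← hj] at haj hbj hdisj
  obtain ⟨a', ha', rfl⟩ := (hA.bijOn _).surjOn haj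
  obtain ⟨b', hb', rfl⟩ := (hA.bijOn _).surjOn hbj
  refine ⟨j - 1, a', b', ha', hb', rfl, rfl, ?_, hdisj⟩
  have hne' : a' ≠ b' := by rintro rfl; exact hne rfl
  -- If `(a', b')` were the short arc, its image `(a, b)` would be `d` times as long, contrary to
  -- minimality.
  refine (hA.arcLength_lt_or (by omega) ha' hb' hne').resolve_left fun h => ?_
  have h1 := hab.le_arcLength hA.finite ha' hb'
  have h2 := arcLength_nsmul (by omega) h.le
  have h3 := arcLength_pos a' b'
  have hd' : (2 : ℝ) ≤ d := by exact_mod_cast hd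
  have h1 : arcLength (d • a') (d • b') ≤ arcLength a' b' := h1
  nlinarith

/-- An angle mapped outside the arc `[a, b]` lies in a translate of the arc `(b', a')`. -/
theorem _root_.Unicritical.exists_mem_openArc_translate (hd : d ≠ 0)
    (hlt : arcLength y x < 1 / d) (ha : d • w ≠ d • x) (hb : d • w ≠ d • y)
    (hw : d • w ∉ openArc (d • x) (d • y)) (hne : d • x ≠ d • y) :
    ∃ k < d, w ∈ openArc (y + (((k : ℝ) / (d : ℝ) : ℝ) : UnitAddCircle))
      (x + (((k : ℝ) / (d : ℝ) : ℝ) : UnitAddCircle)) := by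
  have h0 : (0 : ℝ) < d := by exact_mod_cast (by omega : 0 < d)
  have h1 := (mem_openArc_or hne ha hb).resolve_left hw
  rw [mem_openArc, arcLength_nsmul hd hlt.le] at h1
  have hpos := arcLength_pos (d • y) (d • w)
  set s := arcLength (d • y) (d • w)
  obtain ⟨k, hk, hwk⟩ := exists_eq_add_translate (x := w)
    (y := y + ((s / d : ℝ) : UnitAddCircle)) hd (by
      rw [smul_add, nsmul_coe, mul_div_cancel₀ _ h0.ne']
      exact (add_arcLength _ _).symm)
  refine ⟨k, hk, ?_⟩
  have hsd : s / d < arcLength y x := by rwa [div_lt_iff₀' h0]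
  rw [mem_openArc, arcLength_add_right, hwk, arcLength_add_right,
    arcLength_eq (by positivity) (hsd.le.trans (arcLength_le_one _ _)) rfl]
  exact hsd

theorem _root_.Unicritical.nsmul_mem_openArc_of_translate (hd : d ≠ 0)
    (hlt : arcLength y x < 1 / d) {k : ℕ}
    (hw : w ∈ openArc (y + (((k : ℝ) / (d : ℝ) : ℝ) : UnitAddCircle))
      (x + (((k : ℝ) / (d : ℝ) : ℝ) : UnitAddCircle))) : d • w ∈ openArc (d • y) (d • x) := by
  have h0 : (0 : ℝ) < d := by exact_mod_cast (by omega : 0 < d)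
  rw [mem_openArc, arcLength_add_right] at hw
  rw [mem_openArc, arcLength_nsmul hd hlt.le, ← nsmul_add_translate hd y k,
    arcLength_nsmul hd (hw.trans hlt).le]
  exact mul_lt_mul_of_pos_left hw h0

/-- Translates of the closed arc `[b', a']` lie in sectors. -/
theorem _root_.Unicritical.sameSector_of_translate (hd : d ≠ 0)
    (hlt : arcLength y x < 1 / d) (ht : t ∈ openArc (d • x) (d • y)) (hne : d • x ≠ d • y) (k : ℕ)
    {u v : UnitAddCircle}
    (hu : u = y + (((k : ℝ) / (d : ℝ) : ℝ) : UnitAddCircle) ∨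
      arcLength (y + (((k : ℝ) / (d : ℝ) : ℝ) : UnitAddCircle)) u ≤ arcLength y x)
    (hv : v = y + (((k : ℝ) / (d : ℝ) : ℝ) : UnitAddCircle) ∨
      arcLength (y + (((k : ℝ) / (d : ℝ) : ℝ) : UnitAddCircle)) v ≤ arcLength y x) :
    SameSector d t u v := by
  have h0 : (0 : ℝ) < d := by exact_mod_cast (by omega : 0 < d)
  have hd1 : (1 : ℝ) ≤ d := by exact_mod_cast (by omega : 1 ≤ d)
  have hpos := arcLength_pos t (d • y)
  have hσ := arcLength_nsmul hd hlt.le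
  have htot : arcLength t (d • y) + d * arcLength y x < 1 := by
    have h1 := arcLength_sub_of_lt ht
    have h2 := arcLength_add_arcLength_comm hne
    have h3 := arcLength_pos (d • x) t
    linarith
  set s := arcLength t (d • y)
  set β := y + (((k : ℝ) / (d : ℝ) : ℝ) : UnitAddCircle)
  have key : ∀ r : ℝ, 0 ≤ r → r ≤ arcLength y x →
      arcLength (β - ((s / d : ℝ) : UnitAddCircle)) (β + (r : UnitAddCircle)) < 1 / d := by
    intro r hr hr'
    have h1 : s / d + r < 1 / d := by
      have := mul_le_mul_of_nonneg_left hr' h0.le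
      rw [lt_div_iff₀' h0, mul_add, mul_div_cancel₀ _ h0.ne']
      linarith
    rw [arcLength_eq (s := s / d + r) (by positivity)]
    · exact h1
    · exact h1.le.trans ((div_le_one h0).2 hd1)
    · rw [AddCircle.coe_add]; abel
  have key' : ∀ u, (u = β ∨ arcLength β u ≤ arcLength y x) →
      arcLength (β - ((s / d : ℝ) : UnitAddCircle)) u < 1 / d := by
    rintro u (rfl | hu)
    · simpa using key 0 le_rfl (arcLength_pos _ _).le
    · have := key _ (arcLength_pos _ _).le hu
      rwa [add_arcLength] at this
  refine ⟨β - ((s / d : ℝ) : UnitAddCircle), ?_, key' u hu, key' v hv⟩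
  rw [smul_sub, nsmul_coe, mul_div_cancel₀ _ h0.ne', nsmul_add_translate hd, sub_eq_iff_eq_add]
  exact (add_arcLength _ _).symm

variable (hd : 2 ≤ d) (hA : IsFormalOrbitPortrait d A) (hab : IsCharacteristicArc A a b)
  (hne : a ≠ b) (hnt : ∀ j, (A j).Nontrivial)
include hd hA hab hne hnt

/-- The preimages of `(a, b)` are complementary to the translates of the closed arc `[b', a']`.
Unlinkedness from the translates of `A q`, and minimality of the characteristic arc, keep each part
out of these preimages and within one translate. Such a translate meets no preimage of `t`. -/
theorem notMem_openArc_and_sameSector (ht : t ∈ openArc a b) (m : ZMod p) :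
    (∀ x ∈ A m, d • x ∉ openArc a b) ∧ ∀ x ∈ A m, ∀ y ∈ A m, SameSector d t x y := by
  have hd0 : d ≠ 0 := by omega
  obtain ⟨q, a', b', ha', hb', rfl, rfl, hlt, hdisj⟩ := hA.exists_preimage_arc hd hab hne
  have hne' : b' ≠ a' := by rintro rfl; exact hne rfl
  have hends : ∀ i, i ≠ q → ∀ x ∈ A i, ∀ y ∈ A q, d • x ≠ d • y := by
    intro i hi x hx y hy h
    obtain ⟨k, hk, rfl⟩ := exists_eq_add_translate hd0 h
    exact Set.disjoint_left.1 (hA.unlinked_others q i hi.symm k hk).disjoint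
      (add_mem_rotate hy k) hx
  have hout : ∀ x ∈ A m, d • x ∉ openArc (d • a') (d • b') := by
    rcases eq_or_ne m q with rfl | hmq
    · exact fun x hx h => Set.disjoint_left.1 hdisj h (hA.nsmul_mem hx)
    · intro z hz hzab
      -- A point of `A m` over `(a, b)` together with one outside would link `A m` with a translate
      -- of `A q`.
      have hall : ∀ w ∈ A m, d • w ∈ openArc (d • a') (d • b') := by
        intro w hw
        by_contra hwab
        obtain ⟨k, hk, hwk⟩ := exists_mem_openArc_translate hd0 hlt (hends m hmq w hw a' ha')
          (hends m hmq w hw b' hb') hwab hne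
        have hun := hA.unlinked_others q m hmq.symm k hk
        have hz' : z ∉ openArc (b' + (((k : ℝ) / (d : ℝ) : ℝ) : UnitAddCircle))
            (a' + (((k : ℝ) / (d : ℝ) : ℝ) : UnitAddCircle)) := fun h =>
          Set.disjoint_left.1 (openArc_disjoint hne) hzab
            (nsmul_mem_openArc_of_translate hd0 hlt h)
        refine hun.not_crossing (add_mem_rotate hb' k) (add_mem_rotate ha' k) hw hz
          (fun h => hne' (add_right_cancel h)) hwk
          ((mem_openArc_or (fun h => hne' (add_right_cancel h)) ?_ ?_).resolve_left hz') <;>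
        rintro rfl
        · exact Set.disjoint_left.1 hun.disjoint (add_mem_rotate hb' k) hz
        · exact Set.disjoint_left.1 hun.disjoint (add_mem_rotate ha' k) hz
      -- Now two image angles in `A (m + 1)` lie inside `(a, b)` and are closer than the length of
      -- the shortest complementary arc.
      obtain ⟨x, hx, y, hy, hxy⟩ := hnt m
      have key : ∀ x ∈ A m, ∀ y ∈ A m,
          ¬ arcLength (d • a') (d • x) < arcLength (d • a') (d • y) := by
        intro x hx y hy h
        have h1 := arcLength_sub_of_lt h
        have h2 := hab.le_arcLength hA.finite (hA.nsmul_mem hx) (hA.nsmul_mem hy)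
        have h3 := mem_openArc.1 (hall y hy)
        have h4 := arcLength_pos (d • a') (d • x)
        linarith
      exact hxy ((hA.bijOn m).injOn hx hy (arcLength_right_injective
        (le_antisymm (not_lt.1 (key y hy x hx)) (not_lt.1 (key x hx y hy)))))
  refine ⟨hout, fun x hx y hy => ?_⟩
  rcases eq_or_ne m q with rfl | hmq
  · have key : ∀ x ∈ A m, x = b' + (((0 : ℕ) / (d : ℝ) : ℝ) : UnitAddCircle) ∨
        arcLength (b' + (((0 : ℕ) / (d : ℝ) : ℝ) : UnitAddCircle)) x ≤ arcLength b' a' := by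
      intro x hx
      simp only [Nat.cast_zero, zero_div, AddCircle.coe_zero, add_zero]
      by_cases hxa : d • x = d • a'
      · rw [(hA.bijOn m).injOn hx ha' hxa]
        exact .inr le_rfl
      by_cases hxb : d • x = d • b'
      · exact .inl ((hA.bijOn m).injOn hx hb' hxb)
      obtain ⟨k, hk, hxk⟩ := exists_mem_openArc_translate hd0 hlt hxa hxb (hout x hx) hne
      -- The end point `b'` also belongs to `A m`; with `x` in another translate of the arc, `A m`
      -- would be linked with its own translate.
      obtain rfl : k = 0 := by
        by_contra hk0
        have hun := hA.unlinked_translates m k hk 0 (by omega) hk0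
        rw [rotate_zero] at hun
        refine hun.not_crossing (add_mem_rotate hb' k) (add_mem_rotate ha' k) hx hb'
          (fun h => hne' (add_right_cancel h)) hxk
          ((mem_openArc_or (fun h => hne' (add_right_cancel h)) ?_ ?_).resolve_left fun h => ?_)
        · intro h
          exact Set.disjoint_left.1 hun.disjoint (add_mem_rotate hb' k) (h ▸ hb')
        · intro h
          exact Set.disjoint_left.1 hun.disjoint (add_mem_rotate ha' k) (h ▸ hb')
        · have := nsmul_mem_openArc_of_translate hd0 hlt h
          rw [mem_openArc, arcLength_self] at this
          linarith [arcLength_le_one (d • b') (d • a')]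
      rw [mem_openArc, arcLength_add_right] at hxk
      simp only [Nat.cast_zero, zero_div, AddCircle.coe_zero, add_zero] at hxk
      exact .inr hxk.le
    exact sameSector_of_translate hd0 hlt ht hne 0 (key x hx) (key y hy)
  · obtain ⟨k, hk, hxk⟩ := exists_mem_openArc_translate hd0 hlt (hends m hmq x hx a' ha')
      (hends m hmq x hx b' hb') (hout x hx) hne
    have hun := hA.unlinked_others q m hmq.symm k hk
    have hyk : y ∈ openArc (b' + (((k : ℝ) / (d : ℝ) : ℝ) : UnitAddCircle))
        (a' + (((k : ℝ) / (d : ℝ) : ℝ) : UnitAddCircle)) := by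
      refine (mem_openArc_or (fun h => hne' (add_right_cancel h)) ?_ ?_).resolve_right
        (hun.not_crossing (add_mem_rotate hb' k) (add_mem_rotate ha' k) hx hy
          (fun h => hne' (add_right_cancel h)) hxk) <;>
      rintro rfl
      · exact Set.disjoint_left.1 hun.disjoint (add_mem_rotate hb' k) hy
      · exact Set.disjoint_left.1 hun.disjoint (add_mem_rotate ha' k) hy
    rw [mem_openArc, arcLength_add_right] at hxk hyk
    exact sameSector_of_translate hd0 hlt ht hne k (.inr hxk.le) (.inr hyk.le)

theorem sameItinerary (ht : t ∈ openArc a b) {m : ZMod p} (hx : x ∈ A m) (hy : y ∈ A m) :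
    SameItinerary d t x y := fun n =>
  (hA.notMem_openArc_and_sameSector hd hab hne hnt ht (m + n)).2 _ (hA.pow_nsmul_mem hx n) _
    (hA.pow_nsmul_mem hy n)

end IsFormalOrbitPortrait

end

section

/-! ### Itinerary classes of periodic angles -/

variable {d m : ℕ} {t x y z w : UnitAddCircle} {B : Set UnitAddCircle}

/-- The angle `y` follows `x` in anticlockwise order among the angles with the itinerary
of `x`. -/
def IsNext (d : ℕ) (t x y : UnitAddCircle) : Prop :=
  SameItinerary d t x y ∧ ∀ z, SameItinerary d t x z → arcLength x y ≤ arcLength x z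

/-- A finite set of periodic angles, invariant under multiplication by `d`, that consists of
full itinerary classes. -/
structure IsPeriodicSystem (d m : ℕ) (t : UnitAddCircle) (B : Set UnitAddCircle) : Prop where
  refl : ∀ x ∈ B, SameItinerary d t x x
  mem_of_sameItinerary : ∀ x ∈ B, ∀ y, SameItinerary d t x y → y ∈ B
  nsmul_mem : ∀ x ∈ B, d • x ∈ B
  pow_nsmul_eq : ∀ x ∈ B, d ^ m • x = x
  finite : B.Finite

namespace IsNext

/-- The gaps of one class are disjoint, so at most one of them contains `t`. -/
theorem eq_of_mem_arc {x' y' : UnitAddCircle} (h : IsNext d t x y)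
    (h' : IsNext d t x' y') (hxx' : SameItinerary d t x x') (ht : arcLength x t < arcLength x y)
    (ht' : arcLength x' t < arcLength x' y') : x = x' := by
  by_contra hne
  have h1 := h.2 x' hxx'
  have h2 := h'.2 x hxx'.symm
  have h3 := arcLength_add_arcLength_comm hne
  have h4 := arcLength_pos x t
  rcases arcLength_add x x' t with h5 | h5
  · linarith [arcLength_pos x' t]
  · linarith

theorem arcLength_nsmul_or (hd : d ≠ 0) (h : IsNext d t x y) :
    arcLength (d • x) (d • y) = d * arcLength x y ∨
      arcLength (d • x) t < arcLength (d • x) (d • y) := by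
  rcases h.1.sameSector.arcLength_nsmul hd with h | h
  · exact .inl h.1
  · exact .inr h.2.2

/-- Two gaps of different classes surround `t`, and `(y, y₁)` is not the shorter one. As classes do
not cross, the whole class of `x₀` lies inside `(y, y₁)`. Of two of its elements, the one met first
has its gap inside `(y, y₁)`. -/
theorem arcLength_lt_or (hd : d ≠ 0) {x₀ x₁ y₁ x' u u' : UnitAddCircle} (h₀ : IsNext d t x₀ x₁)
    (hy : IsNext d t y y₁) (ht₀ : arcLength x₀ t < arcLength x₀ x₁)
    (hty : arcLength y t < arcLength y y₁) (hne : ¬ SameItinerary d t x₀ y)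
    (hle : arcLength x₀ x₁ ≤ arcLength y y₁) (hx : SameItinerary d t x₀ x)
    (hx' : SameItinerary d t x₀ x') (hxx' : x ≠ x') (hu : IsNext d t x u)
    (hu' : IsNext d t x' u') :
    arcLength x u < arcLength y y₁ ∨ arcLength x' u' < arcLength y y₁ := by
  have hney : ∀ w, SameItinerary d t x₀ w → w ≠ y := by rintro w hw rfl; exact hne hw
  have hney₁ : ∀ w, SameItinerary d t x₀ w → w ≠ y₁ := by
    rintro w hw rfl; exact hne (hw.trans hd hy.1.symm)
  have hrefl : SameItinerary d t x₀ x₀ := hx.trans hd hx.symm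
  by_cases hcase : arcLength y x₀ < arcLength y y₁
  · have hin : ∀ w, SameItinerary d t x₀ w → arcLength y w < arcLength y y₁ := by
      intro w hw
      by_cases hyy : y = y₁
      · rw [← hyy, arcLength_self]
        exact arcLength_lt_one_iff.2 (hney w hw).symm
      refine (mem_openArc_or hyy (hney w hw) (hney₁ w hw)).resolve_right fun hw' => hne ?_
      exact (hy.1.of_crossing hd hw hyy hcase hw').symm
    have h1 := hin x hx
    have h2 := hin x' hx'
    have h3 := arcLength_pos y x
    have h4 := arcLength_pos y x'
    rcases lt_trichotomy (arcLength y x) (arcLength y x') with h | h | h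
    · left
      have := hu.2 x' (hx.symm.trans hd hx')
      rw [arcLength_sub_of_lt h] at this
      linarith
    · exact absurd (arcLength_right_injective h) hxx'
    · right
      have := hu'.2 x (hx'.symm.trans hd hx)
      rw [arcLength_sub_of_lt h] at this
      linarith
  · exfalso
    -- If `x₀` is outside `(y, y₁)`, then `y` lies in `(x₀, x₁)` because both gaps contain `t`. So
    -- does `y₁`, as classes do not cross, and `(y, y₁)` would be strictly shorter than `(x₀, x₁)`.
    have hcase : arcLength y y₁ < arcLength y x₀ := lt_of_le_of_ne (not_lt.1 hcase) fun h =>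
      hney₁ x₀ hrefl (arcLength_right_injective h).symm
    have h1 := arcLength_add_arcLength_comm (hney x₀ hrefl)
    have h2 := arcLength_pos y t
    have hyin : y ∈ openArc x₀ x₁ := by
      rw [mem_openArc]
      rcases arcLength_add x₀ y t with h3 | h3 <;> linarith [arcLength_pos x₀ t]
    have hx₀₁ : x₀ ≠ x₁ := by
      rintro rfl
      rw [arcLength_self] at hle
      linarith [arcLength_le_one y x₀]
    have hy₁in : y₁ ∈ openArc x₀ x₁ := by
      refine (mem_openArc_or hx₀₁ (hney₁ x₀ hrefl).symm (hney₁ x₁ h₀.1).symm).resolve_right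
        fun h => hne ?_
      exact h₀.1.of_crossing hd hy.1 hx₀₁ hyin h
    rw [mem_openArc] at hy₁in
    have h4 := arcLength_pos x₀ y
    have h5 := arcLength_pos y y₁
    rcases arcLength_add x₀ y y₁ with h3 | h3
    · linarith
    · linarith [arcLength_pos x₀ y₁]

end IsNext

namespace IsPeriodicSystem

theorem pow_nsmul_mem (H : IsPeriodicSystem d m t B) (hx : x ∈ B) (n : ℕ) : d ^ n • x ∈ B := by
  induction n with
  | zero => simpa using hx
  | succ n ih =>
    rw [add_comm, pow_add_nsmul, pow_one]
    exact H.nsmul_mem _ ih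

theorem pow_mul_nsmul_eq (H : IsPeriodicSystem d m t B) (hx : x ∈ B) (n : ℕ) :
    d ^ (m * n) • x = x := by
  induction n with
  | zero => simp
  | succ n ih => rw [mul_add, mul_one, pow_add_nsmul, H.pow_nsmul_eq x hx, ih]

theorem pow_sub_nsmul (H : IsPeriodicSystem d m t B) (hm : m ≠ 0) (hx : x ∈ B) (n : ℕ) :
    d ^ (m * n - n) • d ^ n • x = x := by
  rw [← pow_add_nsmul, Nat.sub_add_cancel (Nat.le_mul_of_pos_left n (by omega)),
    H.pow_mul_nsmul_eq hx]

theorem exists_isNext (H : IsPeriodicSystem d m t B) (hx : x ∈ B) : ∃ y, IsNext d t x y := by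
  obtain ⟨y, hy, hmin⟩ := Set.exists_min_image {y | SameItinerary d t x y} (arcLength x)
    (H.finite.subset fun y hy => H.mem_of_sameItinerary x hx y hy) ⟨x, H.refl x hx⟩
  exact ⟨y, hy, hmin⟩

/-- On the system, `d ^ n` is inverted by `d ^ (m * n - n)`, so a closer successor of the image
would pull back to a closer successor of `x`. -/
theorem isNext_pow_nsmul (H : IsPeriodicSystem d m t B) (hd : d ≠ 0) (hm : m ≠ 0) (hx : x ∈ B)
    (h : IsNext d t x y) (n : ℕ) : IsNext d t (d ^ n • x) (d ^ n • y) := by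
  refine ⟨h.1.iterate n, fun z hz => ?_⟩
  have h1 := hz.iterate (m * n - n)
  rw [H.pow_sub_nsmul hm hx] at h1
  have h2 := h.2 _ h1
  have hz' : d ^ n • d ^ (m * n - n) • z = z := by
    rw [← pow_add_nsmul, Nat.add_sub_cancel' (Nat.le_mul_of_pos_left n (by omega)),
      H.pow_mul_nsmul_eq (H.mem_of_sameItinerary _ (H.pow_nsmul_mem hx n) _ hz)]
  by_contra! hlt
  rw [← hz', h1.arcLength_lt_iff hd h.1] at hlt
  linarith

/-- The shortest gap in an orbit of gaps contains the critical angle `t`. -/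
theorem arcLength_lt_of_forall_le (H : IsPeriodicSystem d m t B) (hd : 2 ≤ d) (hm : m ≠ 0)
    (hx : x ∈ B) (h : IsNext d t x y)
    (hmin : ∀ n : ℕ, arcLength x y ≤ arcLength (d ^ n • x) (d ^ n • y)) :
    arcLength x t < arcLength x y := by
  have hy := H.mem_of_sameItinerary x hx y h.1
  have hback : ∀ {z}, z ∈ B → d • d ^ (m - 1) • z = z := fun {z} hz => by
    rw [smul_smul, ← pow_succ', Nat.sub_add_cancel (by omega), H.pow_nsmul_eq z hz]
  -- By periodicity the preceding gap in the orbit is the image under `d ^ (m - 1)`. Unless `t` lies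
  -- in the present gap, this one is `d` times as long as its predecessor.
  have h1 := (H.isNext_pow_nsmul (by omega) hm hx h (m - 1)).arcLength_nsmul_or (by omega)
  rw [hback hx, hback hy] at h1
  refine h1.resolve_left fun h2 => ?_
  have h3 := hmin (m - 1)
  have h4 := arcLength_pos (d ^ (m - 1) • x) (d ^ (m - 1) • y)
  have hd' : (2 : ℝ) ≤ d := by exact_mod_cast hd
  nlinarith

theorem exists_min_iterate (H : IsPeriodicSystem d m t B) (hx : x ∈ B) (h : IsNext d t x y) :
    ∃ k : ℕ, ∀ n : ℕ, arcLength (d ^ k • x) (d ^ k • y) ≤ arcLength (d ^ n • x) (d ^ n • y) := by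
  have hy := H.mem_of_sameItinerary x hx y h.1
  obtain ⟨-, ⟨k, rfl⟩, hk⟩ := Set.exists_min_image (range fun n : ℕ => (d ^ n • x, d ^ n • y))
    (fun q => arcLength q.1 q.2) ((H.finite.prod H.finite).subset (by
      rintro _ ⟨n, rfl⟩
      exact ⟨H.pow_nsmul_mem hx n, H.pow_nsmul_mem hy n⟩)) ⟨_, 0, rfl⟩
  exact ⟨k, fun n => hk _ ⟨n, rfl⟩⟩

section

variable (H : IsPeriodicSystem d m t B) (hd : 2 ≤ d) (hm : m ≠ 0) {x₀ x₁ : UnitAddCircle}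
  (hx₀ : x₀ ∈ B) (h₀ : IsNext d t x₀ x₁)
  (hmin : ∀ x ∈ B, ∀ y, IsNext d t x y → arcLength x₀ x₁ ≤ arcLength x y)
include H hd hm hx₀ h₀ hmin

/-- The shortest iterate of the gap at `z` contains `t`. It is not a gap of the class of `x₀`: the
only one containing `t` starts at `x₀`, and then `z` would lie on the orbit of `x₀`. -/
theorem exists_short_gap {z₁ : UnitAddCircle} (hz : SameItinerary d t x₀ z)
    (hzorb : ∀ n : ℕ, z ≠ d ^ n • x₀) (hz₁ : IsNext d t z z₁) :
    ∃ y y₁, y ∈ B ∧ IsNext d t y y₁ ∧ arcLength y t < arcLength y y₁ ∧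
      ¬ SameItinerary d t x₀ y ∧ arcLength y y₁ ≤ arcLength z z₁ := by
  have hd0 : d ≠ 0 := by omega
  have hzB := H.mem_of_sameItinerary _ hx₀ _ hz
  obtain ⟨k, hk⟩ := H.exists_min_iterate hzB hz₁
  have hnext := H.isNext_pow_nsmul hd0 hm hzB hz₁ k
  have ht := H.arcLength_lt_of_forall_le hd hm (H.pow_nsmul_mem hzB k) hnext fun n => by
    rw [← pow_add_nsmul, ← pow_add_nsmul]
    exact hk _
  refine ⟨_, _, H.pow_nsmul_mem hzB k, hnext, ht, fun h => ?_, by simpa using hk 0⟩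
  have ht₀ := H.arcLength_lt_of_forall_le hd hm hx₀ h₀ fun n =>
    hmin _ (H.pow_nsmul_mem hx₀ n) _ (H.isNext_pow_nsmul hd0 hm hx₀ h₀ n)
  have heq := h₀.eq_of_mem_arc hnext h ht₀ ht
  refine hzorb (m * k - k) ?_
  rw [heq, H.pow_sub_nsmul hm hzB]

/-- For distinct `z` and `z'`, the short gap obtained from `z` shows by `IsNext.arcLength_lt_or`
that the gap at `z'` is shorter than the gap at `z`. The one obtained from `z'` shows the opposite.
-/
theorem eq_of_notMem_orbit {z' : UnitAddCircle} (hz : SameItinerary d t x₀ z)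
    (hz' : SameItinerary d t x₀ z') (hzorb : ∀ n : ℕ, z ≠ d ^ n • x₀)
    (hzorb' : ∀ n : ℕ, z' ≠ d ^ n • x₀) : z = z' := by
  have hd0 : d ≠ 0 := by omega
  by_contra hne
  obtain ⟨z₁, hz₁⟩ := H.exists_isNext (H.mem_of_sameItinerary _ hx₀ _ hz)
  obtain ⟨z₁', hz₁'⟩ := H.exists_isNext (H.mem_of_sameItinerary _ hx₀ _ hz')
  have ht₀ := H.arcLength_lt_of_forall_le hd hm hx₀ h₀ fun n =>
    hmin _ (H.pow_nsmul_mem hx₀ n) _ (H.isNext_pow_nsmul hd0 hm hx₀ h₀ n)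
  obtain ⟨y, y₁, hyB, hy, hty, hny, hle⟩ := H.exists_short_gap hd hm hx₀ h₀ hmin hz hzorb hz₁
  obtain ⟨y', y₁', hyB', hy', hty', hny', hle'⟩ :=
    H.exists_short_gap hd hm hx₀ h₀ hmin hz' hzorb' hz₁'
  have h1 := h₀.arcLength_lt_or hd0 hy ht₀ hty hny (hmin _ hyB _ hy) hz hz' hne hz₁ hz₁'
  have h2 := h₀.arcLength_lt_or hd0 hy' ht₀ hty' hny' (hmin _ hyB' _ hy') hz hz' hne hz₁ hz₁'
  rcases h1 with h1 | h1 <;> rcases h2 with h2 | h2 <;> linarith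

/-- The class of the shortest gap lies in one orbit, provided it has at least three elements. -/
theorem exists_eq_pow_nsmul {u v : UnitAddCircle} (hu : SameItinerary d t x₀ u)
    (hv : SameItinerary d t x₀ v) (hw : SameItinerary d t x₀ w) (huv : u ≠ v) (huw : u ≠ w)
    (hvw : v ≠ w) (hz : SameItinerary d t x₀ z) : ∃ n : ℕ, z = d ^ n • x₀ := by
  have hd0 : d ≠ 0 := by omega
  by_contra! hzorb
  -- Since `z` is the only element off the orbit, `s = d ^ n • x₀` for some `n`, and `d ^ n` must
  -- fix `z`. It then fixes the whole class, so `s = x₀`, a contradiction.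
  obtain ⟨s, hs, hsx, hsz⟩ : ∃ s, SameItinerary d t x₀ s ∧ s ≠ x₀ ∧ s ≠ z := by
    by_contra! hno
    have h1 := hno u hu
    have h2 := hno v hv
    have h3 := hno w hw
    by_cases hux : u = x₀
    · rw [h2 (hux ▸ huv.symm), h3 (hux ▸ huw.symm)] at hvw
      exact hvw rfl
    · have hu' := h1 hux
      by_cases hvx : v = x₀
      · exact huw (hu'.trans (h3 (hvx ▸ hvw.symm)).symm)
      · exact huv (hu'.trans (h2 hvx).symm)
  obtain ⟨n, rfl⟩ : ∃ n : ℕ, s = d ^ n • x₀ := by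
    by_contra! hsorb
    exact hsz (H.eq_of_notMem_orbit hd hm hx₀ h₀ hmin hs hz hsorb hzorb)
  have hn : n ≠ 0 := by
    rintro rfl
    simp at hsx
  have hzB := H.mem_of_sameItinerary _ hx₀ _ hz
  have hfix : d ^ n • z = z := by
    refine H.eq_of_notMem_orbit hd hm hx₀ h₀ hmin (hs.trans hd0 (hz.iterate n)) hz ?_ hzorb
    intro k hk
    refine hzorb (m * n - n + k) ?_
    rw [pow_add_nsmul, ← hk, H.pow_sub_nsmul hm hzB]
  exact hsx (hz.symm.pow_nsmul_eq hd hn hfix)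

end

end IsPeriodicSystem

end

/-! ### Parts of a portrait are full itinerary classes -/

section

variable {d p : ℕ} {A : ZMod p → Set UnitAddCircle} {a b t x y z w : UnitAddCircle}

namespace IsFormalOrbitPortrait

/-- The set of all angles whose itinerary is that of an angle of the portrait. -/
theorem isPeriodicSystem [NeZero p] (hd : 2 ≤ d) (hA : IsFormalOrbitPortrait d A) {m : ℕ}
    (hm : m ≠ 0) (hper : ∀ j, ∀ x ∈ A j, d ^ m • x = x) :
    IsPeriodicSystem d m t {y | ∃ j, ∃ x ∈ A j, SameItinerary d t x y} := by
  have hd0 : d ≠ 0 := by omega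
  have hper' : ∀ y, (∃ j, ∃ x ∈ A j, SameItinerary d t x y) → d ^ m • y = y := by
    rintro y ⟨j, x, hx, hxy⟩
    exact hxy.pow_nsmul_eq hd hm (hper j x hx)
  refine ⟨?_, ?_, ?_, hper', ?_⟩
  · rintro y ⟨j, x, hx, hxy⟩
    exact hxy.symm.trans hd0 hxy
  · rintro y ⟨j, x, hx, hxy⟩ z hyz
    exact ⟨j, x, hx, hxy.trans hd0 hyz⟩
  · rintro y ⟨j, x, hx, hxy⟩
    exact ⟨j + 1, d • x, hA.nsmul_mem hx, hxy.nsmul⟩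
  · have h1 : 0 < d ^ m - 1 := by
      have := Nat.one_lt_pow hm (show 1 < d by omega)
      omega
    refine (AddCircle.finite_torsion (1 : ℝ) h1).subset fun y hy => ?_
    have h2 : (d ^ m - 1 + 1) • y = y := by
      rw [Nat.sub_add_cancel (by omega)]
      exact hper' y hy
    rwa [add_smul, one_smul, add_eq_right] at h2

variable (hd : 2 ≤ d) (hA : IsFormalOrbitPortrait d A) (hab : IsCharacteristicArc A a b)
  (hne : a ≠ b) (hnt : ∀ j, (A j).Nontrivial) (ht : t ∈ openArc a b)
include hd hA hab hne hnt ht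

/-- The class with the shortest gap is chosen. If a part were a proper subset of it, the class would
have three elements and lie in one orbit. Its gaps are then permuted transitively, so one gap
bounded by two angles of the same part makes every gap of that kind. -/
theorem exists_class_subset [NeZero p] :
    ∃ i, ∃ u ∈ A i, ∀ w, SameItinerary d t u w → w ∈ A i := by
  have hd0 : d ≠ 0 := by omega
  obtain ⟨m, hm, hper⟩ := hA.exists_period
  have H := hA.isPeriodicSystem (t := t) hd hm hper
  set B := {y | ∃ j, ∃ x ∈ A j, SameItinerary d t x y}
  have hsame : ∀ {j x y}, x ∈ A j → y ∈ A j → SameItinerary d t x y := fun hx hy =>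
    hA.sameItinerary hd hab hne hnt ht hx hy
  have hBne : B.Nonempty := by
    obtain ⟨x, hx⟩ := hA.nonempty 0
    exact ⟨x, 0, x, hx, hsame hx hx⟩
  choose! N hN using fun x (hx : x ∈ B) => H.exists_isNext hx
  obtain ⟨x₀, hx₀, hmin⟩ := Set.exists_min_image B (fun x => arcLength x (N x)) H.finite hBne
  have h₀ := hN x₀ hx₀
  have hmin' : ∀ x ∈ B, ∀ y, IsNext d t x y → arcLength x₀ (N x₀) ≤ arcLength x y :=
    fun x hx y hy => (hmin x hx).trans ((hN x hx).2 y hy.1)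
  obtain ⟨i, u, hu, hux₀⟩ := id hx₀
  refine ⟨i, u, hu, fun w hw => ?_⟩
  by_contra hwA
  obtain ⟨v, hv, hvu⟩ := (hnt i).exists_ne u
  have horb : ∀ z, SameItinerary d t x₀ z → ∃ n : ℕ, z = d ^ n • x₀ := fun z hz =>
    H.exists_eq_pow_nsmul hd hm hx₀ h₀ hmin' hux₀.symm (hux₀.symm.trans hd0 (hsame hu hv))
      (hux₀.symm.trans hd0 hw) hvu.symm (by rintro rfl; exact hwA hu)
      (by rintro rfl; exact hwA hv) hz
  have hClass : ∀ z, SameItinerary d t x₀ z → z ∈ B := H.mem_of_sameItinerary _ hx₀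
  obtain ⟨l₀, hx₀l⟩ : ∃ l, x₀ ∈ A l := by
    obtain ⟨n, hn⟩ := horb u hux₀.symm
    have := hA.pow_nsmul_mem hu (m * n - n)
    rw [hn, H.pow_sub_nsmul hm hx₀] at this
    exact ⟨_, this⟩
  have hmem : ∀ z, SameItinerary d t x₀ z → ∃ l, z ∈ A l := fun z hz => by
    obtain ⟨n, rfl⟩ := horb z hz
    exact ⟨_, hA.pow_nsmul_mem hx₀l n⟩
  -- The closest pair within a common part bounds a gap of the class. An angle in between would
  -- belong to another part, and by unlinkedness that part would have a second angle there, giving a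
  -- closer pair.
  obtain ⟨⟨x, y⟩, ⟨hxy, hx, hy, k, hxk, hyk⟩, hshort⟩ := Set.exists_min_image
    {q : UnitAddCircle × UnitAddCircle | q.1 ≠ q.2 ∧ SameItinerary d t x₀ q.1 ∧
      SameItinerary d t x₀ q.2 ∧ ∃ k, q.1 ∈ A k ∧ q.2 ∈ A k} (fun q => arcLength q.1 q.2)
    ((H.finite.prod H.finite).subset fun q hq => ⟨hClass _ hq.2.1, hClass _ hq.2.2.1⟩)
    ⟨(u, v), hvu.symm, hux₀.symm, hux₀.symm.trans hd0 (hsame hu hv), i, hu, hv⟩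
  simp only at hxy hx hy hxk hyk hshort
  have hnext : IsNext d t x y := by
    refine ⟨hx.symm.trans hd0 hy, fun z hz => ?_⟩
    by_contra! hlt
    have hz₀ := hx.trans hd0 hz
    obtain ⟨l, hzl⟩ := hmem z hz₀
    have hxz : x ≠ z := by
      rintro rfl
      rw [arcLength_self] at hlt
      linarith [arcLength_le_one x y]
    rcases eq_or_ne k l with rfl | hkl
    · exact not_lt.2 (hshort (x, z) ⟨hxz, hx, hz₀, k, hxk, hzl⟩) hlt
    · obtain ⟨z', hz'l, hzz'⟩ := (hnt l).exists_ne z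
      have hz'₀ := hz₀.trans hd0 (hsame hzl hz'l)
      have hun := hA.unlinked_others k l hkl 0 (by omega)
      rw [rotate_zero] at hun
      have hz'in : z' ∈ openArc x y := by
        refine (mem_openArc_or hxy ?_ ?_).resolve_right
          (hun.not_crossing hxk hyk hzl hz'l hxy hlt) <;> rintro rfl
        · exact hkl (hA.eq_of_mem hd0 hxk hz'l)
        · exact hkl (hA.eq_of_mem hd0 hyk hz'l)
      rw [mem_openArc] at hz'in
      rcases lt_trichotomy (arcLength x z) (arcLength x z') with h | h | h
      · have h1 : arcLength x y ≤ arcLength z z' :=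
          hshort (z, z') ⟨hzz'.symm, hz₀, hz'₀, l, hzl, hz'l⟩
        rw [arcLength_sub_of_lt h] at h1
        linarith [arcLength_pos x z]
      · exact hzz' (arcLength_right_injective h).symm
      · have h1 : arcLength x y ≤ arcLength z' z :=
          hshort (z', z) ⟨hzz', hz'₀, hz₀, l, hz'l, hzl⟩
        rw [arcLength_sub_of_lt h] at h1
        linarith [arcLength_pos x z']
  -- All elements are iterates of `x`, so every gap of the class is an iterate of the gap from `x`
  -- to `y`.
  have hall : ∀ z, SameItinerary d t x₀ z → ∃ s, IsNext d t z s ∧ ∀ l, z ∈ A l → s ∈ A l := by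
    intro z hz
    obtain ⟨n, rfl⟩ := horb x hx
    obtain ⟨n', rfl⟩ := horb z hz
    have hback : d ^ (n' + (m * n - n)) • d ^ n • x₀ = d ^ n' • x₀ := by
      rw [pow_add_nsmul, H.pow_sub_nsmul hm hx₀]
    refine ⟨d ^ (n' + (m * n - n)) • y, ?_, fun l hl => ?_⟩
    · rw [← hback]
      exact H.isNext_pow_nsmul hd0 hm (hClass _ hx) hnext _
    · have h1 := hA.pow_nsmul_mem hxk (n' + (m * n - n))
      rw [hback] at h1
      rw [hA.eq_of_mem hd0 hl h1]
      exact hA.pow_nsmul_mem hyk _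
  -- Let `q` outside `A i` follow `z` in `A i` as closely as possible. The successor of `z` is again
  -- in `A i` and is closer to `q`.
  obtain ⟨⟨z, q⟩, ⟨hz, hq, hqA⟩, hshort'⟩ := Set.exists_min_image
    {q : UnitAddCircle × UnitAddCircle | q.1 ∈ A i ∧ SameItinerary d t u q.2 ∧ q.2 ∉ A i}
    (fun q => arcLength q.1 q.2)
    ((H.finite.prod H.finite).subset fun q hq =>
      ⟨⟨i, q.1, hq.1, hsame hq.1 hq.1⟩, ⟨i, u, hu, hq.2.1⟩⟩) ⟨(u, w), hu, hw, hwA⟩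
  simp only at hz hq hqA hshort'
  obtain ⟨s, hs, hsA⟩ := hall z (hux₀.symm.trans hd0 (hsame hu hz))
  have hsi := hsA i hz
  have h1 := hs.2 q ((hsame hz hu).trans hd0 hq)
  have h2 : arcLength z s < arcLength z q := lt_of_le_of_ne h1 fun h =>
    hqA (arcLength_right_injective h ▸ hsi)
  have h3 : arcLength z q ≤ arcLength s q := hshort' (s, q) ⟨hsi, hq, hqA⟩
  rw [arcLength_sub_of_lt h2] at h3
  linarith [arcLength_pos z s]

/-- A power of `d` carries `A k` into the part known to be a full class, and by periodicity a
further power leads back. -/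
theorem mem_of_sameItinerary [NeZero p] {k : ZMod p} (hx : x ∈ A k)
    (hxy : SameItinerary d t x y) : y ∈ A k := by
  have hd0 : d ≠ 0 := by omega
  obtain ⟨m, hm, hper⟩ := hA.exists_period
  have H := hA.isPeriodicSystem (t := t) hd hm hper
  obtain ⟨i, u, hu, hclass⟩ := hA.exists_class_subset hd hab hne hnt ht
  have hxB : x ∈ {y | ∃ j, ∃ x ∈ A j, SameItinerary d t x y} :=
    ⟨k, x, hx, hA.sameItinerary hd hab hne hnt ht hx hx⟩
  have hyB := H.mem_of_sameItinerary _ hxB _ hxy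
  set n := (i - k).val
  have hn : k + (n : ZMod p) = i := by rw [ZMod.natCast_zmod_val, add_sub_cancel]
  have hxi := hA.pow_nsmul_mem hx n
  rw [hn] at hxi
  have hyi : d ^ n • y ∈ A i := hclass _
    ((hA.sameItinerary hd hab hne hnt ht hu hxi).trans hd0 (hxy.iterate n))
  have hx' := hA.pow_nsmul_mem hxi (m * n - n)
  have hy' := hA.pow_nsmul_mem hyi (m * n - n)
  rw [H.pow_sub_nsmul hm hxB] at hx'
  rw [H.pow_sub_nsmul hm hyB] at hy'
  rwa [hA.eq_of_mem hd0 hx hx']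

end IsFormalOrbitPortrait

/-! ### The portrait of a fixed point of angle zero, and trivial portraits -/

theorem SameItinerary.eq_of_nsmul_eq (hd : 2 ≤ d) (h : SameItinerary d t x y) (hx : d • x = x) :
    x = y := by
  have hy : d • y = y := by
    simpa using h.pow_nsmul_eq hd one_ne_zero (by simpa using hx)
  have hd' : (2 : ℝ) ≤ d := by exact_mod_cast hd
  by_contra hne
  have h1 := arcLength_pos x y
  have h2 := arcLength_lt_one_iff.2 hne
  rcases h.sameSector.arcLength_nsmul (by omega) with ⟨h3, -⟩ | ⟨h3, -⟩ <;>
  rw [hx, hy] at h3 <;> nlinarith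

theorem sameItinerary_self (hd : d ≠ 0) (h : ∀ n : ℕ, d • d ^ n • x ≠ t) :
    SameItinerary d t x x := fun n => sameSector_self hd (h n)

/-- For `t = 0` no open sector contains `0`, so on a sector the coordinates measured from `0` and
from its left end `e` differ by a constant. -/
theorem SameSector.arcLength_sub_eq (hd : d ≠ 0) (h : SameSector d 0 x y) :
    arcLength 0 (d • x) - arcLength 0 (d • y) = d * (arcLength 0 x - arcLength 0 y) := by
  have h0 : (0 : ℝ) < d := by exact_mod_cast (by omega : 0 < d)
  obtain ⟨e, he, hx, hy⟩ := h
  rw [arcLength_of_sector hd he hx, arcLength_of_sector hd he hy, ← mul_sub]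
  congr 1
  have hlow : ∀ {z}, arcLength e z < 1 / d → arcLength e z < arcLength e 0 := by
    intro z hz
    refine hz.trans_le ?_
    by_contra! h
    have h1 := arcLength_of_sector hd he h
    rw [smul_zero, arcLength_self] at h1
    rw [lt_div_iff₀' h0] at h
    linarith
  have hx' := arcLength_eq_ite e 0 x
  have hy' := arcLength_eq_ite e 0 y
  rw [if_neg (not_lt.2 (hlow hx).le)] at hx'
  rw [if_neg (not_lt.2 (hlow hy).le)] at hy'
  linarith

/-- The sectors correspond to base `d` digits: along equal itineraries the difference of coordinates
is multiplied by `d` at each step, yet stays below `1`. -/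
theorem SameItinerary.eq_of_zero (hd : 2 ≤ d) (h : SameItinerary d 0 x y) : x = y := by
  have hd' : (1 : ℝ) < d := by exact_mod_cast (by omega : 1 < d)
  have key : ∀ n : ℕ, arcLength 0 (d ^ n • x) - arcLength 0 (d ^ n • y) =
      d ^ n * (arcLength 0 x - arcLength 0 y) := by
    intro n
    induction n with
    | zero => simp
    | succ n ih =>
      simp only [add_comm n 1, pow_add_nsmul d 1 n, pow_one]
      rw [(h n).arcLength_sub_eq (by omega), ih]
      ring
  by_contra hne
  have h1 : 0 < |arcLength 0 x - arcLength 0 y| :=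
    abs_pos.2 (sub_ne_zero.2 fun h => hne (arcLength_right_injective h))
  obtain ⟨n, hn⟩ := (((tendsto_pow_atTop_atTop_of_one_lt hd').atTop_mul_const h1).eventually_ge_atTop
    1).exists
  have h2 : |arcLength 0 (d ^ n • x) - arcLength 0 (d ^ n • y)| < 1 := by
    rw [abs_sub_lt_iff]
    constructor <;> linarith [arcLength_pos 0 (d ^ n • x), arcLength_pos 0 (d ^ n • y),
      arcLength_le_one 0 (d ^ n • x), arcLength_le_one 0 (d ^ n • y)]
  rw [key, abs_mul, abs_of_pos (by positivity)] at h2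
  linarith

/-! ### Realization -/

theorem IsFormalOrbitPortrait.hasRepellingOrbitWithPortrait [NeZero p] (hd : 2 ≤ d)
    (hA : IsFormalOrbitPortrait d A) (hnontriv : IsNontrivial A)
    (hab : IsCharacteristicArc A a b) {c : ℂ} (ht : t ∈ openArc a b)
    (hc : HasExternalAngle d c t) : HasRepellingOrbitWithPortrait d c A := by
  have hd0 : d ≠ 0 := by omega
  obtain ⟨m, hm, hper⟩ := hA.exists_period
  refine hasRepellingOrbitWithPortrait_of_itinerary hd hc hA.nonempty
    (fun j θ hθ => hA.nsmul_mem hθ) hm hper (fun j x hx y => ?_)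
    fun i j θ hi hj => hA.eq_of_mem hd0 hi hj
  rcases hnontriv with ⟨i, hi⟩ | ⟨rfl, h0⟩
  · have hnt := hA.nontrivial hi
    have hne : a ≠ b := by
      rintro rfl
      obtain ⟨k, hak, -, hdisj⟩ := hab.1
      obtain ⟨v, hv, hva⟩ := (hnt k).exists_ne a
      refine Set.disjoint_left.1 hdisj ?_ hv
      rw [mem_openArc, arcLength_self]
      exact arcLength_lt_one_iff.2 hva.symm
    exact ⟨fun hy => hA.sameItinerary hd hab hne hnt ht hx hy,
      fun h => hA.mem_of_sameItinerary hd hab hne hnt ht hx h⟩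
  -- For the portrait `{{0}}` the characteristic arc is the circle without `0`.
  · obtain ⟨k, hak, hbk, -⟩ := hab.1
    have hzero : ∀ j, A j = {0} := fun j => Subsingleton.elim 0 j ▸ h0
    rw [hzero, mem_singleton_iff] at hak hbk hx
    subst hak hbk hx
    rw [hzero, mem_singleton_iff]
    constructor
    · rintro rfl
      refine sameItinerary_self hd0 fun n h => ?_
      rw [smul_zero, smul_zero] at h
      rw [← h, mem_openArc] at ht
      exact lt_irrefl _ ht
    · exact fun h => (h.eq_of_nsmul_eq hd (smul_zero d)).symm

/-- No part contains `0`: such a part would be fixed, and the portrait would be `{{0}}`, which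
counts as nontrivial. So all angles have itineraries relative to `0`, and these separate angles. -/
theorem IsFormalOrbitPortrait.hasRepellingOrbitWithPortrait_of_trivial [NeZero p] (hd : 2 ≤ d)
    (hA : IsFormalOrbitPortrait d A) (htriv : ¬ IsNontrivial A) {c : ℂ}
    (hc : HasExternalAngle d c 0) : HasRepellingOrbitWithPortrait d c A := by
  have hd0 : d ≠ 0 := by omega
  obtain ⟨m, hm, hper⟩ := hA.exists_period
  obtain ⟨hnt, hzero⟩ := not_or.1 htriv
  rw [not_exists] at hnt
  have hsub : ∀ j, (A j).Subsingleton := fun j => Set.not_nontrivial_iff.1 (hnt j)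
  have hne0 : ∀ j, ∀ x ∈ A j, x ≠ 0 := by
    rintro j _ hx rfl
    have h1 := hA.nsmul_mem hx
    rw [smul_zero] at h1
    have h2 := hA.eq_of_mem hd0 hx h1
    obtain rfl : p = 1 := by
      have h3 : (1 : ZMod p) = 0 := add_eq_left.1 h2.symm
      exact (ZMod.one_eq_zero_iff).1 h3
    obtain rfl : j = 0 := Subsingleton.elim _ _
    exact hzero ⟨rfl, (hsub 0).eq_singleton_of_mem hx⟩
  refine hasRepellingOrbitWithPortrait_of_itinerary hd hc hA.nonempty
    (fun j θ hθ => hA.nsmul_mem hθ) hm hper (fun j x hx y => ?_)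
    fun i j θ hi hj => hA.eq_of_mem hd0 hi hj
  constructor
  · intro hy
    obtain rfl := hsub j hx hy
    exact sameItinerary_self hd0 fun n => hne0 _ _ (hA.nsmul_mem (hA.pow_nsmul_mem hx n))
  · intro h
    exact h.eq_of_zero hd ▸ hx

end

end

end Unicritical

theorem mainTheorem11 (d : ℕ) (hd : 2 ≤ d) (p : ℕ) [NeZero p]
    (A : ZMod p → Set UnitAddCircle) (hA : Unicritical.IsFormalOrbitPortrait d A) :
    (∃ c : ℂ, c ∉ Unicritical.multibrot d ∧
      Unicritical.HasRepellingOrbitWithPortrait d c A) ∧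
    (Unicritical.IsNontrivial A →
      ∀ a b : UnitAddCircle, Unicritical.IsCharacteristicArc A a b →
        (∃ c : ℂ, c ∉ Unicritical.multibrot d ∧
          ∃ t ∈ Unicritical.openArc a b, Unicritical.HasExternalAngle d c t) ∧
        ∀ c : ℂ, c ∉ Unicritical.multibrot d →
          ∀ t ∈ Unicritical.openArc a b, Unicritical.HasExternalAngle d c t →
            Unicritical.HasRepellingOrbitWithPortrait d c A) := by
  refine ⟨?_, fun hnt a b hab => ⟨?_, fun c _ t ht hc =>
    hA.hasRepellingOrbitWithPortrait hd hnt hab ht hc⟩⟩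
  · by_cases hnt : Unicritical.IsNontrivial A
    · obtain ⟨a, b, hab⟩ :=
        Unicritical.IsCharacteristicArc.exists_of_finite hA.nonempty hA.finite
      obtain ⟨t, ht⟩ := Unicritical.openArc_nonempty a b
      obtain ⟨c, hc, hct⟩ := Unicritical.exists_hasExternalAngle hd t
      exact ⟨c, Unicritical.notMem_multibrot hd hc,
        hA.hasRepellingOrbitWithPortrait hd hnt hab ht hct⟩
    · obtain ⟨c, hc, hct⟩ := Unicritical.exists_hasExternalAngle hd 0
      exact ⟨c, Unicritical.notMem_multibrot hd hc,
        hA.hasRepellingOrbitWithPortrait_of_trivial hd hnt hct⟩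
  · obtain ⟨t, ht⟩ := Unicritical.openArc_nonempty a b
    obtain ⟨c, hc, hct⟩ := Unicritical.exists_hasExternalAngle hd t
    exact ⟨c, Unicritical.notMem_multibrot hd hc, t, ht, hct⟩
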